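/- **Setting.** Let the state space $E$ be $[0,\infty)$ or $(0,\infty)$ (the second case covers flows such as $\phi(x,t)=xe^{ct}$, for which $0$ is a fixed point). Let $\phi:E\times[0,\infty)\to E$ be a $\mathcal C^1$ flow: $\phi(x,0)=x$, $\phi(x,t+s)=\phi(\phi(x,s),t)$, each $\phi(\cdot,t)$ is a homeomorphism onto its image, and each $\phi_x:=\phi(x,\cdot)$ is a $\mathcal C^1$-diffeomorphism from $[0,\infty)$ onto $[x,\infty)$. Let $f:[0,\infty)\to[0,\infty)$ be an increasing $\mathcal C^1$-diffeomorphism, and put $g_x(y)=[(f\circ\phi_x)^{-1}]'(y)$ for $y\ge f(x)$. Assume that there are $\kappa\in(0,1)$ and continuous functions $0<\mathbf m\le\mathbf M$ on $(0,\infty)$ such that $0<f(x)\le\kappa x$ for $x>0$, and $\mathbf m(y)\le g_x(y)\le\mathbf M(y)$ for all $x\in E$ and all $y>0$ with $y\ge f(x)$. Let $\mathcal I=[i_1,i_2]$ with $0<i_1<i_2$, let $b>0$, and let $\mathfrak c=(r,L,\mathbf a)$ be positive constants with $r>i_2$ and $r\ge f^{-1}\big(\big[\tfrac{-\ln(1-\kappa^{b+1})}{1-\kappa^{b+1}}\big]^{1/(b+1)}\big)$.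 Let $\mathcal F(\mathfrak c,b)$ be the set of continuous $\lambda:[0,\infty)\to[0,\infty)$ with $\frac{f(x)^b}{\mathbf m(f(x))}\le\frac{\lambda(x)}{\mathbf a}$ for all $x\ge r$ and $\int_0^{f(r)}\mathbf M(u)\lambda(f^{-1}(u))\,du\le L$. For $x_0\in E$ let $(Z_k)_{k\ge0}$ be the chain of post-jump locations of the piecewise deterministic Markov process with flow $\phi$, jump rate $\lambda$ and jumps $x\mapsto f(x)$, started at $Z_0=x_0$: given the past up to the $k$-th jump, the waiting time $\tau_k$ until the next jump satisfies $P(\tau_k>t)=\exp\big(-\int_0^t\lambda(\phi(Z_k,s))ds\big)$ for $t\ge0$, and $Z_{k+1}=f(\phi(Z_k,\tau_k))$. Its transition probability is $$\mathcal P_\lambda(x,dy)=\lambda(f^{-1}(y))\,g_x(y)\,e^{-\int_{f(x)}^y\lambda(f^{-1}(u))g_x(u)du}\,\mathbf 1_{\{y\ge f(x)\}}\,dy .$$ Put $\mathbb V(x)=\exp\big(\frac{\mathbf a}{b+1}f(x)^{b+1}\big)$. **Claim.** There are constants $R>0$, $\gamma\in(0,1)$ and $K$, depending only on $E,\phi,f,\mathbf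 m,\mathbf M,\kappa,\mathcal I,\mathfrak c,b$, such that the following holds. 1. For every $\lambda\in\mathcal F(\mathfrak c,b)$ there is a unique invariant probability measure of $\mathcal P_\lambda$ on $E$. It has a density $\nu_\lambda$ on $[0,\infty)$, with $\int\mathbb V\nu_\lambda\le K$, and for all measurable $h$ with $|h|\le\mathbb V$ on $E$, all $k\ge0$ and all $x\in E$, $$\Big|\mathcal P_\lambda^kh(x)-\int h\,\nu_\lambda\Big|\le R\,\mathbb V(x)\,\gamma^k .$$ 2. For all $x_0\in E$ and $\psi_1,\psi_2>0$ there is a constant $c$ such that the following holds for all $\lambda\in\mathcal F(\mathfrak c,b)$. Let $\mathcal A\subset[0,\infty)$ be compact with $f(\mathcal I)\subseteq\mathcal A$. Let $(S_m)_{m\in\mathbb N}$ be an increasing sequence of subspaces of $L^2(\mathcal A)$ of finite dimensions $D_m$, with $\|s\|_\infty^2\le\psi_1D_m\|s\|_{L^2}^2$ for all $m$ and all $s\in S_m$. Let $m\in\mathbb N$ and let $(\varphi_l)_{1\le l\le D_m}$ be an orthonormal basis of $S_m$ with $\big\|\sum_l\|\varphi_l\|_\infty|\varphi_l|\big\|_\infty\le\psi_2D_m$.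 Let $\nu_m=\sum_l\big(\int_{\mathcal A}\varphi_l\nu_\lambda\big)\varphi_l$ and $\hat\nu_m=\sum_l\hat a_l\varphi_l$, where $\hat a_l=\frac1n\sum_{k=1}^n\varphi_l(Z_k)$ and $\varphi_l$ is extended by $0$ outside $\mathcal A$. Then for every $n\ge1$ with $D_m^2\le n$, $$E\|\hat\nu_m-\nu_\lambda\|^2_{L^2(\mathcal A)}\le\|\nu_m-\nu_\lambda\|^2_{L^2(\mathcal A)}+C_\lambda\frac{D_m}{n}+\frac cn\quad\text{in }[0,\infty],$$ where $C_\lambda=\psi_1+\psi_2\int G_\lambda(z)\nu_\lambda(z)dz$ and $G_\lambda(z)=\frac R{1-\gamma}\big(\mathbb V(z)+\int\mathbb V\nu_\lambda\big)$. In particular $C_\lambda\le\psi_1+\frac{2\psi_2RK}{1-\gamma}$ uniformly over $\lambda\in\mathcal F(\mathfrak c,b)$. -/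

import Mathlib

open MeasureTheory ProbabilityTheory Set Module
open scoped ENNReal

noncomputable section

namespace PDMP

/-- `h` is a `C¹`-diffeomorphism from `s` onto `t`. -/
structure IsC1Diffeo (h : ℝ → ℝ) (s t : Set ℝ) : Prop where
  bijOn : BijOn h s t
  contDiffOn : ContDiffOn ℝ 1 h s
  contDiffOn_inv : ContDiffOn ℝ 1 (Function.invFunOn h s) t

/-- `φ x t` is the position at time `t ≥ 0` of the flow started from `x ∈ E`. Since `φ (·, t)` is
continuous on the interval `E`, being injective it is a homeomorphism onto its image. -/
structure IsFlow (E : Set ℝ) (φ : ℝ → ℝ → ℝ) : Prop where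
  contDiffOn : ContDiffOn ℝ 1 (fun q : ℝ × ℝ => φ q.1 q.2) (E ×ˢ Ici 0)
  injOn : ∀ t, 0 ≤ t → InjOn (fun x => φ x t) E
  zero : ∀ x ∈ E, φ x 0 = x
  semigroup : ∀ x ∈ E, ∀ t s, 0 ≤ t → 0 ≤ s → φ x (t + s) = φ (φ x s) t
  diffeo : ∀ x ∈ E, IsC1Diffeo (φ x) (Ici 0) (Ici x)

/-- The deterministic jump `x ↦ f x`: an increasing `C¹`-diffeomorphism of `[0, ∞)`. -/
structure IsJumpMap (f : ℝ → ℝ) : Prop where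
  diffeo : IsC1Diffeo f (Ici 0) (Ici 0)
  strictMonoOn : StrictMonoOn f (Ici 0)

/-- The inverse of `f` on `[0, ∞)`. -/
def finv (f : ℝ → ℝ) : ℝ → ℝ := Function.invFunOn f (Ici 0)

/-- `g x` is the derivative of the inverse of `f ∘ φ x`, on the range `[f x, ∞)` of `f ∘ φ x`. -/
def g (φ : ℝ → ℝ → ℝ) (f : ℝ → ℝ) (x y : ℝ) : ℝ :=
  derivWithin (Function.invFunOn (fun t => f (φ x t)) (Ici 0)) (Ici (f x)) y

/-- The conditions on the known functions: `0 < f x ≤ κ x`, and `mlo y ≤ g_x(y) ≤ Mup y` wherever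
`g_x` is defined, with `mlo`, `Mup` continuous and positive. -/
structure Bounds (E : Set ℝ) (φ : ℝ → ℝ → ℝ) (f mlo Mup : ℝ → ℝ) (κ : ℝ) : Prop where
  κ_pos : 0 < κ
  κ_lt_one : κ < 1
  f_bounds : ∀ x, 0 < x → 0 < f x ∧ f x ≤ κ * x
  mlo_cont : ContinuousOn mlo (Ioi 0)
  Mup_cont : ContinuousOn Mup (Ioi 0)
  mlo_pos : ∀ y, 0 < y → 0 < mlo y
  mlo_le_Mup : ∀ y, 0 < y → mlo y ≤ Mup y
  g_bounds : ∀ x ∈ E, ∀ y, 0 < y → f x ≤ y → mlo y ≤ g φ f x y ∧ g φ f x y ≤ Mup y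

/-- The lower bound required of the threshold `r`. -/
def rMin (f : ℝ → ℝ) (κ b : ℝ) : ℝ :=
  finv f ((-Real.log (1 - κ ^ (b + 1)) / (1 - κ ^ (b + 1))) ^ (1 / (b + 1)))

/-- The class `𝓕(𝔠, b)`, `𝔠 = (r, L, a)`, of jump rates on `[0, ∞)`. -/
def rateClass (f mlo Mup : ℝ → ℝ) (r L a b : ℝ) : Set (ℝ → ℝ) :=
  {lam | ContinuousOn lam (Ici 0) ∧ (∀ x, 0 ≤ x → 0 ≤ lam x) ∧
    (∀ x, r ≤ x → f x ^ b / mlo (f x) ≤ lam x / a) ∧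
    IntegrableOn (fun u => Mup u * lam (finv f u)) (Ioc 0 (f r)) ∧
    ∫ u in Ioc 0 (f r), Mup u * lam (finv f u) ≤ L}

/-- The cumulated jump rate `Λ(x, t)` along the flow started from `x`. -/
def cumRate (φ : ℝ → ℝ → ℝ) (lam : ℝ → ℝ) (x t : ℝ) : ℝ := ∫ s in (0 : ℝ)..t, lam (φ x s)

/-- `Z` is the chain of post-jump locations of the piecewise deterministic Markov process with
flow `φ`, jump rate `lam` and jumps `x ↦ f x`, started from `x₀`. Here `τ k` is the time between the
`k`-th and the `(k+1)`-th jump: given the past, it has survival function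
`t ↦ exp (-Λ(Z_k, t))`, and then `Z_{k+1} = f (φ (Z_k, τ k))`. -/
def IsJumpChain (φ : ℝ → ℝ → ℝ) (f lam : ℝ → ℝ) (x₀ : ℝ)
    {Ω : Type*} [mΩ : MeasurableSpace Ω] (P : Measure Ω) (Z : ℕ → Ω → ℝ) : Prop :=
  ∃ (ℱ : Filtration ℕ mΩ) (τ : ℕ → Ω → ℝ),
    Adapted ℱ Z ∧ (∀ k, Measurable (τ k)) ∧
    (∀ᵐ ω ∂P, Z 0 ω = x₀) ∧
    (∀ k, ∀ᵐ ω ∂P, Z (k + 1) ω = f (φ (Z k ω) (τ k ω))) ∧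
    ∀ k t, 0 ≤ t →
      P[{ω | t < τ k ω}.indicator (fun _ => (1 : ℝ)) | ℱ k]
        =ᵐ[P] fun ω => Real.exp (-cumRate φ lam (Z k ω) t)

/-- The transition density `𝒫_λ(x, y)` of the chain of post-jump locations. -/
def transDensity (φ : ℝ → ℝ → ℝ) (f lam : ℝ → ℝ) (x y : ℝ) : ℝ :=
  (Ici (f x)).indicator (fun y => lam (finv f y) * g φ f x y *
    Real.exp (-∫ u in (f x)..y, lam (finv f u) * g φ f x u)) y

/-- The transition probability `𝒫_λ(x, dy) = 𝒫_λ(x, y) dy`. -/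
def transMeasure (φ : ℝ → ℝ → ℝ) (f lam : ℝ → ℝ) (x : ℝ) : Measure ℝ :=
  volume.withDensity fun y => ENNReal.ofReal (transDensity φ f lam x y)

/-- The transition operator `h ↦ 𝒫_λ h`. -/
def transOp (φ : ℝ → ℝ → ℝ) (f lam h : ℝ → ℝ) : ℝ → ℝ :=
  fun x => ∫ y, h y ∂(transMeasure φ f lam x)

/-- `μ` is an invariant probability measure on the state space `E`. -/
structure IsInvariant (E : Set ℝ) (φ : ℝ → ℝ → ℝ) (f lam : ℝ → ℝ) (μ : Measure ℝ) : Prop where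
  prob : IsProbabilityMeasure μ
  compl : μ Eᶜ = 0
  invariant : ∀ B, MeasurableSet B → ∫⁻ x, transMeasure φ f lam x B ∂μ = μ B

/-- The measure `ν(x) dx` on `[0, ∞)`. -/
def densityMeasure (ν : ℝ → ℝ) : Measure ℝ :=
  (volume.restrict (Ici 0)).withDensity fun x => ENNReal.ofReal (ν x)

/-- `ν` is the density of the unique invariant probability measure. -/
structure IsStationaryDensity (E : Set ℝ) (φ : ℝ → ℝ → ℝ) (f lam ν : ℝ → ℝ) : Prop where
  measurable : Measurable ν
  nonneg : ∀ x, 0 ≤ ν x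
  invariant : IsInvariant E φ f lam (densityMeasure ν)
  unique : ∀ μ : Measure ℝ, IsInvariant E φ f lam μ → μ = densityMeasure ν

/-- The weight `𝕍(x) = exp (a / (b + 1) * f(x)^(b+1))`. -/
def V (f : ℝ → ℝ) (a b x : ℝ) : ℝ := Real.exp (a / (b + 1) * f x ^ (b + 1))

/-- Geometric convergence of `𝒫_λ^k` to the stationary law, in the norm weighted by `𝕍`. -/
def Contraction (E : Set ℝ) (φ : ℝ → ℝ → ℝ) (f lam ν : ℝ → ℝ) (a b R γ : ℝ) : Prop :=
  ∀ h : ℝ → ℝ, Measurable h → (∀ x ∈ E, |h x| ≤ V f a b x) → ∀ k : ℕ, ∀ x ∈ E,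
    |(transOp φ f lam)^[k] h x - ∫ z in Ici 0, h z * ν z| ≤ R * V f a b x * γ ^ k

/-- The function `G_λ(z) = R / (1 - γ) * (𝕍(z) + ∫ 𝕍 ν_λ)`. -/
def G (f ν : ℝ → ℝ) (a b R γ z : ℝ) : ℝ :=
  R / (1 - γ) * (V f a b z + ∫ x in Ici 0, V f a b x * ν x)

/-- `L²(A)`, with respect to Lebesgue measure. -/
abbrev L2 (A : Set ℝ) : Type := Lp ℝ 2 ((volume : Measure ℝ).restrict A)

/-- The `L^∞(A)` norm of a function. -/
def supNorm (A : Set ℝ) (s : ℝ → ℝ) : ℝ≥0∞ := eLpNorm s ⊤ (volume.restrict A)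

/-- `S` is an increasing sequence of finite-dimensional subspaces of `L²(A)`, on which
`‖s‖_∞² ≤ ψ₁ D_m ‖s‖²_{L²}`, where `D_m = dim S_m`. -/
structure IsModelSequence (A : Set ℝ) (ψ₁ : ℝ) (S : ℕ → Submodule ℝ (L2 A)) : Prop where
  mono : Monotone S
  finiteDimensional : ∀ m, FiniteDimensional ℝ (S m)
  sup_le : ∀ m, ∀ s ∈ S m, supNorm A s ^ 2 ≤ ENNReal.ofReal (ψ₁ * finrank ℝ (S m) * ‖s‖ ^ 2)

/-- The orthonormal basis `e` satisfies `‖∑ₗ ‖eₗ‖_∞ |eₗ|‖_∞ ≤ ψ₂ D`. -/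
def IsGoodBasis (A : Set ℝ) (ψ₂ : ℝ) {D : ℕ} {S : Submodule ℝ (L2 A)}
    (e : OrthonormalBasis (Fin D) ℝ S) : Prop :=
  ∀ᵐ x ∂(volume.restrict A),
    ∑ l, supNorm A (e l : L2 A) * ENNReal.ofReal |(e l : L2 A) x| ≤ ENNReal.ofReal (ψ₂ * D)

/-- `ν_m = ∑ₗ aₗ eₗ` with `aₗ = ∫_A eₗ ν`, the orthogonal projection of `ν` on `S_m`. -/
def proj (A : Set ℝ) {D : ℕ} {S : Submodule ℝ (L2 A)} (e : OrthonormalBasis (Fin D) ℝ S)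
    (ν : ℝ → ℝ) (x : ℝ) : ℝ :=
  ∑ l, (∫ y in A, (e l : L2 A) y * ν y) * (e l : L2 A) x

/-- The empirical coefficient `âₗ = (1/n) ∑_{k=1}^n eₗ(Z_k)`; functions of `L²(A)` are extended
by `0` outside `A`. -/
def empCoeff (A : Set ℝ) {D : ℕ} {S : Submodule ℝ (L2 A)} (e : OrthonormalBasis (Fin D) ℝ S)
    (n : ℕ) (z : ℕ → ℝ) (l : Fin D) : ℝ :=
  (1 / (n : ℝ)) * ∑ k ∈ Finset.Icc 1 n, A.indicator (fun y => (e l : L2 A) y) (z k)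

/-- The projection estimator `ν̂_m = ∑ₗ âₗ eₗ`, computed from the observed trajectory `z`. -/
def estimator (A : Set ℝ) {D : ℕ} {S : Submodule ℝ (L2 A)} (e : OrthonormalBasis (Fin D) ℝ S)
    (n : ℕ) (z : ℕ → ℝ) (x : ℝ) : ℝ :=
  ∑ l, empCoeff A e n z l * (e l : L2 A) x

/-- The squared `L²(A)` norm, with values in `[0, ∞]`. -/
def sqNorm (A : Set ℝ) (s : ℝ → ℝ) : ℝ≥0∞ := eLpNorm s 2 (volume.restrict A) ^ 2

end PDMP

end

/-! The theorem is Harris' theorem with constants that do not see the jump rate, followed by a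
covariance estimate. In the variable y = f(φ(x,t)) the next jump has hazard λ(f⁻¹y) g_x(y), and for
y ≥ f(max r x) the definition of the class forces this to be at least a y^b (`hazard_ge`).

Drift. As f(y) ≤ κy, the weight satisfies V(y) ≤ W(y) = exp(κ^(b+1) a/(b+1) y^(b+1)), and W grows
more slowly than the survival function decays. An exact derivative bounds the tail integral of W
(`setLIntegral_driftBound_le`), so that P V(x) is at most a constant times W(f(max r x)). For x ≥ r
one has W(f x) = V(x)^(κ^(b+1)) with exponent below 1, whence P V ≤ V/2 + C (`exists_drift_const`).

Minorization. From x ≤ r the transition density dominates, on [f r, r], a density that does not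
depend on x; the bound L controls the hazard spent before f r (`minorMeasure_le`). From x ≥ r one
step lands below qx, for some q < 1, with probability bounded below (`transMeasure_Iic_ge`). Hence a
fixed number of steps minorizes each level set of V (`exists_isMinorized`), and
`exists_geometric_contraction` yields the rate.

Invariant law. Contraction between two starting points makes the laws of the chain Cauchy in L¹; the
limit is the stationary density (`IsContracting.exists_density`). Averaging the contraction against
it gives convergence and uniqueness.

Estimation. The conditional survival functions determine the joint law of state and waiting time,
hence the Markov property (`condExp_comp_jump`). By Pythagoras the risk is the bias plus the summed
second moments of the coefficient errors. Variances sum to O(D) through ∑ e_l² ≤ ψ₁D. A covariance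
at lag i gains γ^i from the contraction with constant ‖e_l‖_∞, and ∑ ‖e_l‖_∞|e_l| ≤ ψ₂D keeps the
sum over l linear in D. The non-stationary start adds O(D) in total to the partial sums, that is
O(D/n²) ≤ c/n to the risk. -/

noncomputable section

namespace PDMP

/-! ### Drift conditions and iterates of a Markov operator. -/

section Harris

variable {X : Type*} [MeasurableSpace X]

/-- The Markov operator of a kernel, acting on real functions. -/
def markovOp (P : Kernel X X) (h : X → ℝ) (x : X) : ℝ := ∫ y, h y ∂(P x)

/-- Measurable functions dominated by a multiple of `V`. -/
def Dominated (V h : X → ℝ) : Prop := Measurable h ∧ ∃ c, ∀ x, |h x| ≤ c * V x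

/-- The geometric drift condition `P V ≤ V / 2 + C`. -/
structure HasDrift (P : Kernel X X) (V : X → ℝ) (C : ℝ) : Prop where
  measurable : Measurable V
  one_le : ∀ x, 1 ≤ V x
  nonneg : 0 ≤ C
  drift : ∀ x, ∫⁻ y, ENNReal.ofReal (V y) ∂(P x) ≤ ENNReal.ofReal (V x / 2 + C)

variable {P : Kernel X X} {V : X → ℝ} {C : ℝ}

namespace Dominated

lemma of_bounded (hV : ∀ x, 1 ≤ V x) {h : X → ℝ} (hm : Measurable h) {c : ℝ}
    (hc : ∀ x, |h x| ≤ c) : Dominated V h :=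
  ⟨hm, c, fun x => (hc x).trans
    (le_mul_of_one_le_right ((abs_nonneg _).trans (hc x)) (hV x))⟩

lemma const (hV : ∀ x, 1 ≤ V x) (c : ℝ) : Dominated V (fun _ : X => c) :=
  of_bounded hV measurable_const (fun _ => le_rfl)

lemma add {h k : X → ℝ} (hh : Dominated V h) (hk : Dominated V k) :
    Dominated V (fun x => h x + k x) := by
  obtain ⟨hm, c, hc⟩ := hh
  obtain ⟨km, d, hd⟩ := hk
  refine ⟨hm.add km, c + d, fun x => (abs_add_le _ _).trans ?_⟩
  rw [add_mul]
  exact add_le_add (hc x) (hd x)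

lemma const_mul {h : X → ℝ} (hh : Dominated V h) (b : ℝ) :
    Dominated V (fun x => b * h x) := by
  obtain ⟨hm, c, hc⟩ := hh
  refine ⟨hm.const_mul b, |b| * c, fun x => ?_⟩
  rw [abs_mul, mul_assoc]
  exact mul_le_mul_of_nonneg_left (hc x) (abs_nonneg b)

lemma integrable {μ : Measure X} (hμ : Integrable V μ) {h : X → ℝ} (hh : Dominated V h) :
    Integrable h μ := by
  obtain ⟨hm, c, hc⟩ := hh
  exact (hμ.const_mul c).mono' hm.aestronglyMeasurable (ae_of_all _ hc)

end Dominated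

namespace HasDrift

variable (hd : HasDrift P V C)
include hd

lemma pos (x : X) : 0 < V x := one_pos.trans_le (hd.one_le x)

lemma dominated_self : Dominated V V :=
  ⟨hd.measurable, 1, fun x => by rw [one_mul, abs_of_pos (hd.pos x)]⟩

/-- The drift condition is stated with the integral in [0, ∞], so integrability of `V` is a
consequence of it. -/
lemma integrable_self (x : X) : Integrable V (P x) := by
  refine ⟨hd.measurable.aestronglyMeasurable, ?_⟩
  rw [hasFiniteIntegral_iff_ofReal (ae_of_all _ fun y => (hd.pos y).le)]
  exact (hd.drift x).trans_lt ENNReal.ofReal_lt_top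

lemma integrable {h : X → ℝ} (hh : Dominated V h) (x : X) : Integrable h (P x) :=
  hh.integrable (hd.integrable_self x)

lemma op_self_le (x : X) : markovOp P V x ≤ V x / 2 + C := by
  have h1 := hd.drift x
  have h0 : 0 ≤ V x / 2 + C := by have := hd.pos x; have := hd.nonneg; linarith
  rw [markovOp, integral_eq_lintegral_of_nonneg_ae (ae_of_all _ fun y => (hd.pos y).le)
    hd.measurable.aestronglyMeasurable]
  exact ENNReal.toReal_le_of_le_ofReal h0 h1

lemma op_mono {h k : X → ℝ} (hh : Dominated V h) (hk : Dominated V k) (hle : ∀ x, h x ≤ k x)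
    (x : X) : markovOp P h x ≤ markovOp P k x :=
  integral_mono (hd.integrable hh x) (hd.integrable hk x) hle

omit hd in
lemma _root_.PDMP.measurable_markovOp {h : X → ℝ} (hh : Measurable h) :
    Measurable (markovOp P h) :=
  (StronglyMeasurable.integral_kernel hh.stronglyMeasurable).measurable

lemma op_abs_le {h : X → ℝ} (hm : Measurable h) {c : ℝ} (hc : ∀ x, |h x| ≤ c * V x) (x : X) :
    |markovOp P h x| ≤ c * (V x / 2 + C) := by
  have hc0 : 0 ≤ c := by
    by_contra hneg
    have := mul_neg_of_neg_of_pos (not_le.1 hneg) (hd.pos x)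
    linarith [abs_nonneg (h x), hc x]
  calc |markovOp P h x| ≤ ∫ y, |h y| ∂(P x) := abs_integral_le_integral_abs
    _ ≤ ∫ y, c * V y ∂(P x) := integral_mono
        (hd.integrable ⟨hm, c, hc⟩ x).abs ((hd.integrable_self x).const_mul c) hc
    _ = c * markovOp P V x := integral_const_mul _ _
    _ ≤ _ := mul_le_mul_of_nonneg_left (hd.op_self_le x) hc0

lemma dominated_op {h : X → ℝ} (hh : Dominated V h) : Dominated V (markovOp P h) := by
  obtain ⟨hm, c, hc⟩ := hh
  refine ⟨measurable_markovOp hm, |c| * (1 / 2 + C), fun x => ?_⟩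
  have h1 : ∀ x, |h x| ≤ |c| * V x := fun x =>
    (hc x).trans (mul_le_mul_of_nonneg_right (le_abs_self c) (hd.pos x).le)
  refine (hd.op_abs_le hm h1 x).trans ?_
  rw [mul_assoc]
  refine mul_le_mul_of_nonneg_left ?_ (abs_nonneg c)
  nlinarith [hd.one_le x, hd.nonneg]

lemma dominated_iter {h : X → ℝ} (hh : Dominated V h) (k : ℕ) :
    Dominated V ((markovOp P)^[k] h) := by
  induction k with
  | zero => exact hh
  | succ k ih => rw [Function.iterate_succ_apply']; exact hd.dominated_op ih

lemma iter_mono {h k : X → ℝ} (hh : Dominated V h) (hk : Dominated V k) (hle : ∀ x, h x ≤ k x)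
    (n : ℕ) (x : X) : (markovOp P)^[n] h x ≤ (markovOp P)^[n] k x := by
  induction n generalizing x with
  | zero => exact hle x
  | succ n ih =>
    simp only [Function.iterate_succ_apply']
    exact hd.op_mono (hd.dominated_iter hh n) (hd.dominated_iter hk n) ih x

lemma iter_add {h k : X → ℝ} (hh : Dominated V h) (hk : Dominated V k) (n : ℕ) (x : X) :
    (markovOp P)^[n] (fun y => h y + k y) x = (markovOp P)^[n] h x + (markovOp P)^[n] k x := by
  induction n generalizing x with
  | zero => rfl
  | succ n ih =>
    simp only [Function.iterate_succ_apply']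
    rw [funext ih]
    exact integral_add (hd.integrable (hd.dominated_iter hh n) x)
      (hd.integrable (hd.dominated_iter hk n) x)

omit hd in
lemma _root_.PDMP.iter_const_mul {h : X → ℝ} (b : ℝ) (n : ℕ) (x : X) :
    (markovOp P)^[n] (fun y => b * h y) x = b * (markovOp P)^[n] h x := by
  induction n generalizing x with
  | zero => rfl
  | succ n ih =>
    simp only [Function.iterate_succ_apply']
    rw [funext ih]
    exact integral_const_mul _ _

variable [IsMarkovKernel P]

lemma iter_affine {h : X → ℝ} (hh : Dominated V h) (α β : ℝ) (n : ℕ) (x : X) :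
    (markovOp P)^[n] (fun y => α + β * h y) x = α + β * (markovOp P)^[n] h x := by
  induction n generalizing x with
  | zero => rfl
  | succ n ih =>
    simp only [Function.iterate_succ_apply']
    rw [funext ih]
    simp only [markovOp]
    rw [integral_add (integrable_const _) ((hd.integrable (hd.dominated_iter hh n) x).const_mul _),
      integral_const_mul]
    simp

/-- The coefficient 2 - 2/2^n is the partial sum 1 + 1/2 + … + 1/2^(n-1) collected by iterating the
drift. -/
lemma iter_self_le_aux (n : ℕ) (x : X) :
    (markovOp P)^[n] V x ≤ (2 - 2 / 2 ^ n) * C + (1 / 2 ^ n) * V x := by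
  induction n generalizing x with
  | zero => simp
  | succ n ih =>
    rw [Function.iterate_succ_apply']
    have h1 : Dominated V (fun y => (2 - 2 / 2 ^ n) * C + (1 / 2 ^ n) * V y) :=
      (Dominated.const hd.one_le _).add (hd.dominated_self.const_mul _)
    refine (hd.op_mono (hd.dominated_iter hd.dominated_self n) h1 ih x).trans ?_
    have h2 := hd.iter_affine hd.dominated_self ((2 - 2 / 2 ^ n) * C) (1 / 2 ^ n) 1 x
    simp only [Function.iterate_one] at h2
    rw [h2]
    have h3 := mul_le_mul_of_nonneg_left (hd.op_self_le x) (by positivity : (0 : ℝ) ≤ 1 / 2 ^ n)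
    refine (add_le_add_right h3 _).trans (le_of_eq ?_)
    rw [pow_succ]
    field_simp
    ring

lemma iter_self_le (n : ℕ) (x : X) :
    (markovOp P)^[n] V x ≤ V x / 2 ^ n + 2 * C := by
  refine (hd.iter_self_le_aux n x).trans ?_
  have h1 : (0 : ℝ) ≤ 2 / 2 ^ n * C := mul_nonneg (by positivity) hd.nonneg
  have h2 : (1 / 2 ^ n) * V x = V x / 2 ^ n := by ring
  rw [h2]
  linarith

lemma iter_abs_le {h : X → ℝ} (hm : Measurable h) {α β : ℝ}
    (hc : ∀ x, |h x| ≤ α + β * V x) (n : ℕ) (x : X) :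
    |(markovOp P)^[n] h x| ≤ α + β * (markovOp P)^[n] V x := by
  have hu : Dominated V (fun y => α + β * V y) :=
    (Dominated.const hd.one_le α).add (hd.dominated_self.const_mul β)
  have hh : Dominated V h := by
    obtain ⟨-, c, hc'⟩ := hu
    exact ⟨hm, c, fun x => (hc x).trans ((le_abs_self _).trans (hc' x))⟩
  rw [← hd.iter_affine hd.dominated_self]
  refine abs_le.2 ⟨?_, hd.iter_mono hh hu (fun x => (le_abs_self _).trans (hc x)) n x⟩
  have h1 := hd.iter_affine hh 0 (-1) n x
  have h2 := hd.iter_mono ((Dominated.const hd.one_le 0).add (hh.const_mul (-1))) hu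
    (fun x => by have := neg_abs_le (h x); linarith [hc x]) n x
  rw [h1] at h2
  linarith

end HasDrift
end Harris

/-! ### Harris' theorem in the weighted oscillation seminorm. -/

section Harris

variable {X : Type*} [MeasurableSpace X]

/-- Minorization of the `N`-th iterate on the level set `{V ≤ ρ}` by a measure of mass `≥ ε`. -/
def IsMinorized (P : Kernel X X) (V : X → ℝ) (N : ℕ) (ρ ε : ℝ) : Prop :=
  -- Testing against nonnegative dominated functions expresses the domination through the iterated
  -- operator, without forming an iterated kernel. The measure may vary with the kernel; only its
  -- mass has to be controlled.
  ∃ m : Measure X, IsFiniteMeasure m ∧ Integrable V m ∧ ε ≤ m.real univ ∧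
    ∀ h, Dominated V h → (∀ x, 0 ≤ h x) → ∀ x, V x ≤ ρ → ∫ y, h y ∂m ≤ (markovOp P)^[N] h x

variable {P : Kernel X X} {V : X → ℝ} {C : ℝ}

namespace HasDrift

variable [IsMarkovKernel P] (hd : HasDrift P V C)
include hd

lemma iter_self_le_half {N : ℕ} (hN : 0 < N) (x : X) :
    (markovOp P)^[N] V x ≤ V x / 2 + 2 * C := by
  refine (hd.iter_self_le N x).trans (add_le_add_left ?_ _)
  refine div_le_div_of_nonneg_left (hd.pos x).le (by norm_num) ?_
  exact le_self_pow₀ (by norm_num) hN.ne'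

/-- Minorization is applied to the nonnegative functions s + sβV - h at x and s + sβV + h at y. On
adding, the integrals of h against the minorizing measure cancel, and its mass is gained twice. -/
lemma iter_sub_le_of_minorized {N : ℕ} {ρ ε : ℝ} (hm : IsMinorized P V N ρ ε)
    {h : X → ℝ} (hmeas : Measurable h) {s β : ℝ} (hs : 0 ≤ s)
    (hβ : 0 ≤ β) (hh : ∀ x, |h x| ≤ s + s * β * V x) {x y : X} (hx : V x ≤ ρ) (hy : V y ≤ ρ) :
    (markovOp P)^[N] h x - (markovOp P)^[N] h y ≤
      2 * s - 2 * s * ε + s * β * ((markovOp P)^[N] V x + (markovOp P)^[N] V y) := by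
  obtain ⟨m, hmf, hVm, hε, hmin⟩ := hm
  have hu : Dominated V (fun y => s + s * β * V y) :=
    (Dominated.const hd.one_le s).add (hd.dominated_self.const_mul _)
  have hdom : Dominated V h := by
    obtain ⟨-, c, hc'⟩ := hu
    exact ⟨hmeas, c, fun x => (hh x).trans ((le_abs_self _).trans (hc' x))⟩
  have key : ∀ (σ : ℝ), |σ| = 1 → ∀ z, V z ≤ ρ →
      s * m.real univ + s * β * ∫ y, V y ∂m + σ * ∫ y, h y ∂m ≤
        s + s * β * (markovOp P)^[N] V z + σ * (markovOp P)^[N] h z := by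
    intro σ hσ z hz
    have h0 : ∀ y, 0 ≤ (s + s * β * V y) + σ * h y := fun y => by
      have h1 := neg_abs_le (σ * h y)
      rw [abs_mul, hσ, one_mul] at h1
      linarith [hh y]
    have h1 := hmin _ (hu.add (hdom.const_mul σ)) h0 z hz
    have h2 : ∫ y, ((s + s * β * V y) + σ * h y) ∂m
        = s * m.real univ + s * β * ∫ y, V y ∂m + σ * ∫ y, h y ∂m := by
      rw [integral_add (hu.integrable hVm) ((hdom.const_mul σ).integrable hVm),
        integral_add (integrable_const _) (hVm.const_mul _), integral_const_mul,
        integral_const_mul]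
      simp [mul_comm]
    rw [h2] at h1
    refine h1.trans (le_of_eq ?_)
    rw [hd.iter_add hu (hdom.const_mul σ), hd.iter_affine hd.dominated_self, iter_const_mul]
  have k1 := key (-1) (by simp) x hx
  have k2 := key 1 (by simp) y hy
  have hsβ : 0 ≤ s * β := mul_nonneg hs hβ
  have hV0 : 0 ≤ ∫ y, V y ∂m := integral_nonneg fun y => (hd.pos y).le
  have := mul_nonneg hsβ hV0
  have := mul_le_mul_of_nonneg_left hε hs
  linarith

/-- One contraction step, for a function in the unit ball of the weighted sup norm. -/
lemma iter_sub_le_of_abs_le {N : ℕ} (hN : 0 < N) {ρ ε α β : ℝ} (hρ : 16 * C + 1 ≤ ρ)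
    (hm : IsMinorized P V N ρ ε) (hβ : 0 < β) (hβε : 4 * C * β ≤ ε) (hα : 1 - ε / 2 ≤ α)
    (hα' : 3 / 4 ≤ α) (hα'' : 2 + 3 / 4 * (β * ρ) ≤ α * (2 + β * ρ))
    {h : X → ℝ} (hmeas : Measurable h) {s : ℝ} (hs : 0 ≤ s)
    (hh : ∀ x, |h x| ≤ s + s * β * V x) (x y : X) :
    (markovOp P)^[N] h x - (markovOp P)^[N] h y ≤ α * s * (2 + β * V x + β * V y) := by
  have hx := hd.iter_self_le_half hN x
  have hy := hd.iter_self_le_half hN y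
  have hVx := hd.one_le x
  have hVy := hd.one_le y
  have hsβ : 0 ≤ s * β := mul_nonneg hs hβ.le
  have hbd : s * β * ((markovOp P)^[N] V x + (markovOp P)^[N] V y) ≤
      s * β * ((V x + V y) / 2 + 4 * C) := mul_le_mul_of_nonneg_left (by linarith) hsβ
  -- Inside the level set the gain 2ε from minorization absorbs the drift constant 4Cβ ≤ ε, leaving
  -- 2 - ε ≤ 2α.
  by_cases hc : V x + V y ≤ ρ
  · have h1 := hd.iter_sub_le_of_minorized hm hmeas hs hβ.le hh
      (by linarith : V x ≤ ρ) (by linarith : V y ≤ ρ)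
    have h2 : 2 - 2 * ε + β * ((V x + V y) / 2 + 4 * C) ≤ α * (2 + β * V x + β * V y) := by
      have : 0 ≤ (α - 1 / 2) * (β * (V x + V y)) := by
        apply mul_nonneg (by linarith); positivity
      nlinarith
    nlinarith [mul_le_mul_of_nonneg_left h2 hs]
  -- Outside, V x + V y > ρ ≥ 16C + 1 makes 4C at most a quarter of V x + V y, so the drift alone
  -- contracts the weighted part by 3/4; `hα''` says that this pays for the uncontracted constant 2.
  · push Not at hc
    have h1 := (abs_le.1 (hd.iter_abs_le hmeas hh N x)).2
    have h2 := (abs_le.1 (hd.iter_abs_le hmeas hh N y)).1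
    have h3 : 2 + β * ((V x + V y) / 2 + 4 * C) ≤ α * (2 + β * V x + β * V y) := by
      have e1 : 0 ≤ (α - 3 / 4) * (β * (V x + V y - ρ)) := by
        apply mul_nonneg (by linarith); exact mul_nonneg hβ.le (by linarith)
      have e2 : β * (4 * C) ≤ β * ((V x + V y) / 4) :=
        mul_le_mul_of_nonneg_left (by linarith) hβ.le
      nlinarith
    nlinarith [mul_le_mul_of_nonneg_left h3 hs]

-- A bound on weighted oscillations becomes a weighted sup bound after subtracting a constant. Every
-- h x - w x lies below every h y + w y, so the supremum of the former separates them.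
omit [MeasurableSpace X] [IsMarkovKernel P] hd in
lemma _root_.PDMP.exists_shift {β s : ℝ} {h : X → ℝ} 
    (hh : ∀ x y, h x - h y ≤ s * (2 + β * V x + β * V y)) :
    ∃ c, ∀ x, |h x - c| ≤ s + s * β * V x := by
  rcases isEmpty_or_nonempty X with hX | ⟨⟨x₀⟩⟩
  · exact ⟨0, fun x => hX.elim x⟩
  refine ⟨⨆ x, (h x - (s + s * β * V x)), fun x => ?_⟩
  have hb : ∀ x y, h x - (s + s * β * V x) ≤ h y + (s + s * β * V y) := fun x y => by
    linarith [hh x y]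
  have hbdd : BddAbove (range fun x => h x - (s + s * β * V x)) :=
    ⟨_, by rintro _ ⟨x, rfl⟩; exact hb x x₀⟩
  have h1 := le_ciSup hbdd x
  have : Nonempty X := ⟨x₀⟩
  have h2 := ciSup_le fun z => hb z x
  rw [abs_le]
  constructor <;> linarith

/-- A Markov operator fixes constants, so before each block of N steps the function may be recentred
by `exists_shift` without changing its oscillation; the one-block contraction then iterates. -/
lemma iter_contract {N : ℕ} (hN : 0 < N) {ρ ε α β : ℝ} (hρ : 16 * C + 1 ≤ ρ)
    (hm : IsMinorized P V N ρ ε) (hβ : 0 < β) (hβε : 4 * C * β ≤ ε) (hα : 1 - ε / 2 ≤ α)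
    (hα' : 3 / 4 ≤ α) (hα'' : 2 + 3 / 4 * (β * ρ) ≤ α * (2 + β * ρ))
    {h : X → ℝ} (hdom : Dominated V h) {s : ℝ} (hs : 0 ≤ s)
    (hh : ∀ x y, h x - h y ≤ s * (2 + β * V x + β * V y)) (n : ℕ) (x y : X) :
    (markovOp P)^[N * n] h x - (markovOp P)^[N * n] h y ≤
      α ^ n * s * (2 + β * V x + β * V y) := by
  induction n generalizing x y with
  | zero => simpa using hh x y
  | succ n ih =>
    have hd' := hd.dominated_iter hdom (N * n)
    have hs' : 0 ≤ α ^ n * s := mul_nonneg (pow_nonneg (by linarith) _) hs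
    obtain ⟨c, hc⟩ := exists_shift ih
    have h1 := hd.iter_sub_le_of_abs_le hN hρ hm hβ hβε hα hα' hα''
      (h := fun z => -c + 1 * (markovOp P)^[N * n] h z)
      ((hd'.1.const_mul 1).const_add _) hs' (fun z => by
        have := hc z; rwa [one_mul, neg_add_eq_sub]) x y
    rw [hd.iter_affine hd', hd.iter_affine hd'] at h1
    rw [mul_add, mul_one, add_comm, Function.iterate_add_apply, pow_succ]
    linarith

end HasDrift

/-- Harris' theorem: geometric ergodicity in the weighted norm, with constants that depend only
on those of the drift and minorization conditions. -/
theorem exists_geometric_contraction (X : Type*) [MeasurableSpace X] {C ε : ℝ} (hC : 0 ≤ C)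
    (hε : 0 < ε) {N : ℕ} (hN : 0 < N) :
    ∃ R γ : ℝ, 0 < R ∧ 0 < γ ∧ γ < 1 ∧ ∀ (P : Kernel X X) [IsMarkovKernel P] (V : X → ℝ),
      HasDrift P V C → IsMinorized P V N (16 * C + 1) ε →
      ∀ h : X → ℝ, Measurable h → ∀ c : ℝ, (∀ x, |h x| ≤ c * V x) → ∀ (k : ℕ) (x y : X),
        |(markovOp P)^[k] h x - (markovOp P)^[k] h y| ≤ c * R * (V x + V y) * γ ^ k := by
  set ρ : ℝ := 16 * C + 1 with hρ
  -- The weight β is small enough that 4Cβ ≤ ε; C + 1 is used because C may vanish.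
  set β : ℝ := ε / (4 * (C + 1)) with hβdef
  have hβ : 0 < β := by positivity
  have hρ0 : 0 < ρ := by positivity
  have hβε : 4 * C * β ≤ ε := by
    rw [hβdef, ← mul_div_assoc, div_le_iff₀ (by positivity)]
    nlinarith
  have hβρ : 0 < β * ρ := by positivity
  set α₁ : ℝ := (2 + 3 / 4 * (β * ρ)) / (2 + β * ρ) with hα₁
  have hα₁1 : α₁ < 1 := by rw [hα₁, div_lt_one (by positivity)]; linarith
  set α : ℝ := max (1 - ε / 2) (max (3 / 4) α₁) with hαdef
  have hα : 1 - ε / 2 ≤ α := le_max_left _ _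
  have hα' : 3 / 4 ≤ α := (le_max_left _ _).trans (le_max_right _ _)
  have hα'' : 2 + 3 / 4 * (β * ρ) ≤ α * (2 + β * ρ) := by
    rw [← div_le_iff₀ (by positivity)]
    exact (le_max_right _ _).trans (le_max_right _ _)
  have hα1 : α < 1 := max_lt (by linarith) (max_lt (by norm_num) hα₁1)
  have hα0 : 0 < α := by linarith
  have hN0 : (0 : ℝ) < N := by exact_mod_cast hN
  -- A factor α per block of N steps is a factor γ per step.
  set γ : ℝ := α ^ (1 / (N : ℝ)) with hγ
  have hγ0 : 0 < γ := Real.rpow_pos_of_pos hα0 _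
  have hγ1 : γ < 1 := Real.rpow_lt_one hα0.le hα1 (by positivity)
  have hγN : γ ^ N = α := by
    rw [hγ, one_div, Real.rpow_inv_natCast_pow hα0.le hN.ne']
  refine ⟨(1 + 2 * C) * (1 / β) * (1 + β) * (1 / γ ^ N), γ, by positivity, hγ0, hγ1, ?_⟩
  intro P _ V hd hm h hmeas c hc k x y
  have hc0 : 0 ≤ c := by
    by_contra hneg
    have := mul_neg_of_neg_of_pos (not_le.1 hneg) (hd.pos x)
    linarith [abs_nonneg (h x), hc x]
  have hdom : Dominated V h := ⟨hmeas, c, hc⟩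
  -- The j < N leftover steps are bounded crudely by the drift, at the cost of 1 + 2C; the n full
  -- blocks contract.
  set j := k % N
  set n := k / N
  have hk : k = N * n + j := (Nat.div_add_mod k N).symm
  have hj : ∀ z, |(markovOp P)^[j] h z| ≤ c * (1 + 2 * C) * V z := fun z => by
    have h1 := hd.iter_abs_le hmeas (α := 0) (β := c) (by simpa using hc) j z
    have h2 := hd.iter_self_le j z
    have h3 : V z / 2 ^ j ≤ V z :=
      div_le_self (hd.pos z).le (one_le_pow₀ (by norm_num))
    have h4 : V z / 2 ^ j + 2 * C ≤ (1 + 2 * C) * V z := by nlinarith [hd.one_le z]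
    rw [zero_add] at h1
    rw [mul_assoc]
    exact h1.trans (mul_le_mul_of_nonneg_left (h2.trans h4) hc0)
  set s := c * (1 + 2 * C) * (1 / β)
  have hs : 0 ≤ s := by positivity
  have hosc : ∀ z w, (markovOp P)^[j] h z - (markovOp P)^[j] h w ≤
      s * (2 + β * V z + β * V w) := fun z w => by
    have h1 := (abs_le.1 (hj z)).2
    have h2 := (abs_le.1 (hj w)).1
    have h3 : s * (2 + β * V z + β * V w)
        = 2 * s + c * (1 + 2 * C) * V z + c * (1 + 2 * C) * V w := by
      simp only [s]; field_simp
    rw [h3]; linarith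
  have hcon := hd.iter_contract hN le_rfl hm hβ hβε hα hα' hα'' (hd.dominated_iter hdom j) hs hosc n
  -- Since k < N n + N, dropping the incomplete block costs at most one factor γ^(-N).
  have hpow : α ^ n ≤ 1 / γ ^ N * γ ^ k := by
    rw [← hγN, ← pow_mul, one_div, ← div_eq_inv_mul, le_div_iff₀ (by positivity), ← pow_add]
    refine pow_le_pow_of_le_one hγ0.le hγ1.le ?_
    have := Nat.mod_lt k hN
    omega
  have main : ∀ z w, (markovOp P)^[k] h z - (markovOp P)^[k] h w ≤
      c * ((1 + 2 * C) * (1 / β) * (1 + β) * (1 / γ ^ N)) * (V z + V w) * γ ^ k := by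
    intro z w
    have h1 := hcon z w
    rw [← Function.iterate_add_apply, ← hk] at h1
    have h2 : 2 + β * V z + β * V w ≤ (1 + β) * (V z + V w) := by
      nlinarith [hd.one_le z, hd.one_le w]
    have hV : 0 ≤ V z + V w := add_nonneg (hd.pos z).le (hd.pos w).le
    calc _ ≤ α ^ n * s * (2 + β * V z + β * V w) := h1
      _ ≤ (1 / γ ^ N * γ ^ k) * s * ((1 + β) * (V z + V w)) := by
        have : 0 ≤ 2 + β * V z + β * V w := by
          have := hd.pos z; have := hd.pos w; positivity
        gcongr
      _ = _ := by simp only [s]; ring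
  rw [abs_le]
  refine ⟨?_, main x y⟩
  have := main y x
  rw [add_comm (V y)] at this
  linarith

end Harris

/-! ### Existence, uniqueness and attraction of an invariant density. -/

section Invariant

open Filter Topology

variable {X : Type*} [MeasurableSpace X]

lemma integral_bind_eq_integral_markovOp {P : Kernel X X} {μ : Measure X} {h : X → ℝ}
    (hh : Integrable h (μ.bind P)) : ∫ x, h x ∂(μ.bind P) = ∫ x, markovOp P h x ∂μ := by
  have h1 := Kernel.integral_comp (κ := Kernel.const Unit μ) (η := P) (a := ()) (f := h)
  rw [Kernel.comp_apply, Kernel.const_apply] at h1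
  exact h1 hh

/-- The law at time `k + 1` of the chain with kernel `P` started from `x`. -/
def lawAt (P : Kernel X X) (x : X) : ℕ → Measure X
  | 0 => P x
  | k + 1 => (lawAt P x k).bind P

section lawAt

variable {P : Kernel X X} {V : X → ℝ} {C : ℝ}

instance [IsMarkovKernel P] (x : X) (k : ℕ) : IsProbabilityMeasure (lawAt P x k) := by
  induction k with
  | zero => unfold lawAt; infer_instance
  | succ k ih =>
    refine ⟨?_⟩
    simp only [lawAt]
    rw [Measure.bind_apply MeasurableSet.univ P.measurable.aemeasurable]
    simp

lemma bind_absolutelyContinuous {m μ : Measure X} (h : ∀ x, P x ≪ m) : μ.bind P ≪ m := by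
  refine Measure.AbsolutelyContinuous.mk fun s hs h0 => ?_
  rw [Measure.bind_apply hs P.measurable.aemeasurable]
  simp [fun x => h x h0]

/-- This is why `lawAt` starts at time 1: the Dirac mass at time 0 need not have a density. -/
lemma lawAt_absolutelyContinuous {m : Measure X} (h : ∀ x, P x ≪ m) (x : X) (k : ℕ) :
    lawAt P x k ≪ m := by
  cases k with
  | zero => exact h x
  | succ k => exact bind_absolutelyContinuous h

lemma HasDrift.lintegral_bind_le (hd : HasDrift P V C) (μ : Measure X) :
    ∫⁻ y, ENNReal.ofReal (V y) ∂(μ.bind P) ≤ ∫⁻ x, ENNReal.ofReal (V x / 2 + C) ∂μ := by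
  rw [Measure.lintegral_bind P.measurable.aemeasurable
    hd.measurable.ennreal_ofReal.aemeasurable]
  exact lintegral_mono hd.drift

lemma HasDrift.integrable_lawAt [IsMarkovKernel P] (hd : HasDrift P V C) (x : X) (k : ℕ) :
    Integrable V (lawAt P x k) := by
  induction k with
  | zero => exact hd.integrable_self x
  | succ k ih =>
    refine ⟨hd.measurable.aestronglyMeasurable, ?_⟩
    rw [hasFiniteIntegral_iff_ofReal (ae_of_all _ fun y => (hd.pos y).le)]
    exact (hd.lintegral_bind_le _).trans_lt
      (((ih.div_const 2).add (integrable_const C)).lintegral_lt_top)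

lemma HasDrift.integral_lawAt [IsMarkovKernel P] (hd : HasDrift P V C) {h : X → ℝ}
    (hh : Dominated V h) (x : X) (k : ℕ) :
    ∫ y, h y ∂(lawAt P x k) = (markovOp P)^[k + 1] h x := by
  induction k generalizing h with
  | zero => rfl
  | succ k ih =>
    have h1 : Integrable h ((lawAt P x k).bind P) := hh.integrable (hd.integrable_lawAt x (k + 1))
    rw [Function.iterate_succ_apply, ← ih (hd.dominated_op hh)]
    exact integral_bind_eq_integral_markovOp h1

end lawAt

/-- Geometric contraction of the iterates between two starting points. -/
def IsContracting (P : Kernel X X) (V : X → ℝ) (R γ : ℝ) : Prop :=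
  ∀ h : X → ℝ, Measurable h → ∀ c : ℝ, (∀ x, |h x| ≤ c * V x) → ∀ (k : ℕ) (x y : X),
    |(markovOp P)^[k] h x - (markovOp P)^[k] h y| ≤ c * R * (V x + V y) * γ ^ k

variable {P : Kernel X X} [IsMarkovKernel P] {V : X → ℝ} {C R γ : ℝ}

/-- By Chapman–Kolmogorov the difference is an average of P^(k+1)h(x) - P^(k+1)h(y) over y drawn
from the law at time j. The contraction bound integrates because that law has V-moment at most V x +
2C. -/
lemma IsContracting.sub_lawAt_le (hc : IsContracting P V R γ) (hd : HasDrift P V C)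
    (hR : 0 ≤ R) (hγ : 0 ≤ γ) {h : X → ℝ} (hm : Measurable h) (h1 : ∀ x, |h x| ≤ 1) (x : X)
    (k j : ℕ) :
    |∫ y, h y ∂(lawAt P x k) - ∫ y, h y ∂(lawAt P x (k + j))| ≤
      R * (2 * V x + 2 * C) * γ ^ (k + 1) := by
  have hdom : Dominated V h := Dominated.of_bounded hd.one_le hm h1
  have hV : ∀ x, |h x| ≤ 1 * V x := fun x => (h1 x).trans (by simpa using hd.one_le x)
  rw [hd.integral_lawAt hdom, hd.integral_lawAt hdom]
  cases j with
  | zero =>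
    simp only [add_zero, sub_self, abs_zero]
    have := hd.pos x; have := hd.nonneg
    positivity
  | succ j =>
    have hk := hd.dominated_iter (P := P) hdom (k + 1)
    rw [show k + (j + 1) + 1 = (j + 1) + (k + 1) by ring, Function.iterate_add_apply _ (j + 1),
      ← hd.integral_lawAt hk]
    have hint := hk.integrable (hd.integrable_lawAt x j)
    have hVint := hd.integrable_lawAt x j
    have e1 : (markovOp P)^[k + 1] h x - ∫ y, (markovOp P)^[k + 1] h y ∂(lawAt P x j)
        = ∫ y, ((markovOp P)^[k + 1] h x - (markovOp P)^[k + 1] h y) ∂(lawAt P x j) := by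
      rw [integral_sub (integrable_const _) hint]; simp
    rw [e1]
    calc _ ≤ ∫ y, |(markovOp P)^[k + 1] h x - (markovOp P)^[k + 1] h y| ∂(lawAt P x j) :=
          abs_integral_le_integral_abs
      _ ≤ ∫ y, (R * V x * γ ^ (k + 1) + R * γ ^ (k + 1) * V y) ∂(lawAt P x j) := by
          refine integral_mono ((integrable_const _).sub hint).abs
            ((integrable_const _).add (hVint.const_mul _)) fun y => ?_
          refine (hc h hm 1 hV (k + 1) x y).trans (le_of_eq ?_)
          ring
      _ = R * γ ^ (k + 1) * (V x + (markovOp P)^[j + 1] V x) := by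
          rw [integral_add (integrable_const _) (hVint.const_mul _),
            integral_const_mul (R * γ ^ (k + 1)) V, hd.integral_lawAt hd.dominated_self]
          simp only [integral_const, probReal_univ, smul_eq_mul]; ring
      _ ≤ R * γ ^ (k + 1) * (2 * V x + 2 * C) := by
          refine mul_le_mul_of_nonneg_left ?_ (by positivity)
          have h2 := hd.iter_self_le (P := P) (j + 1) x
          have h3 : V x / 2 ^ (j + 1) ≤ V x :=
            div_le_self (hd.pos x).le (one_le_pow₀ (by norm_num))
          linarith
      _ = _ := by ring

/-- The laws at time `k` converge to a probability measure with a density. -/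
theorem IsContracting.exists_density [Nonempty X] (hc : IsContracting P V R γ)
    (hd : HasDrift P V C) (hR : 0 ≤ R) (hγ : 0 ≤ γ) (hγ1 : γ < 1) (m : Measure X) [SigmaFinite m]
    (hm : ∀ x, P x ≪ m) (x : X) :
    ∃ p : X → ℝ, Measurable p ∧ (∀ y, 0 ≤ p y) ∧ Integrable p m ∧
      ∀ (h : X → ℝ) (c : ℝ), Measurable h → (∀ y, |h y| ≤ c) →
        Tendsto (fun k => ∫ y, h y ∂(lawAt P x k)) atTop
          (𝓝 (∫ y, h y ∂(m.withDensity fun y => ENNReal.ofReal (p y)))) := by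
  set q : ℕ → X → ℝ := fun k y => ((lawAt P x k).rnDeriv m y).toReal with hq
  have hqm : ∀ k, Measurable (q k) := fun k => (Measure.measurable_rnDeriv _ _).ennreal_toReal
  have hqi : ∀ k, Integrable (q k) m := fun k => Measure.integrable_toReal_rnDeriv
  have hint : ∀ (h : X → ℝ) k, ∫ y, q k y * h y ∂m = ∫ y, h y ∂(lawAt P x k) := fun h k => by
    simpa using integral_rnDeriv_smul (f := h) (lawAt_absolutelyContinuous hm x k)
  set F : ℕ → X →₁[m] ℝ := fun k => (hqi k).toL1 (q k) with hF
  have hdist : ∀ k j, dist (F k) (F (k + j)) ≤ R * (2 * V x + 2 * C) * γ ^ (k + 1) := by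
    intro k j
    -- Testing against the sign of the difference of densities recovers their L¹ distance.
    set s : X → ℝ := fun y => if q (k + j) y ≤ q k y then 1 else -1 with hs
    have hsm : Measurable s := Measurable.ite (measurableSet_le (hqm _) (hqm _))
      measurable_const measurable_const
    have hs1 : ∀ y, |s y| ≤ 1 := fun y => by simp only [hs]; split_ifs <;> simp
    have h1 := hc.sub_lawAt_le hd hR hγ hsm hs1 x k j
    rw [← hint, ← hint, ← integral_sub] at h1
    · refine le_trans (le_of_eq ?_) ((le_abs_self _).trans h1)
      rw [dist_eq_norm, hF]
      simp only
      rw [← Integrable.toL1_sub, L1.norm_eq_integral_norm]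
      refine integral_congr_ae ?_
      filter_upwards [Integrable.coeFn_toL1 ((hqi k).sub (hqi (k + j)))] with y hy
      rw [hy]
      simp only [Pi.sub_apply, hs, Real.norm_eq_abs]
      split_ifs with h2
      · rw [abs_of_nonneg (by linarith)]; ring
      · rw [abs_of_neg (by linarith)]; ring
    · exact (hqi k).mul_bdd hsm.aestronglyMeasurable (ae_of_all _ hs1)
    · exact (hqi _).mul_bdd hsm.aestronglyMeasurable (ae_of_all _ hs1)
  have hcauchy : CauchySeq F := by
    refine cauchySeq_of_le_tendsto_0' (fun k => R * (2 * V x + 2 * C) * γ ^ (k + 1)) ?_ ?_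
    · intro k l hkl
      obtain ⟨j, rfl⟩ := Nat.exists_eq_add_of_le hkl
      exact hdist k j
    · have := (tendsto_pow_atTop_nhds_zero_of_lt_one hγ hγ1).comp (tendsto_add_atTop_nat 1)
      simpa using this.const_mul (R * (2 * V x + 2 * C))
  obtain ⟨f, hf⟩ := cauchySeq_tendsto_of_complete hcauchy
  have hfm : Measurable (f : X → ℝ) := (Lp.stronglyMeasurable f).measurable
  have hfi : Integrable (f : X → ℝ) m := L1.integrable_coeFn f
  have hfL : hfi.toL1 f = f := Integrable.toL1_coeFn f hfi
  -- The positive part makes the density nonnegative everywhere. It is no further from the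
  -- nonnegative `q k` than `f` is, so the limit is unaffected.
  set p : X → ℝ := fun y => max (f y) 0 with hp
  have hpm : Measurable p := hfm.max measurable_const
  have hpi : Integrable p m := hfi.pos_part
  refine ⟨p, hpm, fun y => le_max_right _ _, hpi, fun h c hh hhc => ?_⟩
  have e1 : ∫ y, h y ∂(m.withDensity fun y => ENNReal.ofReal (p y)) = ∫ y, p y * h y ∂m := by
    rw [integral_withDensity_eq_integral_toReal_smul hpm.ennreal_ofReal (by simp)]
    refine integral_congr_ae (ae_of_all _ fun y => ?_)
    simp only [smul_eq_mul]
    rw [ENNReal.toReal_ofReal (le_max_right _ _)]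
  rw [e1]
  simp only [← hint]
  have bd : ∀ {u : X → ℝ}, Integrable u m → Integrable (fun y => u y * h y) m := fun hu =>
    hu.mul_bdd hh.aestronglyMeasurable (ae_of_all _ hhc)
  refine tendsto_integral_of_L1 _ (bd hpi).aestronglyMeasurable
    (Eventually.of_forall fun k => bd (hqi k)) ?_
  have hle : ∀ k, ∫⁻ y, ‖q k y * h y - p y * h y‖ₑ ∂m ≤ ENNReal.ofReal c * edist (F k) f := by
    intro k
    have e2 : edist (F k) f = ∫⁻ y, ‖q k y - f y‖ₑ ∂m := by
      conv_lhs => rw [← hfL]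
      rw [hF]
      simp only
      rw [Integrable.edist_toL1_toL1]
      simp [edist_eq_enorm_sub]
    rw [e2, ← lintegral_const_mul' _ _ ENNReal.ofReal_ne_top]
    refine lintegral_mono fun y => ?_
    simp only [Real.enorm_eq_ofReal_abs]
    rw [← ENNReal.ofReal_mul ((abs_nonneg _).trans (hhc y)), ← sub_mul, abs_mul, mul_comm]
    refine ENNReal.ofReal_le_ofReal (mul_le_mul (hhc y) ?_ (abs_nonneg _)
      ((abs_nonneg _).trans (hhc y)))
    have hq0 : q k y = max (q k y) 0 := (max_eq_left ENNReal.toReal_nonneg).symm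
    rw [hq0]
    simpa [hp, ← hq0] using abs_max_sub_max_le_abs (q k y) (f y) 0
  have h0 : Tendsto (fun k => ENNReal.ofReal c * edist (F k) f) atTop (𝓝 0) := by
    have := ENNReal.Tendsto.const_mul (a := ENNReal.ofReal c)
      (tendsto_iff_edist_tendsto_0.1 hf) (Or.inr ENNReal.ofReal_ne_top)
    simpa using this
  exact tendsto_of_tendsto_of_tendsto_of_le_of_le tendsto_const_nhds h0 (fun _ => zero_le) hle

/-- Existence of an invariant density, with a bound on the integral of `V`. -/
theorem IsContracting.exists_invariant_density [Nonempty X] (hc : IsContracting P V R γ)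
    (hd : HasDrift P V C) (hR : 0 ≤ R) (hγ : 0 ≤ γ) (hγ1 : γ < 1) (m : Measure X) [SigmaFinite m]
    (hm : ∀ x, P x ≪ m) :
    ∃ p : X → ℝ, Measurable p ∧ (∀ y, 0 ≤ p y) ∧
      IsProbabilityMeasure (m.withDensity fun y => ENNReal.ofReal (p y)) ∧
      (m.withDensity fun y => ENNReal.ofReal (p y)).bind P
        = m.withDensity (fun y => ENNReal.ofReal (p y)) ∧
      Integrable V (m.withDensity fun y => ENNReal.ofReal (p y)) ∧
      ∫ y, V y ∂(m.withDensity fun y => ENNReal.ofReal (p y)) ≤ 2 * C := by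
  obtain ⟨x⟩ := ‹Nonempty X›
  have : Nonempty X := ⟨x⟩
  obtain ⟨p, hpm, hp0, hpi, hlim⟩ := hc.exists_density hd hR hγ hγ1 m hm x
  set π := m.withDensity fun y => ENNReal.ofReal (p y) with hπ
  have hfin : IsFiniteMeasure π := isFiniteMeasure_withDensity_ofReal hpi.2
  have hprob : IsProbabilityMeasure π := by
    have h1 := hlim (fun _ => 1) 1 measurable_const (fun _ => by simp)
    simp only [integral_const, probReal_univ, smul_eq_mul, mul_one] at h1
    have h2 := tendsto_nhds_unique tendsto_const_nhds h1
    refine ⟨?_⟩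
    rw [Measure.real] at h2
    exact (ENNReal.toReal_eq_one_iff _).1 h2.symm
  -- The laws at times k + 2 tested on an indicator, and the laws at times k + 1 tested on its image
  -- under P, are the same sequence; its two limits are the two sides.
  have hbind : π.bind P = π := by
    have hfb : IsFiniteMeasure (π.bind P) := by
      refine ⟨?_⟩
      rw [Measure.bind_apply MeasurableSet.univ P.measurable.aemeasurable]
      simp
    refine Measure.ext fun B hB => ?_
    rw [← ENNReal.toReal_eq_toReal_iff' (measure_ne_top _ _) (measure_ne_top _ _)]
    have hIm : Measurable (B.indicator (fun _ => (1 : ℝ))) := measurable_const.indicator hB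
    have hI1 : ∀ y, |B.indicator (fun _ => (1 : ℝ)) y| ≤ 1 := fun y => by
      by_cases hy : y ∈ B <;> simp [hy]
    have hT1 : ∀ y, |markovOp P (B.indicator (fun _ => (1 : ℝ))) y| ≤ 1 := fun y => by
      rw [markovOp, integral_indicator hB]
      simp only [integral_const, MeasurableSet.univ, measureReal_restrict_apply, univ_inter,
        smul_eq_mul, mul_one]
      rw [abs_of_nonneg measureReal_nonneg]
      exact measureReal_le_one
    have l1 := (hlim _ 1 hIm hI1).comp (tendsto_add_atTop_nat 1)
    have l2 := hlim _ 1 (measurable_markovOp (P := P) hIm) hT1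
    have heq : (fun k => ∫ y, B.indicator (fun _ => (1 : ℝ)) y ∂(lawAt P x k)) ∘ (fun a => a + 1)
        = fun k => ∫ y, markovOp P (B.indicator (fun _ => (1 : ℝ))) y ∂(lawAt P x k) := by
      funext k
      refine integral_bind_eq_integral_markovOp ?_
      exact (integrable_const (1 : ℝ)).indicator hB |>.mono' hIm.aestronglyMeasurable
        (ae_of_all _ fun y => by by_cases hy : y ∈ B <;> simp [hy])
    rw [heq] at l1
    have h3 := tendsto_nhds_unique l2 l1
    rw [← integral_bind_eq_integral_markovOp
      ((integrable_const (1 : ℝ)).indicator hB)] at h3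
    simpa [integral_indicator hB, Measure.real] using h3
  -- Convergence is known only for bounded functions, so V is truncated at level n and recovered by
  -- monotone convergence.
  have hVle : ∫⁻ y, ENNReal.ofReal (V y) ∂π ≤ ENNReal.ofReal (2 * C) := by
    have hmin : ∀ n : ℕ, ∫⁻ y, ENNReal.ofReal (min (V y) n) ∂π ≤ ENNReal.ofReal (2 * C) := by
      intro n
      have hmm : Measurable fun y => min (V y) (n : ℝ) := hd.measurable.min measurable_const
      have h0 : ∀ y, 0 ≤ min (V y) (n : ℝ) := fun y => le_min (hd.pos y).le n.cast_nonneg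
      have hb : ∀ y, |min (V y) (n : ℝ)| ≤ n := fun y => by
        rw [abs_of_nonneg (h0 y)]; exact min_le_right _ _
      have l1 := hlim _ n hmm hb
      have l2 : Tendsto (fun k : ℕ => V x / 2 ^ (k + 1) + 2 * C) atTop (𝓝 (0 + 2 * C)) := by
        refine Tendsto.add_const _ ?_
        have := ((tendsto_pow_atTop_nhds_zero_of_lt_one (by norm_num : (0 : ℝ) ≤ 1 / 2)
          (by norm_num)).comp (tendsto_add_atTop_nat 1)).const_mul (V x)
        simpa [div_eq_mul_inv] using this
      rw [zero_add] at l2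
      have h3 := le_of_tendsto_of_tendsto' l1 l2 fun k => by
        have hdom : Dominated V fun y => min (V y) (n : ℝ) :=
          Dominated.of_bounded hd.one_le hmm hb
        rw [hd.integral_lawAt hdom]
        exact (hd.iter_mono hdom hd.dominated_self (fun y => min_le_left _ _) _ x).trans
          (hd.iter_self_le _ x)
      rw [← ofReal_integral_eq_lintegral_ofReal
        ((integrable_const (n : ℝ)).mono' hmm.aestronglyMeasurable (ae_of_all _ hb))
        (ae_of_all _ h0)]
      exact ENNReal.ofReal_le_ofReal h3
    have hsup : ∀ y, ENNReal.ofReal (V y) = ⨆ n : ℕ, ENNReal.ofReal (min (V y) n) := by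
      intro y
      refine le_antisymm ?_ (iSup_le fun n => ENNReal.ofReal_le_ofReal (min_le_left _ _))
      obtain ⟨n, hn⟩ := exists_nat_ge (V y)
      refine le_iSup_of_le n ?_
      rw [min_eq_left hn]
    simp_rw [hsup]
    rw [lintegral_iSup]
    · exact iSup_le hmin
    · exact fun n => (hd.measurable.min measurable_const).ennreal_ofReal
    · intro n k hnk y
      exact ENNReal.ofReal_le_ofReal (min_le_min le_rfl (by exact_mod_cast hnk))
  have hVi : Integrable V π := by
    refine ⟨hd.measurable.aestronglyMeasurable, ?_⟩
    rw [hasFiniteIntegral_iff_ofReal (ae_of_all _ fun y => (hd.pos y).le)]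
    exact hVle.trans_lt ENNReal.ofReal_lt_top
  refine ⟨p, hpm, hp0, hprob, hbind, hVi, ?_⟩
  rw [integral_eq_lintegral_of_nonneg_ae (ae_of_all _ fun y => (hd.pos y).le)
    hd.measurable.aestronglyMeasurable]
  exact ENNReal.toReal_le_of_le_ofReal (by linarith [hd.nonneg]) hVle

omit [IsMarkovKernel P] in
lemma HasDrift.integral_iter_of_invariant (hd : HasDrift P V C) {π : Measure X}
    (hV : Integrable V π) (hinv : π.bind P = π) {h : X → ℝ} (hh : Dominated V h) (k : ℕ) :
    ∫ x, (markovOp P)^[k] h x ∂π = ∫ x, h x ∂π := by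
  induction k with
  | zero => rfl
  | succ k ih =>
    have h1 := hd.dominated_iter (P := P) hh k
    rw [← ih, Function.iterate_succ']
    conv_rhs => rw [← hinv]
    rw [integral_bind_eq_integral_markovOp (by rw [hinv]; exact h1.integrable hV)]
    rfl

-- By invariance ∫ h dπ = ∫ P^k h dπ, so the two-point contraction is averaged over the second
-- point; the factor 1 + 2C absorbs ∫ V dπ ≤ 2C into V x ≥ 1.
omit [IsMarkovKernel P] in
theorem IsContracting.sub_integral_le (hc : IsContracting P V R γ) (hd : HasDrift P V C)
    (hR : 0 ≤ R) (hγ : 0 ≤ γ) {π : Measure X} [IsProbabilityMeasure π]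
    (hV : Integrable V π) (hVC : ∫ x, V x ∂π ≤ 2 * C) (hinv : π.bind P = π) {h : X → ℝ}
    (hm : Measurable h) {c : ℝ} (hcV : ∀ x, |h x| ≤ c * V x) (k : ℕ) (x : X) :
    |(markovOp P)^[k] h x - ∫ y, h y ∂π| ≤ c * (R * (1 + 2 * C)) * V x * γ ^ k := by
  have hc0 : 0 ≤ c := by
    by_contra hneg
    have := mul_neg_of_neg_of_pos (not_le.1 hneg) (hd.pos x)
    linarith [abs_nonneg (h x), hcV x]
  have hdom : Dominated V h := ⟨hm, c, hcV⟩
  have hint := (hd.dominated_iter (P := P) hdom k).integrable hV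
  rw [← hd.integral_iter_of_invariant hV hinv hdom k]
  have e1 : (markovOp P)^[k] h x - ∫ y, (markovOp P)^[k] h y ∂π
      = ∫ y, ((markovOp P)^[k] h x - (markovOp P)^[k] h y) ∂π := by
    rw [integral_sub (integrable_const _) hint]; simp
  rw [e1]
  calc _ ≤ ∫ y, |(markovOp P)^[k] h x - (markovOp P)^[k] h y| ∂π :=
        abs_integral_le_integral_abs
    _ ≤ ∫ y, (c * R * V x * γ ^ k + c * R * γ ^ k * V y) ∂π := by
        refine integral_mono ((integrable_const _).sub hint).abs
          ((integrable_const _).add (hV.const_mul _)) fun y => ?_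
        refine (hc h hm c hcV k x y).trans (le_of_eq ?_)
        ring
    _ = c * R * γ ^ k * (V x + ∫ y, V y ∂π) := by
        rw [integral_add (integrable_const _) (hV.const_mul _),
          integral_const_mul (c * R * γ ^ k) V]
        simp only [integral_const, probReal_univ, smul_eq_mul]; ring
    _ ≤ c * R * γ ^ k * ((1 + 2 * C) * V x) := by
        refine mul_le_mul_of_nonneg_left ?_ (by positivity)
        nlinarith [hd.one_le x, hd.nonneg]
    _ = _ := by ring

/-- An invariant probability measure is the limit of the laws at time `k`. -/
theorem IsContracting.eq_of_invariant (hc : IsContracting P V R γ) (hd : HasDrift P V C)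
    (hR : 0 ≤ R) (hγ : 0 ≤ γ) (hγ1 : γ < 1) {π : Measure X} [IsProbabilityMeasure π]
    (hV : Integrable V π) (hVC : ∫ x, V x ∂π ≤ 2 * C) (hinv : π.bind P = π) {μ : Measure X}
    [IsProbabilityMeasure μ] (hμ : μ.bind P = μ) : μ = π := by
  refine Measure.ext fun B hB => ?_
  rw [← ENNReal.toReal_eq_toReal_iff' (measure_ne_top _ _) (measure_ne_top _ _)]
  set I : X → ℝ := B.indicator (fun _ => (1 : ℝ)) with hI
  have hIm : Measurable I := measurable_const.indicator hB
  have hI1 : ∀ y, |I y| ≤ 1 := fun y => by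
    by_cases hy : y ∈ B <;> simp [hI, hy]
  have hIV : ∀ y, |I y| ≤ 1 * V y := fun y => (hI1 y).trans (by simpa using hd.one_le y)
  have hmeas : ∀ k, Measurable ((markovOp P)^[k] I) := fun k =>
    (hd.dominated_iter (P := P) ⟨hIm, 1, hIV⟩ k).1
  have hb : ∀ k y, |(markovOp P)^[k] I y| ≤ 1 := fun k y => by
    have := hd.iter_abs_le (P := P) (α := 1) (β := 0) hIm (by simpa using hI1) k y
    simpa using this
  have hiter : ∀ k, ∫ x, (markovOp P)^[k] I x ∂μ = ∫ x, I x ∂μ := by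
    intro k
    induction k with
    | zero => rfl
    | succ k ih =>
      rw [← ih, Function.iterate_succ']
      conv_rhs => rw [← hμ]
      rw [integral_bind_eq_integral_markovOp]
      · rfl
      · rw [hμ]
        exact (integrable_const (1 : ℝ)).mono' (hmeas k).aestronglyMeasurable (ae_of_all _ (hb k))
  -- Nothing is known about ∫ V dμ, so the rate is used only pointwise; the bound by 1 gives
  -- dominated convergence.
  have hlim : Tendsto (fun k => ∫ x, (markovOp P)^[k] I x ∂μ) atTop
      (𝓝 (∫ _, (∫ y, I y ∂π) ∂μ)) := by
    refine tendsto_integral_of_dominated_convergence (fun _ => 1)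
      (fun k => (hmeas k).aestronglyMeasurable) (integrable_const _)
      (fun k => ae_of_all _ (hb k)) (ae_of_all _ fun x => ?_)
    rw [tendsto_iff_norm_sub_tendsto_zero]
    refine squeeze_zero (fun _ => norm_nonneg _)
      (fun k => hc.sub_integral_le hd hR hγ hV hVC hinv hIm hIV k x) ?_
    simpa using (tendsto_pow_atTop_nhds_zero_of_lt_one hγ hγ1).const_mul
      (1 * (R * (1 + 2 * C)) * V x)
  simp only [hiter] at hlim
  have := tendsto_nhds_unique tendsto_const_nhds hlim
  simpa [hI, integral_indicator hB, Measure.real] using this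

end Invariant

/-! ### The flow followed by the jump, and its hazard rate in the post-jump variable. -/

open Filter Topology

/-- The standing assumptions on the known data. -/
structure Model (E : Set ℝ) (φ : ℝ → ℝ → ℝ) (f mlo Mup : ℝ → ℝ) (κ r a b : ℝ) : Prop where
  E_eq : E = Ici 0 ∨ E = Ioi 0
  flow : IsFlow E φ
  jump : IsJumpMap f
  bounds : Bounds E φ f mlo Mup κ
  r_pos : 0 < r
  a_pos : 0 < a
  b_pos : 0 < b

/-- The inverse of the path `t ↦ f (φ x t)`. -/
def jinv (φ : ℝ → ℝ → ℝ) (f : ℝ → ℝ) (x : ℝ) : ℝ → ℝ :=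
  Function.invFunOn (fun t => f (φ x t)) (Ici 0)

namespace Model

variable {E : Set ℝ} {φ : ℝ → ℝ → ℝ} {f mlo Mup : ℝ → ℝ} {κ r L a b : ℝ}
  (M : Model E φ f mlo Mup κ r a b)
include M

lemma E_nonneg {x : ℝ} (hx : x ∈ E) : 0 ≤ x := by
  rcases M.E_eq with h | h <;> rw [h] at hx
  · exact hx
  · exact le_of_lt hx

lemma mem_E_of_pos {x : ℝ} (hx : 0 < x) : x ∈ E := by
  rcases M.E_eq with h | h <;> rw [h]
  · exact hx.le
  · exact hx

lemma mem_E_of_le {x y : ℝ} (hx : x ∈ E) (hxy : x ≤ y) : y ∈ E := by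
  rcases M.E_eq with h | h <;> rw [h] at hx ⊢
  · exact le_trans hx hxy
  · exact lt_of_lt_of_le hx hxy

lemma measurableSet_E : MeasurableSet E := by
  rcases M.E_eq with h | h <;> rw [h]
  · exact measurableSet_Ici
  · exact measurableSet_Ioi

lemma f_nonneg {x : ℝ} (hx : 0 ≤ x) : 0 ≤ f x := M.jump.diffeo.bijOn.mapsTo hx

lemma f_zero : f 0 = 0 := by
  obtain ⟨x, hx, h0⟩ := M.jump.diffeo.bijOn.surjOn (self_mem_Ici : (0 : ℝ) ∈ Ici 0)
  have h1 := M.jump.strictMonoOn.monotoneOn self_mem_Ici hx hx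
  exact le_antisymm (h1.trans h0.le) (M.f_nonneg le_rfl)

lemma f_pos {x : ℝ} (hx : 0 < x) : 0 < f x := (M.bounds.f_bounds x hx).1

lemma f_le {x : ℝ} (hx : 0 ≤ x) : f x ≤ κ * x := by
  rcases hx.eq_or_lt with rfl | h
  · simp [M.f_zero]
  · exact (M.bounds.f_bounds x h).2

lemma f_mono {x y : ℝ} (hx : 0 ≤ x) (hxy : x ≤ y) : f x ≤ f y :=
  M.jump.strictMonoOn.monotoneOn hx (hx.trans hxy) hxy

lemma f_continuousOn : ContinuousOn f (Ici 0) := M.jump.diffeo.contDiffOn.continuousOn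

lemma f_finv {y : ℝ} (hy : 0 ≤ y) : f (finv f y) = y :=
  M.jump.diffeo.bijOn.invOn_invFunOn.2 hy

lemma finv_f {x : ℝ} (hx : 0 ≤ x) : finv f (f x) = x :=
  M.jump.diffeo.bijOn.invOn_invFunOn.1 hx

lemma finv_nonneg {y : ℝ} (hy : 0 ≤ y) : 0 ≤ finv f y :=
  M.jump.diffeo.bijOn.surjOn.mapsTo_invFunOn hy

lemma le_finv {x y : ℝ} (hx : 0 ≤ x) (hxy : f x ≤ y) : x ≤ finv f y := by
  have hy : 0 ≤ y := (M.f_nonneg hx).trans hxy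
  rw [← M.jump.strictMonoOn.le_iff_le hx (M.finv_nonneg hy), M.f_finv hy]
  exact hxy

lemma finv_continuousOn : ContinuousOn (finv f) (Ici 0) :=
  M.jump.diffeo.contDiffOn_inv.continuousOn

lemma f_mem_E {x : ℝ} (hx : x ∈ E) : f x ∈ E := by
  rcases (M.E_nonneg hx).eq_or_lt with h | h
  · rw [← h, M.f_zero, h]; exact hx
  · exact M.mem_E_of_pos (M.f_pos h)

lemma le_flow {x t : ℝ} (hx : x ∈ E) (ht : 0 ≤ t) : x ≤ φ x t :=
  (M.flow.diffeo x hx).bijOn.mapsTo ht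

lemma flow_nonneg {x t : ℝ} (hx : x ∈ E) (ht : 0 ≤ t) : 0 ≤ φ x t :=
  (M.E_nonneg hx).trans (M.le_flow hx ht)

lemma f_flow_mem_E {x t : ℝ} (hx : x ∈ E) (ht : 0 ≤ t) : f (φ x t) ∈ E :=
  M.f_mem_E (M.mem_E_of_le hx (M.le_flow hx ht))

lemma bijOn_path {x : ℝ} (hx : x ∈ E) : BijOn (fun t => f (φ x t)) (Ici 0) (Ici (f x)) := by
  have h0 := M.E_nonneg hx
  refine BijOn.comp (g := f) ?_ (M.flow.diffeo x hx).bijOn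
  refine ⟨fun y hy => M.f_mono h0 hy,
    M.jump.strictMonoOn.injOn.mono (Ici_subset_Ici.2 h0), fun y hy => ?_⟩
  exact ⟨finv f y, M.le_finv h0 hy, M.f_finv ((M.f_nonneg h0).trans hy)⟩

lemma bijOn_jinv {x : ℝ} (hx : x ∈ E) : BijOn (jinv φ f x) (Ici (f x)) (Ici 0) :=
  (bijOn_comm (M.bijOn_path hx).invOn_invFunOn).2 (M.bijOn_path hx)

lemma f_flow_jinv {x y : ℝ} (hx : x ∈ E) (hy : f x ≤ y) : f (φ x (jinv φ f x y)) = y :=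
  (M.bijOn_path hx).invOn_invFunOn.2 hy

lemma jinv_f_flow {x t : ℝ} (hx : x ∈ E) (ht : 0 ≤ t) : jinv φ f x (f (φ x t)) = t :=
  (M.bijOn_path hx).invOn_invFunOn.1 ht

lemma jinv_nonneg {x y : ℝ} (hx : x ∈ E) (hy : f x ≤ y) : 0 ≤ jinv φ f x y :=
  (M.bijOn_jinv hx).mapsTo hy

/-- In the post-jump variable the pre-jump position no longer depends on the starting point; this is
what makes comparison over different x possible. -/
lemma flow_jinv {x y : ℝ} (hx : x ∈ E) (hy : f x ≤ y) : φ x (jinv φ f x y) = finv f y := by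
  rw [← M.finv_f (M.flow_nonneg hx (M.jinv_nonneg hx hy)), M.f_flow_jinv hx hy]

lemma jinv_f {x : ℝ} (hx : x ∈ E) : jinv φ f x (f x) = 0 := by
  have := M.jinv_f_flow hx le_rfl
  rwa [M.flow.zero x hx] at this

lemma contDiffOn_jinv {x : ℝ} (hx : x ∈ E) : ContDiffOn ℝ 1 (jinv φ f x) (Ici (f x)) := by
  have h0 := M.E_nonneg hx
  have h1 : ContDiffOn ℝ 1 (fun y => Function.invFunOn (φ x) (Ici 0) (finv f y)) (Ici (f x)) :=
    (M.flow.diffeo x hx).contDiffOn_inv.comp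
      (M.jump.diffeo.contDiffOn_inv.mono (Ici_subset_Ici.2 (M.f_nonneg h0)))
      (fun y hy => M.le_finv h0 hy)
  refine h1.congr fun y hy => ?_
  have h2 := (M.flow.diffeo x hx).bijOn.invOn_invFunOn.1 (M.jinv_nonneg hx hy)
  rw [← M.flow_jinv hx hy, h2]

lemma hasDerivWithinAt_jinv {x y : ℝ} (hx : x ∈ E) (hy : f x ≤ y) :
    HasDerivWithinAt (jinv φ f x) (g φ f x y) (Ici (f x)) y :=
  ((M.contDiffOn_jinv hx).differentiableOn (by simp) y hy).hasDerivWithinAt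

lemma continuousOn_g {x : ℝ} (hx : x ∈ E) : ContinuousOn (g φ f x) (Ici (f x)) :=
  (M.contDiffOn_jinv hx).continuousOn_derivWithin (uniqueDiffOn_Ici _) le_rfl

lemma strictMonoOn_jinv {x : ℝ} (hx : x ∈ E) : StrictMonoOn (jinv φ f x) (Ici (f x)) := by
  refine strictMonoOn_of_deriv_pos (convex_Ici _) (M.contDiffOn_jinv hx).continuousOn ?_
  intro y hy
  rw [interior_Ici] at hy
  have hy0 : 0 < y := (M.f_nonneg (M.E_nonneg hx)).trans_lt hy
  rw [((M.hasDerivWithinAt_jinv hx (le_of_lt hy)).hasDerivAt (Ici_mem_nhds hy)).deriv]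
  exact (M.bounds.mlo_pos y hy0).trans_le (M.bounds.g_bounds x hx y hy0 (le_of_lt hy)).1

end Model

/-- The jump rate in the variable `y = f (φ x t)`, extended by a constant to the left of `f x`. -/
def hazard (φ : ℝ → ℝ → ℝ) (f lam : ℝ → ℝ) (x u : ℝ) : ℝ :=
  lam (finv f (max (f x) u)) * g φ f x (max (f x) u)

/-- The primitive of the hazard rate. -/
def cumHazard (φ : ℝ → ℝ → ℝ) (f lam : ℝ → ℝ) (x y : ℝ) : ℝ := ∫ u in f x..y, hazard φ f lam x u

namespace Model

variable {E : Set ℝ} {φ : ℝ → ℝ → ℝ} {f mlo Mup lam : ℝ → ℝ} {κ r L a b : ℝ}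
  (M : Model E φ f mlo Mup κ r a b)

lemma _root_.PDMP.hazard_of_le {x u : ℝ} (hu : f x ≤ u) :
    hazard φ f lam x u = lam (finv f u) * g φ f x u := by rw [hazard, max_eq_right hu]

lemma _root_.PDMP.transDensity_of_le {x y : ℝ} (hy : f x ≤ y) :
    transDensity φ f lam x y = hazard φ f lam x y * Real.exp (-cumHazard φ f lam x y) := by
  rw [transDensity, indicator_of_mem (show y ∈ Ici (f x) from hy), hazard_of_le hy, cumHazard]
  congr 3
  refine intervalIntegral.integral_congr fun u hu => ?_
  rw [uIcc_of_le hy] at hu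
  exact (hazard_of_le hu.1).symm

lemma _root_.PDMP.transDensity_of_lt {x y : ℝ} (hy : y < f x) :
    transDensity φ f lam x y = 0 := by
  rw [transDensity, indicator_of_notMem (show y ∉ Ici (f x) from not_le.2 hy)]

include M

section

variable (hlam : ContinuousOn lam (Ici 0))
include hlam

/-- Freezing the argument to the left of f x makes the hazard continuous on the whole line, so its
primitive has two-sided derivatives even at f x. -/
lemma continuous_hazard {x : ℝ} (hx : x ∈ E) : Continuous (hazard φ f lam x) := by
  have h0 := M.f_nonneg (M.E_nonneg hx)
  have hc : Continuous fun u : ℝ => max (f x) u := continuous_const.max continuous_id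
  have h1 : ContinuousOn (fun u => lam (finv f u)) (Ici 0) :=
    hlam.comp M.finv_continuousOn fun u hu => M.finv_nonneg hu
  exact (h1.comp_continuous hc fun u => h0.trans (le_max_left _ _)).mul
    ((M.continuousOn_g hx).comp_continuous hc fun u => mem_Ici.2 (le_max_left _ _))

lemma hasDerivAt_cumHazard {x : ℝ} (hx : x ∈ E) (y : ℝ) :
    HasDerivAt (cumHazard φ f lam x) (hazard φ f lam x y) y :=
  intervalIntegral.integral_hasDerivAt_right
    ((M.continuous_hazard hlam hx).intervalIntegrable _ _)
    (M.continuous_hazard hlam hx).stronglyMeasurable.stronglyMeasurableAtFilter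
    (M.continuous_hazard hlam hx).continuousAt

variable (hlam0 : ∀ x, 0 ≤ x → 0 ≤ lam x)
include hlam0

/-- The bounds on `g` are assumed only for y > 0, so an endpoint f x = 0 is reached by continuity
from the right. -/
lemma hazard_nonneg {x : ℝ} (hx : x ∈ E) (u : ℝ) : 0 ≤ hazard φ f lam x u := by
  have h0 := M.f_nonneg (M.E_nonneg hx)
  have h1 : Ioi (f x) ⊆ {u | 0 ≤ hazard φ f lam x u} := fun u hu => by
    have hu0 : 0 < u := h0.trans_lt hu
    show 0 ≤ hazard φ f lam x u
    rw [hazard_of_le (le_of_lt hu)]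
    exact mul_nonneg (hlam0 _ (M.finv_nonneg hu0.le)) ((M.bounds.mlo_pos u hu0).le.trans
      (M.bounds.g_bounds x hx u hu0 (le_of_lt hu)).1)
  have h2 : Ici (f x) ⊆ {u | 0 ≤ hazard φ f lam x u} := by
    rw [← closure_Ioi]
    exact closure_minimal h1 (isClosed_le continuous_const (M.continuous_hazard hlam hx))
  have h3 := h2 (mem_Ici.2 (le_max_left (f x) u))
  simpa [hazard] using h3

lemma cumHazard_mono {x : ℝ} (hx : x ∈ E) : Monotone (cumHazard φ f lam x) :=
  monotone_of_deriv_nonneg (fun y => (M.hasDerivAt_cumHazard hlam hx y).differentiableAt)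
    fun y => by
      rw [(M.hasDerivAt_cumHazard hlam hx y).deriv]
      exact M.hazard_nonneg hlam hlam0 hx y

end

end Model

lemma cumHazard_self {φ : ℝ → ℝ → ℝ} {f lam : ℝ → ℝ} (x : ℝ) :
    cumHazard φ f lam x (f x) = 0 := intervalIntegral.integral_same

lemma lintegral_Ioi_deriv_eq {F F' : ℝ → ℝ} {a l : ℝ} (hd : ∀ x ∈ Ici a, HasDerivAt F (F' x) x)
    (hpos : ∀ x ∈ Ioi a, 0 ≤ F' x) (hl : Tendsto F atTop (𝓝 l)) :
    ∫⁻ x in Ioi a, ENNReal.ofReal (F' x) = ENNReal.ofReal (l - F a) := by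
  rw [← ofReal_integral_eq_lintegral_ofReal (integrableOn_Ioi_deriv_of_nonneg' hd hpos hl)
    ((ae_restrict_iff' measurableSet_Ioi).2 (ae_of_all _ hpos)),
    integral_Ioi_of_hasDerivAt_of_nonneg' hd hpos hl]

/-- For antiderivatives that are bounded above but whose limit is not identified: monotonicity
supplies some limit, and it is at most B. -/
lemma lintegral_Ioi_deriv_le {F F' : ℝ → ℝ} {a B : ℝ} (hd : ∀ x, HasDerivAt F (F' x) x)
    (hpos : ∀ x ∈ Ioi a, 0 ≤ F' x) (hB : ∀ x, F x ≤ B) :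
    ∫⁻ x in Ioi a, ENNReal.ofReal (F' x) ≤ ENNReal.ofReal (B - F a) := by
  have hmono : MonotoneOn F (Ici a) := by
    refine monotoneOn_of_deriv_nonneg (convex_Ici a)
      (fun x _ => (hd x).continuousAt.continuousWithinAt)
      (fun x _ => (hd x).differentiableAt.differentiableWithinAt) fun x hx => ?_
    rw [interior_Ici] at hx
    rw [(hd x).deriv]
    exact hpos x hx
  have hm2 : Monotone fun x => F (max a x) := fun x y hxy =>
    hmono (mem_Ici.2 (le_max_left _ _)) (mem_Ici.2 (le_max_left _ _)) (max_le_max le_rfl hxy)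
  have hlim := tendsto_atTop_ciSup hm2 ⟨B, by rintro _ ⟨x, rfl⟩; exact hB _⟩
  have hlim' : Tendsto F atTop (𝓝 (⨆ x, F (max a x))) := by
    refine hlim.congr' ?_
    filter_upwards [eventually_ge_atTop a] with x hx
    rw [max_eq_right hx]
  rw [lintegral_Ioi_deriv_eq (fun x _ => hd x) hpos hlim']
  exact ENNReal.ofReal_le_ofReal (sub_le_sub_right (ciSup_le fun x => hB _) _)

/-! ### Transition probabilities and the drift condition. -/

namespace Model

variable {E : Set ℝ} {φ : ℝ → ℝ → ℝ} {f mlo Mup lam : ℝ → ℝ} {κ r L a b : ℝ}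
  (M : Model E φ f mlo Mup κ r a b) (hlam : lam ∈ rateClass f mlo Mup r L a b)

include M

lemma kappa_pow_pos : 0 < κ ^ (b + 1) := Real.rpow_pos_of_pos M.bounds.κ_pos _

lemma kappa_pow_lt_one : κ ^ (b + 1) < 1 :=
  Real.rpow_lt_one M.bounds.κ_pos.le M.bounds.κ_lt_one (by linarith [M.b_pos])

include hlam

/-- Beyond f(max r x) the pre-jump position is at least r, so the class bounds the rate below by a
u^b / mlo u, and the factor g ≥ mlo u cancels the denominator. -/
lemma hazard_ge {x u : ℝ} (hx : x ∈ E) (hu : f (max r x) ≤ u) :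
    a * u ^ b ≤ hazard φ f lam x u := by
  have hx0 := M.E_nonneg hx
  have hr := M.r_pos
  have h1 : max r x ≤ finv f u := M.le_finv (hx0.trans (le_max_right _ _)) hu
  have hu0 : 0 < u := (M.f_pos (lt_max_of_lt_left hr)).trans_le hu
  have hxu : f x ≤ u := (M.f_mono hx0 (le_max_right _ _)).trans hu
  have h2 := hlam.2.2.1 (finv f u) ((le_max_left _ _).trans h1)
  rw [M.f_finv hu0.le, div_le_div_iff₀ (M.bounds.mlo_pos u hu0) M.a_pos] at h2
  rw [hazard_of_le hxu]
  have h3 := (M.bounds.g_bounds x hx u hu0 hxu).1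
  have h4 := hlam.2.1 _ (M.finv_nonneg hu0.le)
  nlinarith [mul_le_mul_of_nonneg_left h3 h4]

lemma cumHazard_sub_ge {x y z : ℝ} (hx : x ∈ E) (hy : f (max r x) ≤ y) (hyz : y ≤ z) :
    a * y ^ b * (z - y) ≤ cumHazard φ f lam x z - cumHazard φ f lam x y := by
  have hy0 : 0 < y := (M.f_pos (lt_max_of_lt_left M.r_pos)).trans_le hy
  have hmono : MonotoneOn (fun u => cumHazard φ f lam x u - a * y ^ b * u) (Ici y) := by
    have hd : ∀ u, HasDerivAt (fun u => cumHazard φ f lam x u - a * y ^ b * u)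
        (hazard φ f lam x u - a * y ^ b * 1) u := fun u =>
      (M.hasDerivAt_cumHazard hlam.1 hx u).sub ((hasDerivAt_id u).const_mul _)
    refine monotoneOn_of_deriv_nonneg (convex_Ici y)
      (fun x _ => (hd x).continuousAt.continuousWithinAt)
      (fun x _ => (hd x).differentiableAt.differentiableWithinAt) fun u hu => ?_
    rw [interior_Ici] at hu
    rw [(hd u).deriv, mul_one, sub_nonneg]
    refine le_trans ?_ (M.hazard_ge hlam hx (hy.trans (le_of_lt hu)))
    exact mul_le_mul_of_nonneg_left (Real.rpow_le_rpow hy0.le (le_of_lt hu) M.b_pos.le) M.a_pos.le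
  have := hmono self_mem_Ici hyz hyz
  simp only at this
  linarith

lemma tendsto_cumHazard {x : ℝ} (hx : x ∈ E) : Tendsto (cumHazard φ f lam x) atTop atTop := by
  set y := f (max r x)
  have hy0 : 0 < y := M.f_pos (lt_max_of_lt_left M.r_pos)
  have hc : 0 < a * y ^ b := mul_pos M.a_pos (Real.rpow_pos_of_pos hy0 b)
  have h1 : Tendsto (fun z => cumHazard φ f lam x y + a * y ^ b * (z - y)) atTop atTop :=
    tendsto_atTop_add_const_left _ _
      ((tendsto_atTop_add_const_right _ (-y) tendsto_id).const_mul_atTop hc)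
  refine tendsto_atTop_mono' _ ?_ h1
  filter_upwards [eventually_ge_atTop y] with z hz
  linarith [M.cumHazard_sub_ge hlam hx le_rfl hz]

lemma hasDerivAt_survival {x : ℝ} (hx : x ∈ E) (u : ℝ) :
    HasDerivAt (fun u => Real.exp (-cumHazard φ f lam x u))
      (-(hazard φ f lam x u * Real.exp (-cumHazard φ f lam x u))) u := by
  refine (M.hasDerivAt_cumHazard hlam.1 hx u).neg.exp.congr_deriv ?_
  simp only [Pi.neg_apply]
  ring

/-- The density is the derivative of -exp(-H) for the cumulated hazard H, and H tends to infinity.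
-/
lemma transMeasure_Ioi {x y : ℝ} (hx : x ∈ E) (hy : f x ≤ y) :
    transMeasure φ f lam x (Ioi y) = ENNReal.ofReal (Real.exp (-cumHazard φ f lam x y)) := by
  rw [transMeasure, withDensity_apply _ measurableSet_Ioi]
  have h1 : ∫⁻ u in Ioi y, ENNReal.ofReal (transDensity φ f lam x u) = ∫⁻ u in Ioi y,
      ENNReal.ofReal (hazard φ f lam x u * Real.exp (-cumHazard φ f lam x u)) :=
    setLIntegral_congr_fun measurableSet_Ioi fun u hu => by
      rw [transDensity_of_le (hy.trans (le_of_lt hu))]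
  have hd : ∀ u, HasDerivAt (fun u => -Real.exp (-cumHazard φ f lam x u))
      (hazard φ f lam x u * Real.exp (-cumHazard φ f lam x u)) u := fun u =>
    (M.hasDerivAt_survival hlam hx u).neg.congr_deriv (neg_neg _)
  have hl : Tendsto (fun u => -Real.exp (-cumHazard φ f lam x u)) atTop (𝓝 0) := by
    rw [← neg_zero]
    exact (Real.tendsto_exp_neg_atTop_nhds_zero.comp (M.tendsto_cumHazard hlam hx)).neg
  rw [h1, lintegral_Ioi_deriv_eq (fun u _ => hd u)
    (fun u _ => mul_nonneg (M.hazard_nonneg hlam.1 hlam.2.1 hx u) (Real.exp_pos _).le) hl]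
  simp

omit M hlam in
lemma _root_.PDMP.transMeasure_Iio (x : ℝ) : transMeasure φ f lam x (Iio (f x)) = 0 := by
  rw [transMeasure, withDensity_apply _ measurableSet_Iio]
  rw [setLIntegral_congr_fun (g := fun _ => 0) measurableSet_Iio fun u hu => by
    rw [transDensity_of_lt hu, ENNReal.ofReal_zero]]
  simp

omit M hlam in
lemma _root_.PDMP.transMeasure_absolutelyContinuous (x : ℝ) :
    transMeasure φ f lam x ≪ volume := withDensity_absolutelyContinuous _ _

lemma isProbabilityMeasure_transMeasure {x : ℝ} (hx : x ∈ E) :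
    IsProbabilityMeasure (transMeasure φ f lam x) := by
  refine ⟨?_⟩
  have h1 : transMeasure φ f lam x (Iic (f x)) = 0 := by
    rw [← Iio_union_right, measure_union_null_iff]
    exact ⟨transMeasure_Iio x, transMeasure_absolutelyContinuous x (by simp)⟩
  have h2 := M.transMeasure_Ioi hlam hx le_rfl
  rw [cumHazard_self, neg_zero, Real.exp_zero, ENNReal.ofReal_one] at h2
  rw [← Iic_union_Ioi (a := f x), measure_union (Iic_disjoint_Ioi le_rfl) measurableSet_Ioi, h1,
    h2, zero_add]

omit hlam in
lemma transMeasure_compl {x : ℝ} (hx : x ∈ E) : transMeasure φ f lam x Eᶜ = 0 := by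
  refine measure_mono_null (fun y hy => ?_) (transMeasure_Iio x)
  by_contra h
  exact hy (M.mem_E_of_le (M.f_mem_E hx) (not_lt.1 h))

omit M hlam in
/-- Comparison function for the drift condition. -/
def _root_.PDMP.driftBound (κ a b y : ℝ) : ℝ := Real.exp (κ ^ (b + 1) * (a / (b + 1)) * y ^ (b + 1))

omit hlam in
lemma V_le_driftBound {y : ℝ} (hy : 0 ≤ y) : V f a b y ≤ driftBound κ a b y := by
  have hb := M.b_pos
  have ha := M.a_pos
  rw [V, driftBound, Real.exp_le_exp, mul_assoc, mul_left_comm,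
    ← Real.mul_rpow M.bounds.κ_pos.le hy]
  exact mul_le_mul_of_nonneg_left (Real.rpow_le_rpow (M.f_nonneg hy) (M.f_le hy) (by linarith))
    (by positivity)

omit hlam in
lemma hasDerivAt_driftBound (y : ℝ) : HasDerivAt (driftBound κ a b)
    (κ ^ (b + 1) * (a * y ^ b) * driftBound κ a b y) y := by
  have hb := M.b_pos
  have h1 := ((Real.hasDerivAt_rpow_const (x := y) (p := b + 1) (Or.inr (by linarith))).const_mul
    (κ ^ (b + 1) * (a / (b + 1)))).exp
  refine h1.congr_deriv ?_
  rw [driftBound, add_sub_cancel_right]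
  field_simp

/-- Let W be the drift bound, S the survival function, h the hazard and s = κ^(b+1). The derivative
of -W S/(1 - s) is (h - s a u^b) W S/(1 - s), which is at least W h S exactly when h ≥ a u^b. So the
integral of W against the density h S is bounded by the boundary term W(y) S(y)/(1 - s), without
identifying the limit of W S. -/
lemma setLIntegral_driftBound_le {x y : ℝ} (hx : x ∈ E) (hy : f (max r x) ≤ y) :
    ∫⁻ u in Ioi y, ENNReal.ofReal (driftBound κ a b u) ∂(transMeasure φ f lam x) ≤
      ENNReal.ofReal (driftBound κ a b y / (1 - κ ^ (b + 1))) := by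
  have hκ := M.kappa_pow_lt_one
  have hκ0 := M.kappa_pow_pos
  have hκ' : 0 < 1 - κ ^ (b + 1) := by linarith
  have hb := M.b_pos
  have ha := M.a_pos
  have hy0 : 0 < y := (M.f_pos (lt_max_of_lt_left M.r_pos)).trans_le hy
  have hfx : f x ≤ y := (M.f_mono (M.E_nonneg hx) (le_max_right _ _)).trans hy
  have hm1 : Measurable (driftBound κ a b) := by unfold driftBound; fun_prop
  have hhz := M.continuous_hazard hlam.1 hx
  have hHc : Continuous (cumHazard φ f lam x) := continuous_iff_continuousAt.2 fun y =>
    (M.hasDerivAt_cumHazard hlam.1 hx y).continuousAt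
  set S : ℝ → ℝ := fun u => Real.exp (-cumHazard φ f lam x u) with hS
  have hS0 : ∀ u, 0 < S u := fun u => Real.exp_pos _
  have hW0 : ∀ u, 0 < driftBound κ a b u := fun u => Real.exp_pos _
  have hdS : ∀ u, HasDerivAt S (-(hazard φ f lam x u * S u)) u :=
    M.hasDerivAt_survival hlam hx
  have hd : ∀ u, HasDerivAt (fun u => -(driftBound κ a b u * S u) / (1 - κ ^ (b + 1)))
      ((hazard φ f lam x u - κ ^ (b + 1) * (a * u ^ b)) * driftBound κ a b u * S u
        / (1 - κ ^ (b + 1))) u := fun u =>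
    (((M.hasDerivAt_driftBound u).mul (hdS u)).neg.div_const _).congr_deriv (by ring)
  have hge : ∀ u ∈ Ioi y, driftBound κ a b u * (hazard φ f lam x u * S u) ≤
      (hazard φ f lam x u - κ ^ (b + 1) * (a * u ^ b)) * driftBound κ a b u * S u
        / (1 - κ ^ (b + 1)) := by
    intro u hu
    rw [le_div_iff₀ hκ']
    have h1 := M.hazard_ge hlam hx (hy.trans (le_of_lt hu))
    have h2 : 0 ≤ κ ^ (b + 1) * (hazard φ f lam x u - a * u ^ b) :=
      mul_nonneg hκ0.le (by linarith)
    nlinarith [mul_nonneg h2 (mul_pos (hW0 u) (hS0 u)).le]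
  have hdens : ∀ u ∈ Ioi y, ENNReal.ofReal (transDensity φ f lam x u) =
      ENNReal.ofReal (hazard φ f lam x u * S u) := fun u hu => by
    rw [transDensity_of_le (hfx.trans (le_of_lt hu))]
  have hdm : Measurable fun u => ENNReal.ofReal (hazard φ f lam x u * S u) :=
    (hhz.mul (Real.continuous_exp.comp hHc.neg)).measurable.ennreal_ofReal
  have hrestr : (transMeasure φ f lam x).restrict (Ioi y) =
      (volume.restrict (Ioi y)).withDensity
        fun u => ENNReal.ofReal (hazard φ f lam x u * S u) := by
    rw [transMeasure, restrict_withDensity measurableSet_Ioi]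
    exact withDensity_congr_ae ((ae_restrict_iff' measurableSet_Ioi).2 (ae_of_all _ hdens))
  rw [hrestr, lintegral_withDensity_eq_lintegral_mul _ hdm hm1.ennreal_ofReal]
  calc _ ≤ ∫⁻ u in Ioi y, ENNReal.ofReal ((hazard φ f lam x u - κ ^ (b + 1) * (a * u ^ b)) *
        driftBound κ a b u * S u / (1 - κ ^ (b + 1))) := by
        refine setLIntegral_mono' measurableSet_Ioi fun u hu => ?_
        rw [Pi.mul_apply, ← ENNReal.ofReal_mul
          (mul_nonneg (M.hazard_nonneg hlam.1 hlam.2.1 hx u) (hS0 u).le), mul_comm]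
        exact ENNReal.ofReal_le_ofReal (hge u hu)
    _ ≤ ENNReal.ofReal (0 - -(driftBound κ a b y * S y) / (1 - κ ^ (b + 1))) := by
        refine lintegral_Ioi_deriv_le hd (fun u hu => ?_) fun u => ?_
        · exact le_trans (mul_nonneg (hW0 u).le (mul_nonneg
            (M.hazard_nonneg hlam.1 hlam.2.1 hx u) (hS0 u).le)) (hge u hu)
        · exact div_nonpos_of_nonpos_of_nonneg
            (neg_nonpos.2 (mul_pos (hW0 u) (hS0 u)).le) hκ'.le
    _ ≤ _ := by
        refine ENNReal.ofReal_le_ofReal ?_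
        rw [zero_sub, ← neg_div, neg_neg]
        refine div_le_div_of_nonneg_right ?_ hκ'.le
        refine mul_le_of_le_one_right (hW0 y).le ?_
        rw [hS]
        simp only [Real.exp_le_one_iff, Left.neg_nonpos_iff]
        rw [← cumHazard_self (φ := φ) (f := f) (lam := lam) x]
        exact M.cumHazard_mono hlam.1 hlam.2.1 hx hfx

omit hlam in
lemma V_mono {x y : ℝ} (hx : 0 ≤ x) (hxy : x ≤ y) : V f a b x ≤ V f a b y := by
  have hb := M.b_pos
  have ha := M.a_pos
  rw [V, V, Real.exp_le_exp]
  exact mul_le_mul_of_nonneg_left (Real.rpow_le_rpow (M.f_nonneg hx) (M.f_mono hx hxy)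
    (by linarith)) (by positivity)

omit hlam in
lemma one_le_V {x : ℝ} (hx : 0 ≤ x) : 1 ≤ V f a b x := by
  have hb := M.b_pos
  have ha := M.a_pos
  have := M.f_nonneg hx
  exact Real.one_le_exp (by positivity)

-- The power κ^(b+1) is below 1, so the bound on P V is sublinear in V; this is the source of the
-- geometric drift.
omit M hlam in
lemma _root_.PDMP.driftBound_f (x : ℝ) :
    driftBound κ a b (f x) = V f a b x ^ (κ ^ (b + 1)) := by
  rw [driftBound, V, ← Real.exp_mul]
  congr 1; ring

/-- The integral is split at y₀ = f(max r x): below it V ≤ W(y₀) by monotonicity, which gives the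
term 1, and above it the tail estimate gives 1/(1 - κ^(b+1)). -/
lemma lintegral_V_le {x : ℝ} (hx : x ∈ E) :
    ∫⁻ y, ENNReal.ofReal (V f a b y) ∂(transMeasure φ f lam x) ≤
      ENNReal.ofReal ((1 + 1 / (1 - κ ^ (b + 1))) * driftBound κ a b (f (max r x))) := by
  have hκ := M.kappa_pow_lt_one
  have hκ' : 0 < 1 - κ ^ (b + 1) := by linarith
  have := M.isProbabilityMeasure_transMeasure hlam hx
  set y₀ := f (max r x)
  have hy0 : 0 ≤ y₀ := M.f_nonneg ((M.E_nonneg hx).trans (le_max_right _ _))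
  have hW0 : 0 < driftBound κ a b y₀ := Real.exp_pos _
  have hE : ∀ᵐ y ∂(transMeasure φ f lam x), y ∈ E := by
    rw [ae_iff]; exact M.transMeasure_compl hx
  rw [← lintegral_add_compl _ (measurableSet_Iic (a := y₀)), compl_Iic, add_mul, one_mul,
    ENNReal.ofReal_add hW0.le (by positivity)]
  refine add_le_add ?_ ?_
  · calc _ ≤ ∫⁻ y in Iic y₀, ENNReal.ofReal (driftBound κ a b y₀) ∂(transMeasure φ f lam x) := by
          refine lintegral_mono_ae ?_
          filter_upwards [ae_restrict_of_ae hE, ae_restrict_mem measurableSet_Iic] with y hy hy'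
          exact ENNReal.ofReal_le_ofReal
            ((M.V_mono (M.E_nonneg hy) hy').trans (M.V_le_driftBound hy0))
      _ ≤ _ := by
          rw [setLIntegral_const]
          exact mul_le_of_le_one_right zero_le prob_le_one
  · rw [one_div, ← div_eq_inv_mul]
    refine le_trans (lintegral_mono_ae ?_) (M.setLIntegral_driftBound_le hlam hx le_rfl)
    filter_upwards [ae_restrict_mem measurableSet_Ioi] with y hy
    exact ENNReal.ofReal_le_ofReal (M.V_le_driftBound (hy0.trans (le_of_lt hy)))

omit hlam in
/-- The bound of `lintegral_V_le` is at most `V / 2` plus a constant. -/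
lemma exists_drift_const : ∃ C : ℝ, 0 ≤ C ∧ ∀ x, 0 ≤ x →
    (1 + 1 / (1 - κ ^ (b + 1))) * driftBound κ a b (f (max r x)) ≤ V f a b x / 2 + C := by
  set s := κ ^ (b + 1)
  have hs1 : s < 1 := M.kappa_pow_lt_one
  have hs0 : 0 < s := M.kappa_pow_pos
  have hs' : 0 < 1 - s := by linarith
  have hr := M.r_pos
  set c := 1 + 1 / (1 - s)
  have hc : 0 < c := by positivity
  -- Chosen so that (V/2)^s w^(1-s) = c V^s; the weighted arithmetic–geometric inequality then
  -- bounds c V^s by V/2 + w.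
  set w : ℝ := (c * 2 ^ s) ^ (1 / (1 - s))
  have hw : 0 < w := by positivity
  have hWr : 0 < driftBound κ a b (f r) := Real.exp_pos _
  refine ⟨c * driftBound κ a b (f r) + w, by positivity, fun x hx => ?_⟩
  have hV := M.one_le_V hx
  have hV0 : 0 < V f a b x := by linarith
  have key : c * V f a b x ^ s ≤ V f a b x / 2 + w := by
    have h1 := Real.geom_mean_le_arith_mean2_weighted hs0.le hs'.le
      (by positivity : 0 ≤ V f a b x / 2) hw.le (by ring)
    have h2 : w ^ (1 - s) = c * 2 ^ s := by
      rw [← Real.rpow_mul (by positivity), one_div, inv_mul_cancel₀ hs'.ne', Real.rpow_one]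
    rw [h2, Real.div_rpow hV0.le (by norm_num)] at h1
    have h3 : V f a b x ^ s / 2 ^ s * (c * 2 ^ s) = c * V f a b x ^ s := by
      have : (2 : ℝ) ^ s ≠ 0 := by positivity
      field_simp
    rw [h3] at h1
    nlinarith
  rcases le_total x r with h | h
  · rw [max_eq_left h]; linarith
  · rw [max_eq_right h, driftBound_f x]
    have : 0 ≤ c * driftBound κ a b (f r) := by positivity
    linarith

end Model

/-! ### The waiting-time kernel and the jump kernel on the whole line. -/

lemma measurable_comp_of_continuousOn {α β γ : Type*} [MeasurableSpace α] [TopologicalSpace β]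
    [MeasurableSpace β] [BorelSpace β] [TopologicalSpace γ] [MeasurableSpace γ] [BorelSpace γ]
    {F : β → γ} {s : Set β} (hF : ContinuousOn F s) {m : α → β} (hm : Measurable m)
    (hms : ∀ x, m x ∈ s) : Measurable fun x => F (m x) :=
  (continuousOn_iff_continuous_domRestrict.1 hF).measurable.comp (hm.subtype_mk (h := hms))

open Classical in
/-- A retraction of the line onto the state space. -/
def retr (E : Set ℝ) (x : ℝ) : ℝ := if x ∈ E then x else 1

lemma retr_of_mem {E : Set ℝ} {x : ℝ} (hx : x ∈ E) : retr E x = x := if_pos hx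

/-- The post-jump location as a function of the starting point and of the waiting time. -/
def jumpMap (E : Set ℝ) (φ : ℝ → ℝ → ℝ) (f : ℝ → ℝ) (p : ℝ × ℝ) : ℝ :=
  f (φ (retr E p.1) (max p.2 0))

/-- The law of the waiting time. -/
def timeKernel (E : Set ℝ) (φ : ℝ → ℝ → ℝ) (lam : ℝ → ℝ) : Kernel ℝ ℝ :=
  Kernel.withDensity (Kernel.const ℝ (volume.restrict (Ici 0))) fun x t =>
    ENNReal.ofReal (lam (φ (retr E x) (max t 0)) *
      Real.exp (-cumRate φ lam (retr E x) (max t 0)))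

/-- The transition kernel of the chain of post-jump locations. -/
def jumpKernel (E : Set ℝ) (φ : ℝ → ℝ → ℝ) (f lam : ℝ → ℝ) : Kernel ℝ ℝ :=
  (Kernel.id ×ₖ timeKernel E φ lam).map (jumpMap E φ f)

namespace Model

variable {E : Set ℝ} {φ : ℝ → ℝ → ℝ} {f mlo Mup lam : ℝ → ℝ} {κ r L a b : ℝ}
  (M : Model E φ f mlo Mup κ r a b) (hlam : lam ∈ rateClass f mlo Mup r L a b)

include M

/-- The default value 1 lies in both possible state spaces. -/
lemma retr_mem (x : ℝ) : retr E x ∈ E := by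
  unfold retr
  split_ifs with h
  · exact h
  · exact M.mem_E_of_pos one_pos

lemma measurable_retr : Measurable (retr E) :=
  Measurable.ite M.measurableSet_E measurable_id measurable_const

lemma measurable_flow : Measurable fun p : ℝ × ℝ => φ (retr E p.1) (max p.2 0) :=
  measurable_comp_of_continuousOn M.flow.contDiffOn.continuousOn
    (m := fun p : ℝ × ℝ => (retr E p.1, max p.2 0))
    ((M.measurable_retr.comp measurable_fst).prodMk (measurable_snd.max measurable_const))
    fun _ => ⟨M.retr_mem _, mem_Ici.2 (le_max_right _ _)⟩

lemma flow_retr_nonneg (p : ℝ × ℝ) : 0 ≤ φ (retr E p.1) (max p.2 0) :=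
  M.flow_nonneg (M.retr_mem _) (le_max_right _ _)

lemma measurable_jumpMap : Measurable (jumpMap E φ f) :=
  measurable_comp_of_continuousOn M.f_continuousOn M.measurable_flow M.flow_retr_nonneg

lemma measurable_jumpMap_right (x : ℝ) : Measurable fun t => jumpMap E φ f (x, t) :=
  M.measurable_jumpMap.comp measurable_prodMk_left

include hlam

lemma measurable_rate_flow : Measurable fun p : ℝ × ℝ => lam (φ (retr E p.1) (max p.2 0)) :=
  measurable_comp_of_continuousOn hlam.1 M.measurable_flow M.flow_retr_nonneg

lemma measurable_cumRate :
    Measurable fun p : ℝ × ℝ => cumRate φ lam (retr E p.1) (max p.2 0) := by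
  have h1 : ∀ p : ℝ × ℝ, cumRate φ lam (retr E p.1) (max p.2 0) =
      ∫ s, {q : (ℝ × ℝ) × ℝ | 0 < q.2 ∧ q.2 ≤ max q.1.2 0}.indicator
        (fun q => lam (φ (retr E q.1.1) (max q.2 0))) (p, s) := fun p => by
    rw [cumRate, intervalIntegral.integral_of_le (le_max_right _ _),
      ← integral_indicator measurableSet_Ioc]
    refine integral_congr_ae (ae_of_all _ fun s => ?_)
    simp only
    by_cases hs : s ∈ Ioc 0 (max p.2 0)
    · rw [indicator_of_mem hs, indicator_of_mem (show (p, s) ∈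
        {q : (ℝ × ℝ) × ℝ | 0 < q.2 ∧ q.2 ≤ max q.1.2 0} from hs), max_eq_left hs.1.le]
    · rw [indicator_of_notMem hs, indicator_of_notMem (show (p, s) ∉
        {q : (ℝ × ℝ) × ℝ | 0 < q.2 ∧ q.2 ≤ max q.1.2 0} from hs)]
  rw [funext h1]
  refine (StronglyMeasurable.integral_prod_right' ?_).measurable
  refine Measurable.stronglyMeasurable (Measurable.indicator ?_ ?_)
  · exact (M.measurable_rate_flow hlam).comp
      ((measurable_fst.comp measurable_fst).prodMk measurable_snd)
  · exact (measurableSet_lt measurable_const measurable_snd).inter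
      (measurableSet_le measurable_snd
        ((measurable_snd.comp measurable_fst).max measurable_const))

lemma measurable_timeDensity : Measurable (Function.uncurry fun x t : ℝ =>
    ENNReal.ofReal (lam (φ (retr E x) (max t 0)) *
      Real.exp (-cumRate φ lam (retr E x) (max t 0)))) :=
  ((M.measurable_rate_flow hlam).mul
    (Real.measurable_exp.comp (M.measurable_cumRate hlam).neg)).ennreal_ofReal

/-- Substitution s = `jinv φ f x u`: the Jacobian is `g`, and the rate along the flow becomes
λ(f⁻¹u). -/
lemma cumRate_jinv {x y : ℝ} (hx : x ∈ E) (hy : f x ≤ y) :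
    cumRate φ lam x (jinv φ f x y) = cumHazard φ f lam x y := by
  have hcont : ContinuousOn (fun s => lam (φ x s)) (Ici 0) :=
    hlam.1.comp (M.flow.diffeo x hx).contDiffOn.continuousOn fun s hs => M.flow_nonneg hx hs
  have hsub : uIcc (f x) y ⊆ Ici (f x) := by rw [uIcc_of_le hy]; exact Icc_subset_Ici_self
  have himg : jinv φ f x '' uIcc (f x) y ⊆ Ici 0 := by
    rintro _ ⟨u, hu, rfl⟩
    exact M.jinv_nonneg hx (hsub hu)
  have hjc : ContinuousOn (jinv φ f x) (uIcc (f x) y) :=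
    (M.contDiffOn_jinv hx).continuousOn.mono hsub
  have h1 := intervalIntegral.integral_comp_mul_deriv'' (a := f x) (b := y) hjc
    (f' := g φ f x) (g := fun s => lam (φ x s))
    (fun u hu => ((M.hasDerivWithinAt_jinv hx (by
      rw [min_eq_left hy] at hu; exact hu.1.le)).mono (fun v hv => by
        rw [min_eq_left hy] at hu; exact (hu.1.trans hv).le)))
    ((M.continuousOn_g hx).mono hsub) (hcont.mono himg)
  rw [M.jinv_f hx] at h1
  rw [cumRate, ← h1, cumHazard]
  refine intervalIntegral.integral_congr fun u hu => ?_
  have hu' : f x ≤ u := hsub hu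
  simp only [Function.comp]
  rw [hazard_of_le hu', M.flow_jinv hx hu']

/-- The same change of variables at the level of laws: pushing the waiting time forward to the
post-jump location produces the stated transition density. -/
lemma map_timeDensity {x : ℝ} (hx : x ∈ E) :
    ((volume.restrict (Ici 0)).withDensity fun t => ENNReal.ofReal (lam (φ x (max t 0)) *
      Real.exp (-cumRate φ lam x (max t 0)))).map (fun t => jumpMap E φ f (x, t))
      = transMeasure φ f lam x := by
  have hJ := M.measurable_jumpMap_right x
  refine Measure.ext fun B hB => ?_
  rw [Measure.map_apply hJ hB, transMeasure, withDensity_apply _ (hJ hB), withDensity_apply _ hB,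
    ← lintegral_indicator (hJ hB), ← lintegral_indicator hB, ← (M.bijOn_jinv hx).image_eq,
    lintegral_image_eq_lintegral_abs_deriv_mul measurableSet_Ici
      (fun y hy => M.hasDerivWithinAt_jinv hx hy) (M.bijOn_jinv hx).injOn]
  rw [← setLIntegral_eq_of_support_subset (s := Ici (f x))
    (f := B.indicator fun a => ENNReal.ofReal (transDensity φ f lam x a))]
  -- Positivity of `g` may fail at an endpoint f x = 0, which is a null set.
  · rw [← restrict_Ioi_eq_restrict_Ici]
    refine setLIntegral_congr_fun measurableSet_Ioi fun y hy => ?_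
    have hy' : f x ≤ y := le_of_lt hy
    have hy0 : 0 < y := (M.f_nonneg (M.E_nonneg hx)).trans_lt hy
    have hj := M.jinv_nonneg hx hy'
    have hg : 0 < g φ f x y := (M.bounds.mlo_pos y hy0).trans_le (M.bounds.g_bounds x hx y hy0 hy').1
    have hmem : jinv φ f x y ∈ (fun t => jumpMap E φ f (x, t)) ⁻¹' B ↔ y ∈ B := by
      rw [mem_preimage, jumpMap, retr_of_mem hx, max_eq_left hj, M.f_flow_jinv hx hy']
    by_cases hyB : y ∈ B
    · rw [indicator_of_mem (hmem.2 hyB), indicator_of_mem hyB, max_eq_left hj,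
        M.flow_jinv hx hy', M.cumRate_jinv hlam hx hy', transDensity_of_le hy', hazard_of_le hy',
        abs_of_pos hg, ← ENNReal.ofReal_mul hg.le]
      congr 1; ring
    · rw [indicator_of_notMem (fun h => hyB (hmem.1 h)), indicator_of_notMem hyB, mul_zero]
  · intro y hy
    by_contra h
    refine hy ?_
    by_cases hyB : y ∈ B
    · rw [indicator_of_mem hyB, transDensity_of_lt (not_le.1 h), ENNReal.ofReal_zero]
    · rw [indicator_of_notMem hyB]

lemma timeKernel_apply (x : ℝ) : timeKernel E φ lam x =
    (volume.restrict (Ici 0)).withDensity fun t => ENNReal.ofReal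
      (lam (φ (retr E x) (max t 0)) * Real.exp (-cumRate φ lam (retr E x) (max t 0))) := by
  rw [timeKernel, Kernel.withDensity_apply _ (M.measurable_timeDensity hlam), Kernel.const_apply]

lemma map_timeKernel (x : ℝ) :
    (timeKernel E φ lam x).map (fun t => jumpMap E φ f (x, t)) =
      transMeasure φ f lam (retr E x) := by
  rw [M.timeKernel_apply hlam, ← M.map_timeDensity hlam (M.retr_mem x)]
  simp only [jumpMap, retr_of_mem (M.retr_mem x)]

lemma isMarkovKernel_timeKernel : IsMarkovKernel (timeKernel E φ lam) := by
  refine ⟨fun x => ⟨?_⟩⟩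
  have h1 := (M.isProbabilityMeasure_transMeasure hlam (M.retr_mem x)).measure_univ
  rwa [← M.map_timeKernel hlam x, Measure.map_apply
    (M.measurable_jumpMap_right x) MeasurableSet.univ, preimage_univ] at h1

/-- Later jumps land higher, so the tail of the waiting time is the tail of the post-jump law beyond
f(φ(x,t)). -/
lemma timeKernel_Ioi {x t : ℝ} (hx : x ∈ E) (ht : 0 ≤ t) :
    timeKernel E φ lam x (Ioi t) = ENNReal.ofReal (Real.exp (-cumRate φ lam x t)) := by
  have hft : f x ≤ f (φ x t) := M.f_mono (M.E_nonneg hx) (M.le_flow hx ht)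
  have h1 := M.transMeasure_Ioi hlam hx hft
  rw [← M.cumRate_jinv hlam hx hft, M.jinv_f_flow hx ht] at h1
  rw [← h1]
  conv_rhs => rw [← retr_of_mem hx]
  rw [← M.map_timeKernel hlam x, Measure.map_apply
    (M.measurable_jumpMap_right x) measurableSet_Ioi]
  have h0 : timeKernel E φ lam x (Iio 0) = 0 := by
    rw [M.timeKernel_apply hlam]
    exact withDensity_absolutelyContinuous _ _ (by
      rw [Measure.restrict_apply measurableSet_Iio, inter_comm, Ici_inter_Iio, Ico_self,
        measure_empty])
  refine measure_congr (eventuallyEq_set.2 ?_)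
  have h0' : ∀ᵐ s ∂(timeKernel E φ lam x), 0 ≤ s := by
    rw [ae_iff]; simpa [not_le, Iio] using h0
  filter_upwards [h0'] with s hs
  have hs' : 0 ≤ s := hs
  rw [mem_Ioi, mem_preimage, mem_Ioi, retr_of_mem hx, jumpMap, retr_of_mem hx, max_eq_left hs']
  have hfs : f x ≤ f (φ x s) := M.f_mono (M.E_nonneg hx) (M.le_flow hx hs')
  rw [← (M.strictMonoOn_jinv hx).lt_iff_lt hft hfs, M.jinv_f_flow hx ht, M.jinv_f_flow hx hs']

lemma jumpKernel_apply (x : ℝ) :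
    jumpKernel E φ f lam x = transMeasure φ f lam (retr E x) := by
  have := M.isMarkovKernel_timeKernel hlam
  rw [jumpKernel, Kernel.map_apply _ M.measurable_jumpMap, Kernel.prod_apply, Kernel.id_apply,
    Measure.dirac_prod, Measure.map_map M.measurable_jumpMap measurable_prodMk_left,
    ← M.map_timeKernel hlam x]
  rfl

lemma isMarkovKernel_jumpKernel : IsMarkovKernel (jumpKernel E φ f lam) := by
  refine ⟨fun x => ?_⟩
  rw [M.jumpKernel_apply hlam]
  exact M.isProbabilityMeasure_transMeasure hlam (M.retr_mem x)

end Model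

/-! ### Minorization on level sets of the weight, uniformly over the class. -/

/-- The weight `V`, extended to the line through the retraction onto the state space. -/
def weight (E : Set ℝ) (f : ℝ → ℝ) (a b x : ℝ) : ℝ := V f a b (retr E x)

/-- The function `Mup (u) * lam (f⁻¹ u)`, extended by a constant to the left of `f r`. -/
def rateUpper (f Mup lam : ℝ → ℝ) (r u : ℝ) : ℝ :=
  Mup (max (f r) u) * lam (finv f (max (f r) u))

/-- The minorizing density, up to a constant. -/
def minorDensity (f Mup lam : ℝ → ℝ) (r y : ℝ) : ℝ :=
  rateUpper f Mup lam r y * Real.exp (-∫ u in f r..y, rateUpper f Mup lam r u)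

/-- The minorizing measure. -/
def minorMeasure (f Mup lam : ℝ → ℝ) (r c : ℝ) : Measure ℝ :=
  (volume.restrict (Icc (f r) r)).withDensity fun y =>
    ENNReal.ofReal (c * minorDensity f Mup lam r y)

namespace Model

variable {E : Set ℝ} {φ : ℝ → ℝ → ℝ} {f mlo Mup lam : ℝ → ℝ} {κ r L a b : ℝ}
  (M : Model E φ f mlo Mup κ r a b)

include M

lemma measurable_weight : Measurable (weight E f a b) := by
  have h1 : Measurable fun x => f (retr E x) :=
    measurable_comp_of_continuousOn M.f_continuousOn M.measurable_retr
      fun x => M.E_nonneg (M.retr_mem x)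
  exact Real.measurable_exp.comp ((h1.pow_const (b + 1)).const_mul (a / (b + 1)))

lemma one_le_weight (x : ℝ) : 1 ≤ weight E f a b x := M.one_le_V (M.E_nonneg (M.retr_mem x))

lemma hasDrift_of_bound {C : ℝ} (hC : 0 ≤ C) (hbd : ∀ x, 0 ≤ x →
    (1 + 1 / (1 - κ ^ (b + 1))) * driftBound κ a b (f (max r x)) ≤ V f a b x / 2 + C)
    (hlam : lam ∈ rateClass f mlo Mup r L a b) :
    HasDrift (jumpKernel E φ f lam) (weight E f a b) C where
  measurable := M.measurable_weight
  one_le := M.one_le_weight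
  nonneg := hC
  drift x := by
    have hx := M.retr_mem x
    rw [M.jumpKernel_apply hlam]
    have hE : ∀ᵐ y ∂(transMeasure φ f lam (retr E x)), y ∈ E := by
      rw [ae_iff]; exact M.transMeasure_compl hx
    rw [lintegral_congr_ae (g := fun y => ENNReal.ofReal (V f a b y))]
    · exact (M.lintegral_V_le hlam hx).trans (ENNReal.ofReal_le_ofReal (hbd _ (M.E_nonneg hx)))
    · filter_upwards [hE] with y hy
      rw [weight, retr_of_mem hy]

lemma f_r_lt : f r < r :=
  (M.f_le M.r_pos.le).trans_lt (by nlinarith [M.r_pos, M.bounds.κ_lt_one])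

variable (hlam : lam ∈ rateClass f mlo Mup r L a b)
include hlam

lemma continuous_rateUpper : Continuous (rateUpper f Mup lam r) := by
  have hc : Continuous fun u : ℝ => max (f r) u := continuous_const.max continuous_id
  have h0 := M.f_pos M.r_pos
  have h1 : ContinuousOn (fun u => lam (finv f u)) (Ici 0) :=
    hlam.1.comp M.finv_continuousOn fun u hu => M.finv_nonneg hu
  exact (M.bounds.Mup_cont.comp_continuous hc fun u => h0.trans_le (le_max_left _ _)).mul
    (h1.comp_continuous hc fun u => mem_Ici.2 (h0.le.trans (le_max_left _ _)))

lemma rateUpper_ge {u : ℝ} (hu : f r ≤ u) : a * f r ^ b ≤ rateUpper f Mup lam r u := by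
  have h0 := M.f_pos M.r_pos
  have hu0 : 0 < u := h0.trans_le hu
  rw [rateUpper, max_eq_right hu]
  have h2 := hlam.2.2.1 (finv f u) (M.le_finv M.r_pos.le hu)
  rw [M.f_finv hu0.le, div_le_div_iff₀ (M.bounds.mlo_pos u hu0) M.a_pos] at h2
  have h4 := hlam.2.1 _ (M.finv_nonneg hu0.le)
  have h5 := mul_le_mul_of_nonneg_right (M.bounds.mlo_le_Mup u hu0) h4
  have h6 := mul_le_mul_of_nonneg_left (Real.rpow_le_rpow h0.le hu M.b_pos.le) M.a_pos.le
  linarith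

lemma rateUpper_pos {u : ℝ} (hu : f r ≤ u) : 0 < rateUpper f Mup lam r u :=
  (mul_pos M.a_pos (Real.rpow_pos_of_pos (M.f_pos M.r_pos) b)).trans_le (M.rateUpper_ge hlam hu)

lemma hasDerivAt_integral_rateUpper (y : ℝ) :
    HasDerivAt (fun y => ∫ u in f r..y, rateUpper f Mup lam r u) (rateUpper f Mup lam r y) y :=
  intervalIntegral.integral_hasDerivAt_right
    ((M.continuous_rateUpper hlam).intervalIntegrable _ _)
    (M.continuous_rateUpper hlam).stronglyMeasurable.stronglyMeasurableAtFilter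
    (M.continuous_rateUpper hlam).continuousAt

lemma continuous_minorDensity : Continuous (minorDensity f Mup lam r) := by
  have h1 : Continuous fun y => ∫ u in f r..y, rateUpper f Mup lam r u :=
    continuous_iff_continuousAt.2 fun y => (M.hasDerivAt_integral_rateUpper hlam y).continuousAt
  exact (M.continuous_rateUpper hlam).mul (Real.continuous_exp.comp h1.neg)

lemma integral_rateUpper_ge :
    a * f r ^ b * (r - f r) ≤ ∫ u in f r..r, rateUpper f Mup lam r u := by
  have h1 := intervalIntegral.integral_mono_on M.f_r_lt.le
    (intervalIntegrable_const (c := a * f r ^ b))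
    ((M.continuous_rateUpper hlam).intervalIntegrable (μ := volume) _ _)
    fun u hu => M.rateUpper_ge hlam hu.1
  rw [intervalIntegral.integral_const, smul_eq_mul] at h1
  linarith

/-- The minorizing density is the derivative of -exp(-∫ `rateUpper`), and `rateUpper` is at least a
f(r)^b. The resulting lower bound on the mass is free of λ, although the density is not. -/
lemma integral_minorDensity_ge : 1 - Real.exp (-(a * f r ^ b * (r - f r))) ≤
    ∫ y in f r..r, minorDensity f Mup lam r y := by
  have hd : ∀ y, HasDerivAt (fun y => -Real.exp (-∫ u in f r..y, rateUpper f Mup lam r u))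
      (minorDensity f Mup lam r y) y := fun y => by
    refine (M.hasDerivAt_integral_rateUpper hlam y).neg.exp.neg.congr_deriv ?_
    simp only [minorDensity, Pi.neg_apply]
    ring
  rw [intervalIntegral.integral_eq_sub_of_hasDerivAt (fun y _ => hd y)
    ((M.continuous_minorDensity hlam).intervalIntegrable _ _)]
  have h1 := Real.exp_le_exp.2 (neg_le_neg (M.integral_rateUpper_ge hlam))
  simp only [intervalIntegral.integral_same, neg_zero, Real.exp_zero]
  linarith

lemma minorMeasure_univ {c : ℝ} (hc : 0 ≤ c) : minorMeasure f Mup lam r c univ =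
    ENNReal.ofReal (c * ∫ y in f r..r, minorDensity f Mup lam r y) := by
  have hcont := (M.continuous_minorDensity hlam).const_mul c
  rw [minorMeasure, withDensity_apply _ MeasurableSet.univ, Measure.restrict_univ,
    ← ofReal_integral_eq_lintegral_ofReal hcont.integrableOn_Icc,
    intervalIntegral.integral_of_le M.f_r_lt.le, integral_Icc_eq_integral_Ioc,
    integral_const_mul]
  filter_upwards [ae_restrict_mem measurableSet_Icc] with y hy
  exact mul_nonneg hc (mul_nonneg (M.rateUpper_pos hlam hy.1).le (Real.exp_pos _).le)

/-- Up to f r the hazard is paid for by the integral condition L of the class; after f r it is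
bounded by `rateUpper`, which does not involve x. -/
lemma cumHazard_le {x y : ℝ} (hx : x ∈ E) (hxr : x ≤ r) (hy : f r ≤ y) :
    cumHazard φ f lam x y ≤ L + ∫ u in f r..y, rateUpper f Mup lam r u := by
  have hx0 := M.E_nonneg hx
  have hfx := M.f_nonneg hx0
  have hfxr := M.f_mono hx0 hxr
  have hcont := M.continuous_hazard hlam.1 hx
  have hle : ∀ u, 0 < u → f x ≤ u → hazard φ f lam x u ≤ Mup u * lam (finv f u) := by
    intro u hu0 hu
    rw [hazard_of_le hu, mul_comm]
    exact mul_le_mul_of_nonneg_right (M.bounds.g_bounds x hx u hu0 hu).2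
      (hlam.2.1 _ (M.finv_nonneg hu0.le))
  rw [cumHazard, ← intervalIntegral.integral_add_adjacent_intervals
    (hcont.intervalIntegrable (f x) (f r)) (hcont.intervalIntegrable (f r) y)]
  refine add_le_add ?_ ?_
  · rw [intervalIntegral.integral_of_le hfxr]
    have hsub : Ioc (f x) (f r) ⊆ Ioc 0 (f r) := Ioc_subset_Ioc_left hfx
    calc _ ≤ ∫ u in Ioc (f x) (f r), Mup u * lam (finv f u) :=
          setIntegral_mono_on hcont.integrableOn_Ioc (hlam.2.2.2.1.mono_set hsub)
            measurableSet_Ioc fun u hu => hle u (hfx.trans_lt hu.1) hu.1.le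
      _ ≤ ∫ u in Ioc 0 (f r), Mup u * lam (finv f u) := by
          refine setIntegral_mono_set hlam.2.2.2.1 ?_ hsub.eventuallyLE
          filter_upwards [ae_restrict_mem measurableSet_Ioc] with u hu
          exact mul_nonneg ((M.bounds.mlo_pos u hu.1).le.trans (M.bounds.mlo_le_Mup u hu.1))
            (hlam.2.1 _ (M.finv_nonneg hu.1.le))
      _ ≤ L := hlam.2.2.2.2
  · refine intervalIntegral.integral_mono_on hy (hcont.intervalIntegrable _ _)
      ((M.continuous_rateUpper hlam).intervalIntegrable _ _) fun u hu => ?_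
    rw [rateUpper, max_eq_right hu.1]
    exact hle u ((M.f_pos M.r_pos).trans_le hu.1) (hfxr.trans hu.1)

/-- On [f r, r] the hazard is at least c₁ times `rateUpper`, and the survival factor is at least
e^(-L) exp(-∫ `rateUpper`); neither bound involves x. -/
lemma minorMeasure_le {c₁ : ℝ} (hc : ∀ y ∈ Icc (f r) r, c₁ * Mup y ≤ mlo y) {x : ℝ}
    (hx : x ∈ E) (hxr : x ≤ r) :
    minorMeasure f Mup lam r (c₁ * Real.exp (-L)) ≤ transMeasure φ f lam x := by
  rw [minorMeasure, ← withDensity_indicator measurableSet_Icc, transMeasure]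
  refine withDensity_mono (ae_of_all _ fun y => ?_)
  by_cases hy : y ∈ Icc (f r) r
  · rw [indicator_of_mem hy]
    refine ENNReal.ofReal_le_ofReal ?_
    have hy0 : 0 < y := (M.f_pos M.r_pos).trans_le hy.1
    have hfx : f x ≤ y := (M.f_mono (M.E_nonneg hx) hxr).trans hy.1
    have hl := hlam.2.1 _ (M.finv_nonneg hy0.le)
    rw [transDensity_of_le hfx, minorDensity, hazard_of_le hfx, rateUpper, max_eq_right hy.1]
    have h1 : c₁ * (Mup y * lam (finv f y)) ≤ lam (finv f y) * g φ f x y := by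
      have := (hc y hy).trans (M.bounds.g_bounds x hx y hy0 hfx).1
      nlinarith
    have h2 : Real.exp (-L) * Real.exp (-∫ u in f r..y, rateUpper f Mup lam r u) ≤
        Real.exp (-cumHazard φ f lam x y) := by
      rw [← Real.exp_add, Real.exp_le_exp]
      linarith [M.cumHazard_le hlam hx hxr hy.1]
    have h3 : 0 ≤ lam (finv f y) * g φ f x y :=
      mul_nonneg hl ((M.bounds.mlo_pos y hy0).le.trans (M.bounds.g_bounds x hx y hy0 hfx).1)
    calc _ = c₁ * (Mup y * lam (finv f y)) *
          (Real.exp (-L) * Real.exp (-∫ u in f r..y, rateUpper f Mup lam r u)) := by ring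
      _ ≤ _ := mul_le_mul h1 h2 (by positivity) h3
  · rw [indicator_of_notMem hy]; exact zero_le

/-- The hazard accumulated on [κx, qx] is at least a (κx)^b (q - κ)x, which is smallest at x = r. So
large states shrink by the factor q with probability bounded below. -/
lemma transMeasure_Iic_ge {q x : ℝ} (hq : κ ≤ q) (hx : x ∈ E) (hxr : r ≤ x) :
    1 - Real.exp (-(a * (κ * r) ^ b * ((q - κ) * r))) ≤
      (transMeasure φ f lam x).real (Iic (q * x)) := by
  have := M.isProbabilityMeasure_transMeasure hlam hx
  have hκ := M.bounds.κ_pos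
  have hr := M.r_pos
  have hx0 : 0 < x := hr.trans_le hxr
  have hfx : f x ≤ κ * x := M.f_le hx0.le
  have hqx : κ * x ≤ q * x := mul_le_mul_of_nonneg_right hq hx0.le
  have h1 := M.cumHazard_sub_ge hlam hx (by rwa [max_eq_right hxr]) hqx
  have h2 := M.cumHazard_mono hlam.1 hlam.2.1 hx hfx
  rw [cumHazard_self] at h2
  have h3 : a * (κ * r) ^ b * ((q - κ) * r) ≤ a * (κ * x) ^ b * (q * x - κ * x) := by
    rw [← sub_mul]
    have := M.a_pos
    have := M.b_pos
    have : 0 ≤ q - κ := by linarith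
    gcongr
  rw [← compl_Ioi, probReal_compl_eq_one_sub measurableSet_Ioi, Measure.real,
    M.transMeasure_Ioi hlam hx (hfx.trans hqx), ENNReal.toReal_ofReal (Real.exp_pos _).le]
  have := Real.exp_le_exp.2 (neg_le_neg (h3.trans (h1.trans (sub_le_self _ h2))))
  linarith

omit hlam in
/-- Uniform minorization of an iterate on bounded sets. -/
theorem exists_isMinorized (L ρ : ℝ) : ∃ (N : ℕ) (ε : ℝ), 0 < N ∧ 0 < ε ∧
    ∀ lam ∈ rateClass f mlo Mup r L a b, ∀ C, HasDrift (jumpKernel E φ f lam) (weight E f a b) C →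
      IsMinorized (jumpKernel E φ f lam) (weight E f a b) N ρ ε := by
  have hr := M.r_pos
  have ha := M.a_pos
  have hb := M.b_pos
  have hκ0 := M.bounds.κ_pos
  have hκ1 := M.bounds.κ_lt_one
  have hfr := M.f_pos hr
  have hfrr := M.f_r_lt
  -- the ratio of the bounds on the compact `[f r, r]`
  obtain ⟨c₁, hc₁, hc⟩ : ∃ c₁ > 0, ∀ y ∈ Icc (f r) r, c₁ * Mup y ≤ mlo y := by
    have hsub : Icc (f r) r ⊆ Ioi 0 := fun y hy => hfr.trans_le hy.1
    have hMp : ∀ y ∈ Icc (f r) r, 0 < Mup y := fun y hy =>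
      (M.bounds.mlo_pos y (hsub hy)).trans_le (M.bounds.mlo_le_Mup y (hsub hy))
    obtain ⟨y₀, hy₀, hmin⟩ := isCompact_Icc.exists_isMinOn (nonempty_Icc.2 hfrr.le)
      (f := fun y => mlo y / Mup y) ((M.bounds.mlo_cont.mono hsub).div
        (M.bounds.Mup_cont.mono hsub) fun y hy => (hMp y hy).ne')
    refine ⟨mlo y₀ / Mup y₀, div_pos (M.bounds.mlo_pos _ (hsub hy₀)) (hMp _ hy₀), fun y hy => ?_⟩
    exact (le_div_iff₀ (hMp y hy)).1 (hmin hy)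
  set c := c₁ * Real.exp (-L) with hcdef
  have hc0 : 0 < c := by positivity
  set ε₀ := c * (1 - Real.exp (-(a * f r ^ b * (r - f r)))) with hε₀
  have hε₀0 : 0 < ε₀ := by
    have : 0 < a * f r ^ b * (r - f r) := by
      have : 0 < r - f r := by linarith
      positivity
    have := Real.exp_lt_one_iff.2 (neg_lt_zero.2 this)
    exact mul_pos hc0 (by linarith)
  -- Strictly between κ and 1: q > κ leaves room to accumulate hazard, and q < 1 makes the descent
  -- geometric.
  set q := (1 + κ) / 2 with hq
  have hq0 : 0 < q := by rw [hq]; linarith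
  have hq1 : q < 1 := by rw [hq]; linarith
  have hqκ : κ < q := by rw [hq]; linarith
  set p₀ := 1 - Real.exp (-(a * (κ * r) ^ b * ((q - κ) * r))) with hp₀
  have hp₀0 : 0 < p₀ := by
    have : 0 < a * (κ * r) ^ b * ((q - κ) * r) := by
      have : 0 < q - κ := by linarith
      positivity
    have := Real.exp_lt_one_iff.2 (neg_lt_zero.2 this)
    rw [hp₀]; linarith
  set p := min ε₀ p₀
  have hp0 : 0 < p := lt_min hε₀0 hp₀0
  -- a bound for the level set of the weight
  obtain ⟨ρ', hρ'⟩ : ∃ ρ' : ℝ, ∀ x ∈ E, V f a b x ≤ ρ → x ≤ ρ' := by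
    set y : ℝ := max 0 (Real.log (max ρ 1) * ((b + 1) / a)) ^ (1 / (b + 1))
    have hy : 0 ≤ y := Real.rpow_nonneg (le_max_left _ _) _
    refine ⟨finv f y, fun x hx hV => M.le_finv (M.E_nonneg hx) ?_⟩
    have hfx := M.f_nonneg (M.E_nonneg hx)
    have h1 := Real.log_le_log (Real.exp_pos _) (hV.trans (le_max_left ρ 1))
    rw [Real.log_exp] at h1
    have h2 : f x ^ (b + 1) ≤ Real.log (max ρ 1) * ((b + 1) / a) := by
      rw [div_mul_eq_mul_div, div_le_iff₀ (by positivity)] at h1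
      rw [← mul_div_assoc, le_div_iff₀ ha]
      linarith
    have h3 := Real.rpow_le_rpow (by positivity) (h2.trans (le_max_right 0 _))
      (by positivity : 0 ≤ 1 / (b + 1))
    rwa [← Real.rpow_mul hfx, mul_one_div_cancel (by positivity), Real.rpow_one] at h3
  -- From the level set, n successful descents lead below r; one further step minorizes, hence n + 1
  -- steps.
  obtain ⟨n, hn⟩ : ∃ n : ℕ, ρ' ≤ r / q ^ n := by
    obtain ⟨n, hn⟩ := exists_pow_lt_of_lt_one
      (by positivity : 0 < r / max ρ' 1) hq1
    refine ⟨n, ?_⟩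
    rw [lt_div_iff₀ (by positivity)] at hn
    rw [le_div_iff₀ (by positivity)]
    nlinarith [le_max_left ρ' 1, pow_pos hq0 n]
  refine ⟨n + 1, p ^ n * ε₀, n.succ_pos, by positivity, fun lam hlam C hd => ?_⟩
  have hMk := M.isMarkovKernel_jumpKernel hlam
  set m := minorMeasure f Mup lam r c
  have hmass : ε₀ ≤ m.real univ := by
    have h1 := M.integral_minorDensity_ge hlam
    have h2 := mul_le_mul_of_nonneg_left h1 hc0.le
    rw [Measure.real, M.minorMeasure_univ hlam hc0.le,
      ENNReal.toReal_ofReal (hε₀0.le.trans h2)]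
    exact h2
  have hmfin : IsFiniteMeasure m := ⟨by
    rw [M.minorMeasure_univ hlam hc0.le]; exact ENNReal.ofReal_lt_top⟩
  have hmle : ∀ x, retr E x ≤ r → m ≤ jumpKernel E φ f lam x := fun x hx => by
    rw [M.jumpKernel_apply hlam]
    exact M.minorMeasure_le hlam hc (M.retr_mem x) hx
  have hmV : Integrable (weight E f a b) m :=
    (hd.integrable_self r).mono_measure (hmle r (retr_of_mem (M.mem_E_of_pos hr)).le)
  -- Below r the minorizing measure itself sits on [f r, r], so the chain stays below r with
  -- probability at least ε₀; above r the geometric descent applies.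
  have hreach : ∀ x, p ≤ (jumpKernel E φ f lam x).real (Iic (max r (q * retr E x))) := by
    intro x
    have hx := M.retr_mem x
    rcases le_total (retr E x) r with h | h
    · refine (min_le_left _ _).trans (hmass.trans ?_)
      have h1 : m.real univ ≤ m.real (Iic r) := by
        rw [← measureReal_add_measureReal_compl (measurableSet_Iic (a := r)), compl_Iic]
        have : m (Ioi r) = 0 := by
          refine withDensity_absolutelyContinuous _ _ ?_
          rw [Measure.restrict_apply measurableSet_Ioi]
          convert measure_empty (μ := volume)
          ext y
          simp only [mem_inter_iff, mem_Ioi, mem_Icc, mem_empty_iff_false, iff_false]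
          rintro ⟨h1, -, h2⟩
          exact absurd h1 (not_lt.2 h2)
        simp [Measure.real, this]
      refine h1.trans ?_
      refine (measureReal_mono (Iic_subset_Iic.2 (le_max_left r (q * retr E x)))).trans ?_
      exact ENNReal.toReal_mono (measure_ne_top _ _) (hmle x h _)
    · refine (min_le_right _ _).trans ((M.transMeasure_Iic_ge hlam hqκ.le hx h).trans ?_)
      rw [← M.jumpKernel_apply hlam]
      exact measureReal_mono (Iic_subset_Iic.2 (le_max_right _ _))
  -- Induction on the number of descents: with probability at least p one step takes {x ≤ r/q^(k+1)}
  -- into {x ≤ r/q^k}, and the nonnegative contribution of the other paths is discarded.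
  have hiter : ∀ h, Dominated (weight E f a b) h → (∀ x, 0 ≤ h x) → ∀ (k : ℕ) (x : ℝ),
      retr E x ≤ r / q ^ k →
      p ^ k * ∫ y, h y ∂m ≤ (markovOp (jumpKernel E φ f lam))^[k + 1] h x := by
    intro h hdom h0 k
    induction k with
    | zero =>
      intro x hx
      rw [pow_zero, one_mul]
      exact integral_mono_measure (hmle x (by simpa using hx)) (ae_of_all _ h0)
        (hd.integrable hdom x)
    | succ k ih =>
      intro x hx
      rw [Function.iterate_succ_apply']
      have hdk := hd.dominated_iter hdom (k + 1)
      have hint := hd.integrable hdk x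
      have hk0 : ∀ y, 0 ≤ (markovOp (jumpKernel E φ f lam))^[k + 1] h y := fun y => by
        have := hd.iter_mono (Dominated.const hd.one_le 0) hdom h0 (k + 1) y
        have h1 := iter_const_mul (P := jumpKernel E φ f lam) (h := fun _ => 0) 0 (k + 1) y
        simp only [zero_mul] at h1
        linarith
      set S := {y | retr E y ≤ r / q ^ k}
      have hS : MeasurableSet S := measurableSet_le M.measurable_retr measurable_const
      have hpS : p ≤ (jumpKernel E φ f lam x).real S := by
        refine (hreach x).trans ?_
        refine ENNReal.toReal_mono (measure_ne_top _ _) (measure_mono_ae ?_)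
        have hE : ∀ᵐ y ∂(jumpKernel E φ f lam x), y ∈ E := by
          rw [ae_iff, M.jumpKernel_apply hlam]; exact M.transMeasure_compl (M.retr_mem x)
        filter_upwards [hE] with y hyE hy
        have hy' : y ≤ max r (q * retr E x) := hy
        change retr E y ≤ r / q ^ k
        rw [retr_of_mem hyE]
        refine hy'.trans (max_le ?_ ?_)
        · exact le_div_self hr.le (by positivity) (pow_le_one₀ hq0.le hq1.le)
        · calc q * retr E x ≤ q * (r / q ^ (k + 1)) := mul_le_mul_of_nonneg_left hx hq0.le
            _ = r / q ^ k := by rw [pow_succ]; field_simp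
      have hI : 0 ≤ ∫ y, h y ∂m := integral_nonneg h0
      calc p ^ (k + 1) * ∫ y, h y ∂m
          ≤ (jumpKernel E φ f lam x).real S * (p ^ k * ∫ y, h y ∂m) := by
            rw [pow_succ, mul_comm (p ^ k) p, mul_assoc]
            exact mul_le_mul_of_nonneg_right hpS (by positivity)
        _ = ∫ _ in S, (p ^ k * ∫ y, h y ∂m) ∂(jumpKernel E φ f lam x) := by
            rw [setIntegral_const, smul_eq_mul]
        _ ≤ ∫ y in S, (markovOp (jumpKernel E φ f lam))^[k + 1] h y ∂(jumpKernel E φ f lam x) :=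
            setIntegral_mono_on (integrable_const _).integrableOn hint.integrableOn hS
              fun y hy => ih y hy
        _ ≤ _ := setIntegral_le_integral hint (ae_of_all _ hk0)
  refine ⟨ENNReal.ofReal (p ^ n) • m, ?_, ?_, ?_, fun h hdom h0 x hx => ?_⟩
  · exact m.smul_finite ENNReal.ofReal_ne_top
  · exact hmV.smul_measure ENNReal.ofReal_ne_top
  · rw [measureReal_ennreal_smul_apply, ENNReal.toReal_ofReal (by positivity)]
    exact mul_le_mul_of_nonneg_left hmass (by positivity)
  · rw [integral_smul_measure, ENNReal.toReal_ofReal (by positivity), smul_eq_mul]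
    exact hiter h hdom h0 n x ((hρ' _ (M.retr_mem x) hx).trans hn)

end Model

/-! ### Uniform ergodicity and its translation to the state space. -/

/-- `ν` is an invariant density of the chain, with geometric ergodicity in the weighted norm. -/
structure IsErgodicDensity (E : Set ℝ) (φ : ℝ → ℝ → ℝ) (f lam ν : ℝ → ℝ) (a b R γ K : ℝ) :
    Prop where
  measurable : Measurable ν
  nonneg : ∀ x, 0 ≤ ν x
  prob : IsProbabilityMeasure (densityMeasure ν)
  bind_eq : (densityMeasure ν).bind (jumpKernel E φ f lam) = densityMeasure ν
  integrable : Integrable (weight E f a b) (densityMeasure ν)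
  integral_le : ∫ x, weight E f a b x ∂(densityMeasure ν) ≤ K
  contraction : ∀ h : ℝ → ℝ, Measurable h → ∀ c : ℝ, (∀ x, |h x| ≤ c * weight E f a b x) →
    ∀ k x, |(markovOp (jumpKernel E φ f lam))^[k] h x - ∫ y, h y ∂(densityMeasure ν)| ≤
      c * R * weight E f a b x * γ ^ k
  unique : ∀ μ : Measure ℝ, IsProbabilityMeasure μ → μ.bind (jumpKernel E φ f lam) = μ →
    μ = densityMeasure ν

lemma integral_densityMeasure {ν : ℝ → ℝ} (hν : Measurable ν) (h0 : ∀ x, 0 ≤ ν x) (h : ℝ → ℝ) :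
    ∫ x, h x ∂(densityMeasure ν) = ∫ x in Ici 0, h x * ν x := by
  rw [densityMeasure, integral_withDensity_eq_integral_toReal_smul hν.ennreal_ofReal (by simp)]
  refine integral_congr_ae (ae_of_all _ fun x => ?_)
  simp only [smul_eq_mul]
  rw [ENNReal.toReal_ofReal (h0 x), mul_comm]

lemma integrable_densityMeasure_iff {ν : ℝ → ℝ} (hν : Measurable ν) (h0 : ∀ x, 0 ≤ ν x)
    {h : ℝ → ℝ} : Integrable h (densityMeasure ν) ↔ IntegrableOn (fun x => h x * ν x) (Ici 0) := by
  rw [densityMeasure, integrable_withDensity_iff hν.ennreal_ofReal (by simp), IntegrableOn]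
  simp only [ENNReal.toReal_ofReal (h0 _)]

namespace Model

variable {E : Set ℝ} {φ : ℝ → ℝ → ℝ} {f mlo Mup lam ν : ℝ → ℝ} {κ r L a b R γ K : ℝ}
  (M : Model E φ f mlo Mup κ r a b)

include M

lemma jumpKernel_absolutelyContinuous (hlam : lam ∈ rateClass f mlo Mup r L a b) (x : ℝ) :
    jumpKernel E φ f lam x ≪ volume.restrict (Ici 0) := by
  rw [M.jumpKernel_apply hlam]
  refine Measure.AbsolutelyContinuous.mk fun s hs h0 => ?_
  rw [Measure.restrict_apply hs] at h0
  have h1 := transMeasure_absolutelyContinuous (φ := φ) (f := f) (lam := lam) (retr E x) h0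
  refine measure_mono_null (fun y hy => ?_)
    (measure_union_null h1 (M.transMeasure_compl (lam := lam) (M.retr_mem x)))
  by_cases hyE : y ∈ E
  · exact Or.inl ⟨hy, M.E_nonneg hyE⟩
  · exact Or.inr hyE

/-- Uniform geometric ergodicity over the class of jump rates. -/
theorem exists_isErgodicDensity (L : ℝ) : ∃ R γ K : ℝ, 0 < R ∧ 0 < γ ∧ γ < 1 ∧
    ∀ lam ∈ rateClass f mlo Mup r L a b,
      HasDrift (jumpKernel E φ f lam) (weight E f a b) K ∧
      ∃ ν, IsErgodicDensity E φ f lam ν a b R γ (2 * K) := by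
  obtain ⟨C, hC, hbd⟩ := M.exists_drift_const
  obtain ⟨N, ε, hN, hε, hmin⟩ := M.exists_isMinorized L (16 * C + 1)
  obtain ⟨R, γ, hR, hγ, hγ1, hharris⟩ := exists_geometric_contraction ℝ hC hε hN
  -- All constants are fixed before `lam` is introduced, which is the uniformity claimed. The factor
  -- 1 + 2C comes from averaging over the invariant law.
  refine ⟨R * (1 + 2 * C), γ, C, by positivity, hγ, hγ1, fun lam hlam => ?_⟩
  have hd := M.hasDrift_of_bound hC hbd hlam
  have := M.isMarkovKernel_jumpKernel hlam
  have hc : IsContracting (jumpKernel E φ f lam) (weight E f a b) R γ :=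
    hharris _ _ hd (hmin lam hlam C hd)
  obtain ⟨ν, hνm, hν0, hprob, hbind, hint, hle⟩ := hc.exists_invariant_density hd hR.le hγ.le hγ1
    (volume.restrict (Ici 0)) (M.jumpKernel_absolutelyContinuous hlam)
  exact ⟨hd, ν, hνm, hν0, hprob, hbind, hint, hle,
    fun h hm c hcV k x => hc.sub_integral_le hd hR.le hγ.le hint hle hbind hm hcV k x,
    fun μ hμ hμb => hc.eq_of_invariant hd hR.le hγ.le hγ1 hint hle hbind hμb⟩

variable (hlam : lam ∈ rateClass f mlo Mup r L a b)
include hlam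

lemma bind_jumpKernel_compl (μ : Measure ℝ) : μ.bind (jumpKernel E φ f lam) Eᶜ = 0 := by
  rw [Measure.bind_apply M.measurableSet_E.compl (Kernel.measurable _).aemeasurable]
  simp [M.jumpKernel_apply hlam, M.transMeasure_compl (M.retr_mem _)]

lemma bind_jumpKernel_apply {μ : Measure ℝ} (hμ : μ Eᶜ = 0) {B : Set ℝ} (hB : MeasurableSet B) :
    μ.bind (jumpKernel E φ f lam) B = ∫⁻ x, transMeasure φ f lam x B ∂μ := by
  rw [Measure.bind_apply hB (Kernel.measurable _).aemeasurable]
  refine lintegral_congr_ae ?_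
  have hE : ∀ᵐ x ∂μ, x ∈ E := by rw [ae_iff]; exact hμ
  filter_upwards [hE] with x hx
  rw [M.jumpKernel_apply hlam, retr_of_mem hx]

/-- Transitions from E stay in E almost surely, so along the iteration the retraction is invisible.
-/
lemma iterate_transOp_eq {h : ℝ → ℝ} (k : ℕ) {x : ℝ} (hx : x ∈ E) :
    (transOp φ f lam)^[k] h x =
      (markovOp (jumpKernel E φ f lam))^[k] (fun y => h (retr E y)) x := by
  induction k generalizing x with
  | zero => simp [retr_of_mem hx]
  | succ k ih =>
    simp only [Function.iterate_succ_apply']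
    rw [transOp, markovOp, M.jumpKernel_apply hlam, retr_of_mem hx]
    refine integral_congr_ae ?_
    have hE : ∀ᵐ y ∂(transMeasure φ f lam x), y ∈ E := by
      rw [ae_iff]; exact M.transMeasure_compl hx
    filter_upwards [hE] with y hy using ih hy

variable (hν : IsErgodicDensity E φ f lam ν a b R γ K)
include hν

lemma densityMeasure_compl : densityMeasure ν Eᶜ = 0 := by
  rw [← hν.bind_eq]; exact M.bind_jumpKernel_compl hlam _

lemma ae_mem_E : ∀ᵐ x ∂(densityMeasure ν), x ∈ E := by
  rw [ae_iff]; exact M.densityMeasure_compl hlam hν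

lemma isStationaryDensity : IsStationaryDensity E φ f lam ν where
  measurable := hν.measurable
  nonneg := hν.nonneg
  invariant :=
    { prob := hν.prob
      compl := M.densityMeasure_compl hlam hν
      invariant := fun B hB => by
        rw [← M.bind_jumpKernel_apply hlam (M.densityMeasure_compl hlam hν) hB, hν.bind_eq] }
  unique := fun μ hμ => hν.unique μ hμ.prob <| Measure.ext fun B hB => by
    rw [M.bind_jumpKernel_apply hlam hμ.compl hB, hμ.invariant B hB]

lemma contraction_of_isErgodicDensity : Contraction E φ f lam ν a b R γ := by
  intro h hm hhV k x hx
  have h1 := hν.contraction (fun y => h (retr E y)) (hm.comp M.measurable_retr) 1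
    (fun y => by rw [one_mul]; exact hhV _ (M.retr_mem y)) k x
  rw [M.iterate_transOp_eq hlam k hx, ← integral_densityMeasure hν.measurable hν.nonneg]
  rw [one_mul, weight, retr_of_mem hx] at h1
  refine le_trans (le_of_eq ?_) h1
  congr 2
  refine integral_congr_ae ?_
  filter_upwards [M.ae_mem_E hlam hν] with y hy
  rw [retr_of_mem hy]

lemma ae_V_eq : V f a b =ᵐ[densityMeasure ν] weight E f a b := by
  filter_upwards [M.ae_mem_E hlam hν] with y hy
  rw [weight, retr_of_mem hy]

lemma integrable_V : Integrable (V f a b) (densityMeasure ν) :=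
  hν.integrable.congr (M.ae_V_eq hlam hν).symm

lemma integral_V_eq :
    ∫ z in Ici 0, V f a b z * ν z = ∫ x, weight E f a b x ∂(densityMeasure ν) := by
  rw [← integral_densityMeasure hν.measurable hν.nonneg]
  exact integral_congr_ae (M.ae_V_eq hlam hν)

lemma integrableOn_V : IntegrableOn (fun z => V f a b z * ν z) (Ici 0) :=
  (integrable_densityMeasure_iff hν.measurable hν.nonneg).1 (M.integrable_V hlam hν)

/-- V(z) and the constant ∫ V ν contribute equally; the resulting factor 2 matches the cross terms
of the variance. -/
lemma integral_G_eq : ∫ z in Ici 0, G f ν a b R γ z * ν z =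
    2 * (R / (1 - γ)) * ∫ x, weight E f a b x ∂(densityMeasure ν) := by
  have := hν.prob
  rw [← integral_densityMeasure hν.measurable hν.nonneg]
  simp only [G]
  rw [integral_const_mul, integral_add (M.integrable_V hlam hν) (integrable_const _),
    M.integral_V_eq hlam hν, integral_congr_ae (M.ae_V_eq hlam hν)]
  simp only [integral_const, probReal_univ, smul_eq_mul]
  ring

end Model

/-! ### Markov chains tested at pairs of times. -/

/-- `Z` is a Markov chain with kernel `κ` started from `x₀`, in weak form. -/
structure IsMarkovChain {Ω : Type*} [MeasurableSpace Ω] (P : Measure Ω) (κ : Kernel ℝ ℝ) (x₀ : ℝ)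
    (Z : ℕ → Ω → ℝ) : Prop where
  measurable : ∀ k, Measurable (Z k)
  zero : ∀ᵐ ω ∂P, Z 0 ω = x₀
  -- Second moments involve only two times, so a test function of one earlier state is enough.
  step : ∀ i k, i ≤ k → ∀ H G : ℝ → ℝ, Measurable H → Measurable G →
    ∀ c d : ℝ, (∀ x, |H x| ≤ c) → (∀ x, |G x| ≤ d) →
    ∫ ω, H (Z i ω) * G (Z (k + 1) ω) ∂P = ∫ ω, H (Z i ω) * markovOp κ G (Z k ω) ∂P

section

variable {κ : Kernel ℝ ℝ} [IsMarkovKernel κ]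

lemma abs_markovOp_le {G : ℝ → ℝ} {d : ℝ} (hd : ∀ x, |G x| ≤ d) (x : ℝ) :
    |markovOp κ G x| ≤ d := by
  have h1 := norm_integral_le_of_norm_le_const (μ := κ x) (f := G) (C := d) (ae_of_all _ hd)
  simpa [markovOp] using h1

omit [IsMarkovKernel κ] in
lemma measurable_iter_markovOp {G : ℝ → ℝ} (hG : Measurable G) (k : ℕ) :
    Measurable ((markovOp κ)^[k] G) := by
  induction k with
  | zero => exact hG
  | succ k ih => rw [Function.iterate_succ_apply']; exact measurable_markovOp ih

lemma abs_iter_markovOp_le {G : ℝ → ℝ} {d : ℝ} (hd : ∀ x, |G x| ≤ d) (k : ℕ) (x : ℝ) :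
    |(markovOp κ)^[k] G x| ≤ d := by
  induction k generalizing x with
  | zero => exact hd x
  | succ k ih => rw [Function.iterate_succ_apply']; exact abs_markovOp_le ih x

namespace IsMarkovChain

variable {Ω : Type*} [MeasurableSpace Ω] {P : Measure Ω} [IsProbabilityMeasure P] {x₀ : ℝ}
  {Z : ℕ → Ω → ℝ} (hZ : IsMarkovChain P κ x₀ Z)
include hZ

omit [IsProbabilityMeasure P] in
lemma integral_mul (i j : ℕ) {H G : ℝ → ℝ} (hH : Measurable H) (hG : Measurable G)
    {c d : ℝ} (hc : ∀ x, |H x| ≤ c) (hd : ∀ x, |G x| ≤ d) :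
    ∫ ω, H (Z i ω) * G (Z (i + j) ω) ∂P = ∫ ω, H (Z i ω) * (markovOp κ)^[j] G (Z i ω) ∂P := by
  induction j generalizing G with
  | zero => rfl
  | succ j ih =>
    rw [← add_assoc, hZ.step i (i + j) (Nat.le_add_right _ _) H G hH hG c d hc hd,
      ih (measurable_markovOp hG) (abs_markovOp_le hd), Function.iterate_succ_apply]

lemma integral_eq (k : ℕ) {G : ℝ → ℝ} (hG : Measurable G) {d : ℝ} (hd : ∀ x, |G x| ≤ d) :
    ∫ ω, G (Z k ω) ∂P = (markovOp κ)^[k] G x₀ := by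
  have h1 := hZ.integral_mul 0 k (H := fun _ => 1) (c := 1) measurable_const hG
    (fun _ => by simp) hd
  simp only [one_mul, zero_add] at h1
  have h2 : ∫ ω, (markovOp κ)^[k] G (Z 0 ω) ∂P = ∫ _, (markovOp κ)^[k] G x₀ ∂P := by
    refine integral_congr_ae ?_
    filter_upwards [hZ.zero] with ω hω
    rw [hω]
  rw [h1, h2]
  simp

-- From time 1 on the states have absolutely continuous laws, so the choice of representatives of
-- the basis functions does not affect the estimator.
omit [IsMarkovKernel κ] in
lemma ae_notMem {N : Set ℝ} {m : Measure ℝ} (hκ : ∀ x, κ x ≪ m) (hN : m N = 0) (k : ℕ) :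
    ∀ᵐ ω ∂P, Z (k + 1) ω ∉ N := by
  set N' := toMeasurable m N
  have hm : MeasurableSet N' := measurableSet_toMeasurable _ _
  have h0 : m N' = 0 := by rw [measure_toMeasurable, hN]
  have hI : ∀ y, |N'.indicator (fun _ => (1 : ℝ)) y| ≤ 1 := fun y => by
    by_cases hy : y ∈ N' <;> simp [hy]
  have h1 := hZ.step 0 k (Nat.zero_le _) (fun _ => 1) (N'.indicator fun _ => (1 : ℝ))
    measurable_const (measurable_const.indicator hm) 1 1 (fun _ => by simp) hI
  have h2 : markovOp κ (N'.indicator fun _ => (1 : ℝ)) = fun _ => 0 := by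
    funext x
    rw [markovOp, integral_indicator hm]
    simp [Measure.real, hκ x h0]
  simp only [h2, one_mul, mul_zero, integral_zero] at h1
  have h3 : (fun ω => N'.indicator (fun _ => (1 : ℝ)) (Z (k + 1) ω)) =
      (Z (k + 1) ⁻¹' N').indicator fun _ => (1 : ℝ) := by
    funext ω
    by_cases h : Z (k + 1) ω ∈ N'
    · rw [indicator_of_mem h, indicator_of_mem (mem_preimage.2 h)]
    · rw [indicator_of_notMem h, indicator_of_notMem (fun h' => h (mem_preimage.1 h'))]
  rw [h3, integral_indicator (hZ.measurable _ hm)] at h1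
  have h4 : P (Z (k + 1) ⁻¹' N') = 0 := by
    simpa [Measure.real, ENNReal.toReal_eq_zero_iff] using h1
  rw [ae_iff]
  refine measure_mono_null (fun ω hω => ?_) h4
  exact subset_toMeasurable m N (not_not.1 hω)

end IsMarkovChain

end

/-! ### The Markov property from conditional survival functions. -/

namespace Model

variable {E : Set ℝ} {φ : ℝ → ℝ → ℝ} {f mlo Mup lam : ℝ → ℝ} {κ r L a b x₀ : ℝ}
  (M : Model E φ f mlo Mup κ r a b) (hlam : lam ∈ rateClass f mlo Mup r L a b)
  {Ω : Type*} {𝒢 mΩ : MeasurableSpace Ω} {P : Measure Ω} [IsProbabilityMeasure P]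

include M hlam

/-- The joint law of the current state and the waiting time. -/
lemma map_prodMk_eq_compProd (h𝒢 : 𝒢 ≤ mΩ) {X τ : Ω → ℝ}
    (hX : Measurable[𝒢] X) (hτ : Measurable τ) (hXE : ∀ᵐ ω ∂P, X ω ∈ E)
    (hsurv : ∀ t, 0 ≤ t → P[{ω | t < τ ω}.indicator (fun _ => (1 : ℝ)) | 𝒢]
        =ᵐ[P] fun ω => Real.exp (-cumRate φ lam (X ω) t))
    {A : Set Ω} (hA : MeasurableSet[𝒢] A) :
    (P.restrict A).map (fun ω => (X ω, τ ω)) =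
      ((P.restrict A).map X) ⊗ₘ timeKernel E φ lam := by
  have := M.isMarkovKernel_timeKernel hlam
  have hX' : Measurable X := hX.mono h𝒢 le_rfl
  have hA' : MeasurableSet A := h𝒢 _ hA
  have htail : ∀ (B : Set Ω), MeasurableSet[𝒢] B → ∀ t, 0 ≤ t →
      P ({ω | t < τ ω} ∩ B) = ∫⁻ ω in B, timeKernel E φ lam (X ω) (Ioi t) ∂P := by
    intro B hB t ht
    have hmt : MeasurableSet {ω | t < τ ω} := measurableSet_lt measurable_const hτ
    have hi : Integrable ({ω | t < τ ω}.indicator fun _ => (1 : ℝ)) P :=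
      (integrable_const 1).indicator hmt
    have h1 := setIntegral_condExp h𝒢 hi hB
    have hexp : Integrable (fun ω => Real.exp (-cumRate φ lam (X ω) t)) P :=
      (integrable_condExp (μ := P) (m := 𝒢)
        (f := {ω | t < τ ω}.indicator fun _ => (1 : ℝ))).congr (hsurv t ht)
    rw [setIntegral_congr_ae (h𝒢 _ hB) ((hsurv t ht).mono fun ω hω _ => hω),
      integral_indicator hmt, Measure.restrict_restrict hmt] at h1
    simp only [integral_const, MeasurableSet.univ, measureReal_restrict_apply, univ_inter,
      smul_eq_mul, mul_one] at h1
    rw [← ENNReal.ofReal_toReal (measure_ne_top P ({ω | t < τ ω} ∩ B)), ← Measure.real, ← h1,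
      ofReal_integral_eq_lintegral_ofReal hexp.integrableOn
        (ae_of_all _ fun ω => (Real.exp_pos _).le)]
    refine lintegral_congr_ae (ae_restrict_of_ae ?_)
    filter_upwards [hXE] with ω hω
    rw [M.timeKernel_Ioi hlam hω ht]
  have hIoi0 : ∀ᵐ ω ∂P, timeKernel E φ lam (X ω) (Ioi 0) = 1 := by
    filter_upwards [hXE] with ω hω
    rw [M.timeKernel_Ioi hlam hω le_rfl]
    simp [cumRate]
  -- Survival is prescribed only for t ≥ 0. At t = 0 it already has full mass, so for negative t
  -- both sides equal P B.
  have htail' : ∀ (B : Set Ω), MeasurableSet[𝒢] B → ∀ t,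
      P ({ω | t < τ ω} ∩ B) = ∫⁻ ω in B, timeKernel E φ lam (X ω) (Ioi t) ∂P := by
    intro B hB t
    rcases le_or_gt 0 t with ht | ht
    · exact htail B hB t ht
    · have h1 : ∫⁻ ω in B, timeKernel E φ lam (X ω) (Ioi 0) ∂P = P B := by
        rw [lintegral_congr_ae (ae_restrict_of_ae hIoi0), setLIntegral_one]
      have h2 : ∫⁻ ω in B, timeKernel E φ lam (X ω) (Ioi t) ∂P = P B := by
        refine le_antisymm ?_ ?_
        · refine (lintegral_mono fun ω => prob_le_one).trans ?_
          simp
        · rw [← h1]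
          exact lintegral_mono fun ω => measure_mono (Ioi_subset_Ioi ht.le)
      rw [h2]
      refine le_antisymm (measure_mono inter_subset_right) ?_
      rw [← h1, ← htail B hB 0 le_rfl]
      exact measure_mono (inter_subset_inter_left _ fun ω (hω : 0 < τ ω) => ht.trans hω)
  refine Measure.ext_prod fun {s u} hs hu => ?_
  rw [Measure.compProd_apply_prod hs hu, Measure.map_apply (hX'.prodMk hτ) (hs.prod hu),
    setLIntegral_map hs (Kernel.measurable_coe _ hu) hX']
  -- On a rectangle s × u the condition on X is absorbed into the 𝒢-event B; what remains is an
  -- identity of finite measures in u, which the tails determine.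
  set B := X ⁻¹' s ∩ A
  have hB : MeasurableSet[𝒢] B := MeasurableSet.inter (hX hs) hA
  rw [Measure.restrict_restrict (hX' hs), Measure.restrict_apply (hX'.prodMk hτ (hs.prod hu))]
  have hset : (fun ω => (X ω, τ ω)) ⁻¹' s ×ˢ u ∩ A = τ ⁻¹' u ∩ B := by
    ext ω; simp only [mem_inter_iff, mem_preimage, mem_prod, B]; tauto
  rw [hset]
  have hbind : ∀ v, MeasurableSet v → ((P.restrict B).map X).bind (timeKernel E φ lam) v =
      ∫⁻ ω in B, timeKernel E φ lam (X ω) v ∂P := fun v hv => by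
    rw [Measure.bind_apply hv (Kernel.measurable _).aemeasurable,
      lintegral_map (Kernel.measurable_coe _ hv) hX']
  have hmap : ∀ v, MeasurableSet v → (P.restrict B).map τ v = P (τ ⁻¹' v ∩ B) := fun v hv => by
    rw [Measure.map_apply hτ hv, Measure.restrict_apply (hτ hv)]
  rw [← hbind u hu, ← hmap u hu]
  congr 1
  have hfin : IsFiniteMeasure ((P.restrict B).map τ) := inferInstance
  refine Measure.ext_of_Iic _ _ fun t => ?_
  have huniv : (P.restrict B).map τ univ =
      ((P.restrict B).map X).bind (timeKernel E φ lam) univ := by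
    rw [hbind _ MeasurableSet.univ, hmap _ MeasurableSet.univ]; simp
  have hIoi : (P.restrict B).map τ (Ioi t) =
      ((P.restrict B).map X).bind (timeKernel E φ lam) (Ioi t) := by
    rw [hbind _ measurableSet_Ioi, hmap _ measurableSet_Ioi]; exact htail' B hB t
  have hfin' : ((P.restrict B).map X).bind (timeKernel E φ lam) (Ioi t) ≠ ∞ := by
    rw [← hIoi]; exact measure_ne_top _ _
  rw [← compl_Ioi, measure_compl measurableSet_Ioi (measure_ne_top _ _),
    measure_compl measurableSet_Ioi hfin', huniv, hIoi]

/-- A conditional expectation is characterized by its integrals over 𝒢-events, and on each such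
event the joint law of state and waiting time is known. -/
lemma condExp_comp_jump (h𝒢 : 𝒢 ≤ mΩ) {X τ Y : Ω → ℝ}
    (hX : Measurable[𝒢] X) (hτ : Measurable τ) (hXE : ∀ᵐ ω ∂P, X ω ∈ E)
    (hY : ∀ᵐ ω ∂P, Y ω = jumpMap E φ f (X ω, τ ω))
    (hsurv : ∀ t, 0 ≤ t → P[{ω | t < τ ω}.indicator (fun _ => (1 : ℝ)) | 𝒢]
        =ᵐ[P] fun ω => Real.exp (-cumRate φ lam (X ω) t))
    {G : ℝ → ℝ} (hG : Measurable G) {d : ℝ} (hd : ∀ x, |G x| ≤ d) :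
    P[fun ω => G (Y ω) | 𝒢] =ᵐ[P] fun ω => markovOp (jumpKernel E φ f lam) G (X ω) := by
  have := M.isMarkovKernel_timeKernel hlam
  have := M.isMarkovKernel_jumpKernel hlam
  have hX' : Measurable X := hX.mono h𝒢 le_rfl
  have hJ := M.measurable_jumpMap
  have hYG : (fun ω => G (Y ω)) =ᵐ[P] fun ω => G (jumpMap E φ f (X ω, τ ω)) := by
    filter_upwards [hY] with ω hω
    rw [hω]
  have hT : Measurable (markovOp (jumpKernel E φ f lam) G) := measurable_markovOp hG
  refine (condExp_congr_ae hYG).trans (Filter.EventuallyEq.symm ?_)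
  have hint : Integrable (fun ω => G (jumpMap E φ f (X ω, τ ω))) P :=
    (integrable_const d).mono' (hG.comp (hJ.comp (hX'.prodMk hτ))).aestronglyMeasurable
      (ae_of_all _ fun ω => hd _)
  refine ae_eq_condExp_of_forall_setIntegral_eq h𝒢 hint (fun A _ _ => ?_) (fun A hA _ => ?_)
    (hT.comp hX).aestronglyMeasurable
  · exact ((integrable_const d).mono' (hT.comp hX').aestronglyMeasurable
      (ae_of_all _ fun ω => abs_markovOp_le hd _)).integrableOn
  · have hlaw := M.map_prodMk_eq_compProd hlam h𝒢 hX hτ hXE hsurv hA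
    have e1 : ∫ ω in A, G (jumpMap E φ f (X ω, τ ω)) ∂P =
        ∫ p, G (jumpMap E φ f p) ∂((P.restrict A).map fun ω => (X ω, τ ω)) :=
      (integral_map (f := fun p => G (jumpMap E φ f p)) (hX'.prodMk hτ).aemeasurable
        (hG.comp hJ).aestronglyMeasurable).symm
    have e2 : ∫ ω in A, markovOp (jumpKernel E φ f lam) G (X ω) ∂P =
        ∫ x, markovOp (jumpKernel E φ f lam) G x ∂((P.restrict A).map X) := by
      rw [integral_map hX'.aemeasurable hT.aestronglyMeasurable]
    rw [e1, e2, hlaw, Measure.integral_compProd]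
    · refine integral_congr_ae (ae_of_all _ fun x => ?_)
      simp only
      rw [markovOp, M.jumpKernel_apply hlam, ← M.map_timeKernel hlam,
        integral_map (M.measurable_jumpMap_right x).aemeasurable hG.aestronglyMeasurable]
    · exact (integrable_const d).mono' (hG.comp hJ).aestronglyMeasurable
        (ae_of_all _ fun p => hd _)

lemma isMarkovChain (hx₀ : x₀ ∈ E) {Z : ℕ → Ω → ℝ} (hZ : IsJumpChain φ f lam x₀ P Z) :
    IsMarkovChain P (jumpKernel E φ f lam) x₀ Z := by
  obtain ⟨ℱ, τ, hadapt, hτ, hZ0, hstep, hsurv⟩ := hZ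
  have hMk := M.isMarkovKernel_jumpKernel hlam
  have hZm : ∀ k, Measurable (Z k) := fun k => (hadapt k).mono (ℱ.le k) le_rfl
  -- Survival at time 0 equals 1. Positivity makes the truncation `max · 0` in `jumpMap` harmless
  -- and keeps the chain in E.
  have hτ0 : ∀ k, ∀ᵐ ω ∂P, 0 < τ k ω := by
    intro k
    have hmt : MeasurableSet {ω | 0 < τ k ω} := measurableSet_lt measurable_const (hτ k)
    have h1 := integral_condExp (μ := P) (ℱ.le k)
      (f := {ω | 0 < τ k ω}.indicator fun _ => (1 : ℝ))
    rw [integral_congr_ae (hsurv k 0 le_rfl), integral_indicator hmt] at h1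
    simp only [cumRate, intervalIntegral.integral_same, neg_zero, Real.exp_zero, integral_const,
      probReal_univ, smul_eq_mul, mul_one, MeasurableSet.univ, measureReal_restrict_apply,
      univ_inter] at h1
    have h2 : P {ω | 0 < τ k ω} = 1 := (ENNReal.toReal_eq_one_iff _).1 h1.symm
    exact (prob_compl_eq_zero_iff hmt).2 h2
  have hE : ∀ k, ∀ᵐ ω ∂P, Z k ω ∈ E := by
    intro k
    induction k with
    | zero => filter_upwards [hZ0] with ω hω; rw [hω]; exact hx₀
    | succ k ih =>
      filter_upwards [ih, hτ0 k, hstep k] with ω h1 h2 h3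
      rw [h3]
      exact M.f_flow_mem_E h1 h2.le
  refine ⟨hZm, hZ0, fun i k hik H G hH hG c d hc hd => ?_⟩
  have hjump : ∀ᵐ ω ∂P, Z (k + 1) ω = jumpMap E φ f (Z k ω, τ k ω) := by
    filter_upwards [hE k, hτ0 k, hstep k] with ω h1 h2 h3
    rw [h3, jumpMap, retr_of_mem h1, max_eq_left h2.le]
  have hcond := M.condExp_comp_jump hlam (ℱ.le k) (hadapt k) (hτ k) (hE k) hjump (hsurv k) hG hd
  have hHm : StronglyMeasurable[ℱ k] fun ω => H (Z i ω) :=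
    (hH.comp ((hadapt i).mono (ℱ.mono hik) le_rfl)).stronglyMeasurable
  have hGi : Integrable (fun ω => G (Z (k + 1) ω)) P :=
    (integrable_const d).mono' (hG.comp (hZm _)).aestronglyMeasurable (ae_of_all _ fun ω => hd _)
  have h1 := condExp_stronglyMeasurable_mul_of_bound (ℱ.le k) hHm hGi c
    (ae_of_all _ fun ω => hc _)
  have h2 := integral_condExp (μ := P) (ℱ.le k)
    (f := (fun ω => H (Z i ω)) * fun ω => G (Z (k + 1) ω))
  rw [integral_congr_ae h1] at h2
  simp only [Pi.mul_apply] at h2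
  rw [← h2]
  refine integral_congr_ae ?_
  filter_upwards [hcond] with ω hω
  rw [hω]

end Model

/-! ### Variance of empirical means over a family of functions. -/

/-- Geometric ergodicity of a kernel with invariant law `π`, in the norm weighted by `V`. -/
structure IsErgodicKernel (κ : Kernel ℝ ℝ) (V : ℝ → ℝ) (π : Measure ℝ) (R γ : ℝ) : Prop where
  bind_eq : π.bind κ = π
  one_le : ∀ x, 1 ≤ V x
  integrable : Integrable V π
  nonneg : 0 ≤ R
  rate_nonneg : 0 ≤ γ
  rate_lt_one : γ < 1
  contraction : ∀ h : ℝ → ℝ, Measurable h → ∀ c : ℝ, (∀ x, |h x| ≤ c * V x) →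
    ∀ k x, |(markovOp κ)^[k] h x - ∫ y, h y ∂π| ≤ c * R * V x * γ ^ k

lemma integrable_of_abs_le {α : Type*} [MeasurableSpace α] {μ : Measure α} [IsFiniteMeasure μ]
    {h : α → ℝ} (hm : Measurable h) {c : ℝ} (hc : ∀ x, |h x| ≤ c) : Integrable h μ :=
  (integrable_const c).mono' hm.aestronglyMeasurable (ae_of_all _ hc)

namespace IsErgodicKernel

variable {κ : Kernel ℝ ℝ} [IsMarkovKernel κ] {V : ℝ → ℝ} {π : Measure ℝ} [IsProbabilityMeasure π]
  {R γ : ℝ} (hκ : IsErgodicKernel κ V π R γ)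
include hκ

lemma integral_iter (k : ℕ) {h : ℝ → ℝ} (hm : Measurable h) {c : ℝ} (hc : ∀ x, |h x| ≤ c) :
    ∫ x, (markovOp κ)^[k] h x ∂π = ∫ x, h x ∂π := by
  induction k with
  | zero => rfl
  | succ k ih =>
    rw [← ih, Function.iterate_succ']
    conv_rhs => rw [← hκ.bind_eq]
    rw [integral_bind_eq_integral_markovOp]
    · rfl
    · rw [hκ.bind_eq]
      exact integrable_of_abs_le (measurable_iter_markovOp hm k) (abs_iter_markovOp_le hc k)

end IsErgodicKernel

/-- A finite family of bounded functions, with the bounds of a good basis. -/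
structure IsBoundedFamily {ι : Type*} [Fintype ι] (h : ι → ℝ → ℝ) (B : ι → ℝ) (s₁ s₂ : ℝ) :
    Prop where
  measurable : ∀ l, Measurable (h l)
  abs_le : ∀ l x, |h l x| ≤ B l
  sum_sq_le : ∀ x, ∑ l, h l x ^ 2 ≤ s₁
  sum_mul_le : ∀ x, ∑ l, B l * |h l x| ≤ s₂

namespace IsBoundedFamily

variable {ι : Type*} [Fintype ι] {h : ι → ℝ → ℝ} {B : ι → ℝ} {s₁ s₂ : ℝ}
  (hh : IsBoundedFamily h B s₁ s₂) {π : Measure ℝ} [IsProbabilityMeasure π]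
include hh

lemma bound_nonneg (l : ι) : 0 ≤ B l := (abs_nonneg _).trans (hh.abs_le l 0)

lemma nonneg₁ : 0 ≤ s₁ := (Finset.sum_nonneg fun _ _ => sq_nonneg _).trans (hh.sum_sq_le 0)

lemma nonneg₂ : 0 ≤ s₂ :=
  (Finset.sum_nonneg fun l _ => mul_nonneg (hh.bound_nonneg l) (abs_nonneg _)).trans
    (hh.sum_mul_le 0)

lemma integrable (l : ι) : Integrable (h l) π := integrable_of_abs_le (hh.measurable l) (hh.abs_le l)

lemma integrable_sq (l : ι) : Integrable (fun x => h l x ^ 2) π :=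
  integrable_of_abs_le (c := B l ^ 2) ((hh.measurable l).pow_const 2) fun x => by
    rw [abs_pow]; exact pow_le_pow_left₀ (abs_nonneg _) (hh.abs_le l x) 2

lemma abs_integral_le (l : ι) : |∫ x, h l x ∂π| ≤ B l := by
  simpa using norm_integral_le_of_norm_le_const (μ := π) (f := h l) (ae_of_all _ (hh.abs_le l))

lemma sum_integral_sq_le : ∑ l, ∫ x, h l x ^ 2 ∂π ≤ s₁ := by
  rw [← integral_finsetSum _ fun l _ => hh.integrable_sq l]
  refine (integral_mono (integrable_finsetSum _ fun l _ => hh.integrable_sq l)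
    (integrable_const s₁) hh.sum_sq_le).trans ?_
  simp

lemma integral_sub_sq (l : ι) : ∫ x, (h l x - ∫ y, h l y ∂π) ^ 2 ∂π =
    ∫ x, h l x ^ 2 ∂π - (∫ y, h l y ∂π) ^ 2 := by
  set a := ∫ y, h l y ∂π
  have h1 : ∀ x, (h l x - a) ^ 2 = h l x ^ 2 + (-2 * a) * h l x + a ^ 2 := fun x => by ring
  simp only [h1]
  have h2 : Integrable (fun x => (-2 * a) * h l x) π := (hh.integrable l).const_mul _
  have h3 : Integrable (fun x => h l x ^ 2 + (-2 * a) * h l x) π := (hh.integrable_sq l).add h2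
  rw [integral_add h3 (integrable_const _), integral_add (hh.integrable_sq l) h2,
    integral_const_mul]
  simp only [integral_const, probReal_univ, smul_eq_mul]
  change _ + -2 * a * a + _ = _
  ring

/-- Jensen's inequality for each function, read off from the nonnegativity of its variance. -/
lemma sum_sq_integral_le : ∑ l, (∫ x, h l x ∂π) ^ 2 ≤ s₁ := by
  refine le_trans (Finset.sum_le_sum fun l _ => ?_) (hh.sum_integral_sq_le (π := π))
  have h1 : 0 ≤ ∫ x, (h l x - ∫ y, h l y ∂π) ^ 2 ∂π := integral_nonneg fun x => sq_nonneg _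
  rw [hh.integral_sub_sq] at h1
  linarith

lemma sum_mul_abs_integral_le : ∑ l, B l * |∫ x, h l x ∂π| ≤ s₂ := by
  have hi : ∀ l, Integrable (fun x => B l * |h l x|) π := fun l => (hh.integrable l).abs.const_mul _
  calc _ ≤ ∑ l, ∫ x, B l * |h l x| ∂π := Finset.sum_le_sum fun l _ => by
        rw [integral_const_mul]
        exact mul_le_mul_of_nonneg_left abs_integral_le_integral_abs (hh.bound_nonneg l)
    _ = ∫ x, ∑ l, B l * |h l x| ∂π := (integral_finsetSum _ fun l _ => hi l).symm
    _ ≤ ∫ _, s₂ ∂π := integral_mono (integrable_finsetSum _ fun l _ => hi l)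
        (integrable_const _) hh.sum_mul_le
    _ = s₂ := by simp

end IsBoundedFamily

section Variance

variable {κ : Kernel ℝ ℝ} [IsMarkovKernel κ] {V : ℝ → ℝ} {π : Measure ℝ} [IsProbabilityMeasure π]
  {R γ : ℝ} {ι : Type*} [Fintype ι] {h : ι → ℝ → ℝ} {B : ι → ℝ} {s₁ s₂ x₀ : ℝ}
  {Ω : Type*} [MeasurableSpace Ω] {P : Measure Ω} [IsProbabilityMeasure P] {Z : ℕ → Ω → ℝ}

/-- The function centred under `π`. -/
def centred (π : Measure ℝ) (h : ℝ → ℝ) (x : ℝ) : ℝ := h x - ∫ y, h y ∂π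

omit [IsProbabilityMeasure π] in
lemma IsBoundedFamily.measurable_centred (hh : IsBoundedFamily h B s₁ s₂) (l : ι) :
    Measurable (centred π (h l)) := (hh.measurable l).sub_const _

lemma IsBoundedFamily.abs_centred_le (hh : IsBoundedFamily h B s₁ s₂) (l : ι) (x : ℝ) :
    |centred π (h l) x| ≤ 2 * B l := by
  have h1 := abs_sub (h l x) (∫ y, h l y ∂π)
  have h2 := hh.abs_le l x
  have h3 := hh.abs_integral_le (π := π) l
  rw [centred]
  linarith

omit [IsProbabilityMeasure π] in
lemma iter_centred {g : ℝ → ℝ} (hg : Measurable g) {c : ℝ} (hc : ∀ x, |g x| ≤ c) (k : ℕ) (x : ℝ) :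
    (markovOp κ)^[k] (centred π g) x = (markovOp κ)^[k] g x - ∫ y, g y ∂π := by
  induction k generalizing x with
  | zero => rfl
  | succ k ih =>
    simp only [Function.iterate_succ_apply']
    rw [funext ih, markovOp, integral_sub (integrable_of_abs_le (measurable_iter_markovOp hg k)
      (abs_iter_markovOp_le hc k)) (integrable_const _)]
    simp [markovOp]

/-- Sum of the second moments at time `k`. -/
lemma sum_integral_centred_sq_le (hκ : IsErgodicKernel κ V π R γ)
    (hh : IsBoundedFamily h B s₁ s₂) (hZ : IsMarkovChain P κ x₀ Z) (k : ℕ) :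
    ∑ l, ∫ ω, centred π (h l) (Z k ω) ^ 2 ∂P ≤ s₁ + 4 * s₁ * R * V x₀ * γ ^ k := by
  set F : ℝ → ℝ := fun x => ∑ l, centred π (h l) x ^ 2 with hF
  have hFm : Measurable F := Finset.measurable_sum _ fun l _ =>
    (hh.measurable_centred l).pow_const 2
  have hs₁ := hh.nonneg₁
  have hF0 : ∀ x, 0 ≤ F x := fun x => Finset.sum_nonneg fun _ _ => sq_nonneg _
  -- From (u - v)² ≤ 2u² + 2v², applied to h_l and its mean.
  have hFle : ∀ x, |F x| ≤ 4 * s₁ := fun x => by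
    rw [abs_of_nonneg (hF0 x)]
    calc F x ≤ ∑ l, (2 * h l x ^ 2 + 2 * (∫ y, h l y ∂π) ^ 2) :=
          Finset.sum_le_sum fun l _ => by
            simp only [centred]
            nlinarith [sq_nonneg (h l x + ∫ y, h l y ∂π)]
      _ = 2 * ∑ l, h l x ^ 2 + 2 * ∑ l, (∫ y, h l y ∂π) ^ 2 := by
          rw [Finset.sum_add_distrib, Finset.mul_sum, Finset.mul_sum]
      _ ≤ 4 * s₁ := by
          have := hh.sum_sq_le x
          have := hh.sum_sq_integral_le (π := π)
          linarith
  have hsqi : ∀ (μ : Measure ℝ) [IsProbabilityMeasure μ] l,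
      Integrable (fun x => centred π (h l) x ^ 2) μ := fun μ _ l =>
    integrable_of_abs_le (c := (2 * B l) ^ 2) ((hh.measurable_centred l).pow_const 2) fun x => by
      rw [abs_pow]; exact pow_le_pow_left₀ (abs_nonneg _) (hh.abs_centred_le l x) 2
  have hπF : ∫ x, F x ∂π ≤ s₁ := by
    rw [hF, integral_finsetSum _ fun l _ => hsqi π l]
    refine le_trans (Finset.sum_le_sum fun l _ => ?_) (hh.sum_integral_sq_le (π := π))
    simp only [centred]
    rw [hh.integral_sub_sq]
    linarith [sq_nonneg (∫ y, h l y ∂π)]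
  have hsum : ∑ l, ∫ ω, centred π (h l) (Z k ω) ^ 2 ∂P = ∫ ω, F (Z k ω) ∂P := by
    rw [hF, integral_finsetSum _ fun l _ => ?_]
    exact integrable_of_abs_le (c := (2 * B l) ^ 2)
      (((hh.measurable_centred l).comp (hZ.measurable k)).pow_const 2) fun ω => by
        rw [abs_pow]; exact pow_le_pow_left₀ (abs_nonneg _) (hh.abs_centred_le l _) 2
  rw [hsum, hZ.integral_eq k hFm hFle]
  have hcon := hκ.contraction F hFm (4 * s₁) (fun x => (hFle x).trans
    (le_mul_of_one_le_right (by linarith) (hκ.one_le x))) k x₀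
  linarith [(abs_le.1 hcon).2]

/-- Sum of the covariances between the times `k` and `k + i`. -/
lemma sum_integral_centred_mul_le (hκ : IsErgodicKernel κ V π R γ)
    (hh : IsBoundedFamily h B s₁ s₂) (hZ : IsMarkovChain P κ x₀ Z) (k i : ℕ) :
    ∑ l, ∫ ω, centred π (h l) (Z k ω) * centred π (h l) (Z (k + i) ω) ∂P ≤
      s₂ * R * (∫ x, V x ∂π) * γ ^ i + 2 * s₂ * R ^ 2 * V x₀ * γ ^ (k + i) := by
  have hR := hκ.nonneg
  have hγ := hκ.rate_nonneg
  have hs₂ := hh.nonneg₂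
  have hV0 : ∀ x, 0 < V x := fun x => one_pos.trans_le (hκ.one_le x)
  set u : ι → ℝ → ℝ := fun l => centred π (h l) with hu
  have hum : ∀ l, Measurable (u l) := hh.measurable_centred
  have hub : ∀ l x, |u l x| ≤ 2 * B l := hh.abs_centred_le
  have hTm : ∀ l, Measurable ((markovOp κ)^[i] (u l)) := fun l => measurable_iter_markovOp (hum l) i
  have hTb : ∀ l x, |(markovOp κ)^[i] (u l) x| ≤ 2 * B l := fun l => abs_iter_markovOp_le (hub l) i
  -- The decay in the lag comes from the contraction for the uncentred h_l, with the constant bound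
  -- B l ≤ B l V.
  have hTV : ∀ l x, |(markovOp κ)^[i] (u l) x| ≤ B l * R * V x * γ ^ i := fun l x => by
    rw [hu, iter_centred (hh.measurable l) (hh.abs_le l)]
    exact hκ.contraction (h l) (hh.measurable l) (B l) (fun x => (hh.abs_le l x).trans
      (le_mul_of_one_le_right (hh.bound_nonneg l) (hκ.one_le x))) i x
  set Ψ : ℝ → ℝ := fun x => ∑ l, u l x * (markovOp κ)^[i] (u l) x with hΨ
  have hprodm : ∀ l, Measurable fun x => u l x * (markovOp κ)^[i] (u l) x := fun l =>
    (hum l).mul (hTm l)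
  have hprodb : ∀ l x, |u l x * (markovOp κ)^[i] (u l) x| ≤ 2 * B l * (2 * B l) := fun l x => by
    rw [abs_mul]
    exact mul_le_mul (hub l x) (hTb l x) (abs_nonneg _)
      ((abs_nonneg _).trans (hub l x))
  have hΨm : Measurable Ψ := Finset.measurable_sum _ fun l _ => hprodm l
  have hΨb : ∀ x, |Ψ x| ≤ ∑ l, 2 * B l * (2 * B l) := fun x =>
    (Finset.abs_sum_le_sum_abs _ _).trans (Finset.sum_le_sum fun l _ => hprodb l x)
  -- Summing over l before bounding uses ∑ B_l|h_l| ≤ s₂ and avoids ∑ B_l². As Ψ is dominated by V,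
  -- a second contraction can replace the law of Z_k by π.
  have hΨV : ∀ x, |Ψ x| ≤ 2 * s₂ * R * γ ^ i * V x := fun x => by
    have hc : 0 ≤ R * V x * γ ^ i := mul_nonneg (mul_nonneg hR (hV0 x).le) (pow_nonneg hγ i)
    calc |Ψ x| ≤ ∑ l, |u l x * (markovOp κ)^[i] (u l) x| := Finset.abs_sum_le_sum_abs _ _
      _ ≤ ∑ l, (B l * |h l x| + B l * |∫ y, h l y ∂π|) * (R * V x * γ ^ i) := by
          refine Finset.sum_le_sum fun l _ => ?_
          rw [abs_mul]
          have h1 : |u l x| ≤ |h l x| + |∫ y, h l y ∂π| := abs_sub _ _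
          calc _ ≤ (|h l x| + |∫ y, h l y ∂π|) * (B l * R * V x * γ ^ i) :=
                mul_le_mul h1 (hTV l x) (abs_nonneg _) (by positivity)
            _ = _ := by ring
      _ = (∑ l, B l * |h l x| + ∑ l, B l * |∫ y, h l y ∂π|) * (R * V x * γ ^ i) := by
          rw [← Finset.sum_mul, Finset.sum_add_distrib]
      _ ≤ (s₂ + s₂) * (R * V x * γ ^ i) := mul_le_mul_of_nonneg_right
          (add_le_add (hh.sum_mul_le x) hh.sum_mul_abs_integral_le) hc
      _ = _ := by ring
  -- Under π the iterate of u_l has mean zero, so the other factor u_l may be replaced by h_l. This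
  -- gives s₂ in place of 2 s₂ in the leading term.
  have hπΨ : ∫ x, Ψ x ∂π ≤ s₂ * R * (∫ x, V x ∂π) * γ ^ i := by
    have hTi : ∀ l, Integrable ((markovOp κ)^[i] (u l)) π := fun l =>
      integrable_of_abs_le (hTm l) (hTb l)
    have hmean : ∀ l, ∫ x, (markovOp κ)^[i] (u l) x ∂π = 0 := fun l => by
      rw [hκ.integral_iter i (hum l) (hub l), hu]
      simp only [centred]
      rw [integral_sub (hh.integrable l) (integrable_const _)]
      simp
    have hhT : ∀ l, Integrable (fun x => h l x * (markovOp κ)^[i] (u l) x) π := fun l =>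
      integrable_of_abs_le (c := B l * (2 * B l)) ((hh.measurable l).mul (hTm l)) fun x => by
        rw [abs_mul]
        exact mul_le_mul (hh.abs_le l x) (hTb l x) (abs_nonneg _) (hh.bound_nonneg l)
    have e1 : ∫ x, Ψ x ∂π = ∫ x, ∑ l, h l x * (markovOp κ)^[i] (u l) x ∂π := by
      rw [hΨ, integral_finsetSum _ fun l _ => integrable_of_abs_le (hprodm l) (hprodb l),
        integral_finsetSum _ fun l _ => hhT l]
      refine Finset.sum_congr rfl fun l _ => ?_
      have e2 : ∀ x, u l x * (markovOp κ)^[i] (u l) x = h l x * (markovOp κ)^[i] (u l) x -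
          (∫ y, h l y ∂π) * (markovOp κ)^[i] (u l) x := fun x => by
        rw [hu]; simp only [centred]; ring
      simp only [e2]
      rw [integral_sub (hhT l) ((hTi l).const_mul _), integral_const_mul, hmean, mul_zero, sub_zero]
    rw [e1]
    have hbd : ∀ x, ∑ l, h l x * (markovOp κ)^[i] (u l) x ≤ s₂ * R * γ ^ i * V x := fun x => by
      have hc : 0 ≤ R * V x * γ ^ i := mul_nonneg (mul_nonneg hR (hV0 x).le) (pow_nonneg hγ i)
      calc _ ≤ ∑ l, B l * |h l x| * (R * V x * γ ^ i) := by
            refine Finset.sum_le_sum fun l _ => (le_abs_self _).trans ?_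
            rw [abs_mul]
            calc _ ≤ |h l x| * (B l * R * V x * γ ^ i) :=
                  mul_le_mul_of_nonneg_left (hTV l x) (abs_nonneg _)
              _ = _ := by ring
        _ = (∑ l, B l * |h l x|) * (R * V x * γ ^ i) := by rw [Finset.sum_mul]
        _ ≤ s₂ * (R * V x * γ ^ i) := mul_le_mul_of_nonneg_right (hh.sum_mul_le x) hc
        _ = _ := by ring
    refine (integral_mono (integrable_finsetSum _ fun l _ => hhT l)
      (hκ.integrable.const_mul _) hbd).trans (le_of_eq ?_)
    rw [integral_const_mul]
    ring
  have hsum : ∑ l, ∫ ω, u l (Z k ω) * u l (Z (k + i) ω) ∂P = ∫ ω, Ψ (Z k ω) ∂P := by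
    rw [hΨ, integral_finsetSum _ fun l _ => ?_]
    · exact Finset.sum_congr rfl fun l _ =>
        hZ.integral_mul k i (hum l) (hum l) (hub l) (hub l)
    · exact integrable_of_abs_le ((hprodm l).comp (hZ.measurable k)) fun ω => hprodb l _
  change ∑ l, ∫ ω, u l (Z k ω) * u l (Z (k + i) ω) ∂P ≤ _
  rw [hsum, hZ.integral_eq k hΨm hΨb]
  have hcon := (abs_le.1 (hκ.contraction Ψ hΨm _ hΨV k x₀)).2
  have e3 : 2 * s₂ * R * γ ^ i * R * V x₀ * γ ^ k = 2 * s₂ * R ^ 2 * V x₀ * γ ^ (k + i) := by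
    rw [pow_add]; ring
  rw [e3] at hcon
  linarith

lemma sum_range_pow_sub_le (hγ : 0 ≤ γ) (hγ1 : γ < 1) (n : ℕ) :
    ∑ k ∈ Finset.range n, γ ^ (n - k) ≤ 1 / (1 - γ) := by
  have h1 : ∑ k ∈ Finset.range n, γ ^ (n - k) = ∑ k ∈ Finset.range n, γ ^ (k + 1) := by
    rw [← Finset.sum_range_reflect]
    refine Finset.sum_congr rfl fun k hk => ?_
    have := Finset.mem_range.1 hk
    congr 1; omega
  rw [h1, one_div]
  refine le_trans (Finset.sum_le_sum fun k _ => pow_le_pow_of_le_one hγ hγ1.le k.le_succ) ?_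
  exact sum_le_hasSum _ (fun k _ => pow_nonneg hγ k) (hasSum_geometric_of_lt_one hγ hγ1)

/-- The summed second moment of the partial sums of a centred family. -/
theorem sum_integral_partialSum_sq_le (hκ : IsErgodicKernel κ V π R γ)
    (hh : IsBoundedFamily h B s₁ s₂) (hZ : IsMarkovChain P κ x₀ Z) (n : ℕ) :
    ∑ l, ∫ ω, (∑ k ∈ Finset.range n, centred π (h l) (Z (k + 1) ω)) ^ 2 ∂P ≤
      n * (s₁ + 2 * s₂ * (R / (1 - γ)) * ∫ x, V x ∂π) +
        (4 * s₁ * R * V x₀ / (1 - γ) + 4 * s₂ * R ^ 2 * V x₀ / (1 - γ) ^ 2) := by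
  have hR := hκ.nonneg
  have hγ := hκ.rate_nonneg
  have hγ1 := hκ.rate_lt_one
  have hγ' : 0 < 1 - γ := by linarith
  have hs₁ := hh.nonneg₁
  have hs₂ := hh.nonneg₂
  have hV0 : ∀ x, 0 < V x := fun x => one_pos.trans_le (hκ.one_le x)
  set m := ∫ x, V x ∂π
  have hm0 : 0 ≤ m := integral_nonneg fun x => (hV0 x).le
  have hVx := (hV0 x₀).le
  have hXm : ∀ l k, Measurable fun ω => centred π (h l) (Z k ω) := fun l k =>
    (hh.measurable_centred l).comp (hZ.measurable k)
  have hXX : ∀ l j k, Integrable (fun ω => centred π (h l) (Z j ω) * centred π (h l) (Z k ω)) P :=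
    fun l j k => integrable_of_abs_le (c := 2 * B l * (2 * B l)) ((hXm l j).mul (hXm l k))
      fun ω => by
        rw [abs_mul]
        exact mul_le_mul (hh.abs_centred_le l _) (hh.abs_centred_le l _) (abs_nonneg _)
          ((abs_nonneg _).trans (hh.abs_centred_le (π := π) l 0))
  have hsq : ∀ l n, Integrable (fun ω =>
      (∑ k ∈ Finset.range n, centred π (h l) (Z (k + 1) ω)) ^ 2) P := fun l n => by
    simp only [sq, Finset.sum_mul_sum]
    exact integrable_finsetSum _ fun j _ => integrable_finsetSum _ fun k _ => hXX l _ _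
  -- Each new time adds one variance and twice its covariances with the past. The first two summands
  -- are the stationary part and the others the effect of the starting point.
  have key : ∀ n : ℕ, ∑ l, ∫ ω, (∑ k ∈ Finset.range n, centred π (h l) (Z (k + 1) ω)) ^ 2 ∂P ≤
      ∑ j ∈ Finset.range n, (s₁ + 2 * s₂ * (R / (1 - γ)) * m + 4 * s₁ * R * V x₀ * γ ^ j +
        4 * s₂ * R ^ 2 * V x₀ * (j * γ ^ j)) := by
    intro n
    induction n with
    | zero => simp
    | succ n ih =>
      rw [Finset.sum_range_succ]
      have hexp : ∀ l, ∫ ω, (∑ k ∈ Finset.range (n + 1), centred π (h l) (Z (k + 1) ω)) ^ 2 ∂P =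
          ∫ ω, (∑ k ∈ Finset.range n, centred π (h l) (Z (k + 1) ω)) ^ 2 ∂P +
          2 * ∑ k ∈ Finset.range n,
            ∫ ω, centred π (h l) (Z (k + 1) ω) * centred π (h l) (Z (n + 1) ω) ∂P +
          ∫ ω, centred π (h l) (Z (n + 1) ω) ^ 2 ∂P := fun l => by
        have i1 : Integrable (fun ω => 2 * ∑ k ∈ Finset.range n,
            centred π (h l) (Z (k + 1) ω) * centred π (h l) (Z (n + 1) ω)) P :=
          (integrable_finsetSum _ fun k _ => hXX l _ _).const_mul _
        have i2 : Integrable (fun ω => (∑ k ∈ Finset.range n, centred π (h l) (Z (k + 1) ω)) ^ 2 +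
            2 * ∑ k ∈ Finset.range n,
              centred π (h l) (Z (k + 1) ω) * centred π (h l) (Z (n + 1) ω)) P := (hsq l n).add i1
        rw [← integral_finsetSum _ fun k _ => hXX l _ _, ← integral_const_mul,
          ← integral_add (hsq l n) i1,
          ← integral_add i2 (by simpa only [sq] using hXX l (n + 1) (n + 1))]
        refine integral_congr_ae (ae_of_all _ fun ω => ?_)
        simp only
        rw [Finset.sum_range_succ, ← Finset.sum_mul]
        ring
      rw [Finset.sum_congr rfl fun l _ => hexp l, Finset.sum_add_distrib, Finset.sum_add_distrib,
        ← Finset.mul_sum, Finset.sum_comm]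
      have hd := sum_integral_centred_sq_le hκ hh hZ (n + 1)
      have hc : ∑ k ∈ Finset.range n, ∑ l,
          ∫ ω, centred π (h l) (Z (k + 1) ω) * centred π (h l) (Z (n + 1) ω) ∂P ≤
          s₂ * R * m * (1 / (1 - γ)) + 2 * s₂ * R ^ 2 * V x₀ * (n * γ ^ n) := by
        -- The time k + 1 and the lag n - k add up to n + 1, so the starting-point error is the same
        -- for all k; the total n γ^n is summable in n, which yields (1 - γ)^(-2).
        have h1 : ∀ k ∈ Finset.range n, ∑ l,
            ∫ ω, centred π (h l) (Z (k + 1) ω) * centred π (h l) (Z (n + 1) ω) ∂P ≤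
            s₂ * R * m * γ ^ (n - k) + 2 * s₂ * R ^ 2 * V x₀ * γ ^ n := fun k hk => by
          have hk' := Finset.mem_range.1 hk
          have h2 := sum_integral_centred_mul_le hκ hh hZ (k + 1) (n - k)
          rw [show k + 1 + (n - k) = n + 1 by omega] at h2
          refine h2.trans (add_le_add le_rfl ?_)
          exact mul_le_mul_of_nonneg_left (pow_le_pow_of_le_one hγ hγ1.le n.le_succ)
            (by positivity)
        refine (Finset.sum_le_sum h1).trans ?_
        rw [Finset.sum_add_distrib, ← Finset.mul_sum, Finset.sum_const, Finset.card_range,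
          nsmul_eq_mul]
        have h3 := mul_le_mul_of_nonneg_left (sum_range_pow_sub_le hγ hγ1 n)
          (by positivity : 0 ≤ s₂ * R * m)
        linarith
      have hdn : 4 * s₁ * R * V x₀ * γ ^ (n + 1) ≤ 4 * s₁ * R * V x₀ * γ ^ n :=
        mul_le_mul_of_nonneg_left (pow_le_pow_of_le_one hγ hγ1.le n.le_succ) (by positivity)
      have e1 : 2 * s₂ * (R / (1 - γ)) * m = 2 * (s₂ * R * m * (1 / (1 - γ))) := by ring
      rw [e1] at ih ⊢
      linarith
  refine (key n).trans ?_
  rw [Finset.sum_add_distrib, Finset.sum_add_distrib, Finset.sum_const, Finset.card_range,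
    nsmul_eq_mul, ← Finset.mul_sum, ← Finset.mul_sum, add_assoc]
  refine add_le_add le_rfl (add_le_add ?_ ?_)
  · rw [div_eq_mul_inv]
    exact mul_le_mul_of_nonneg_left (sum_le_hasSum _ (fun k _ => pow_nonneg hγ k)
      (hasSum_geometric_of_lt_one hγ hγ1)) (by positivity)
  · have hs := hasSum_coe_mul_geometric_of_norm_lt_one (𝕜 := ℝ) (r := γ)
      (by rw [Real.norm_eq_abs, abs_of_nonneg hγ]; exact hγ1)
    have h1 := sum_le_hasSum (Finset.range n) (fun k _ => by positivity) hs
    have h2 : γ / (1 - γ) ^ 2 ≤ 1 / (1 - γ) ^ 2 := div_le_div_of_nonneg_right hγ1.le (by positivity)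
    rw [← mul_one_div]
    exact mul_le_mul_of_nonneg_left (h1.trans h2) (by positivity)

end Variance

/-! ### Basis functions: pointwise bounds and the Pythagorean identity. -/

section L2

variable {A : Set ℝ} {ψ₁ ψ₂ : ℝ} {D : ℕ} {S : Submodule ℝ (L2 A)}
  (e : OrthonormalBasis (Fin D) ℝ S)

lemma orthonormal_coe : Orthonormal ℝ fun l => (e l : L2 A) :=
  e.orthonormal.comp_linearIsometry S.subtypeₗᵢ

lemma norm_sq_sum_smul (c : Fin D → ℝ) :
    ‖∑ l, c l • (e l : L2 A)‖ ^ 2 = ∑ l, c l ^ 2 := by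
  rw [← real_inner_self_eq_norm_sq, (orthonormal_coe e).inner_sum]
  simp [sq]

lemma coeFn_sum_smul (c : Fin D → ℝ) :
    ⇑(∑ l, c l • (e l : L2 A)) =ᵐ[volume.restrict A] fun x => ∑ l, c l * (e l : L2 A) x := by
  have h1 : ∀ᵐ x ∂(volume.restrict A), ∀ l, (c l • (e l : L2 A) : L2 A) x = c l * (e l : L2 A) x :=
    ae_all_iff.2 fun l => (Lp.coeFn_smul (c l) (e l : L2 A)).mono fun x hx => hx
  filter_upwards [Lp.coeFn_finsetSum Finset.univ fun l => c l • (e l : L2 A), h1] with x hx h1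
  rw [hx, Finset.sum_apply]
  exact Finset.sum_congr rfl fun l _ => h1 l

lemma measurable_coe (l : Fin D) : Measurable (e l : L2 A) := (Lp.stronglyMeasurable _).measurable

/-- The essential supremum of the `l`-th basis function. -/
def basisBound (l : Fin D) : ℝ := (supNorm A (e l : L2 A)).toReal

variable {e}

lemma supNorm_sq_le (hS : ∀ s ∈ S, supNorm A s ^ 2 ≤ ENNReal.ofReal (ψ₁ * D * ‖s‖ ^ 2))
    (c : Fin D → ℝ) (hψ : 0 ≤ ψ₁) : ∀ᵐ x ∂(volume.restrict A),
      (∑ l, c l * (e l : L2 A) x) ^ 2 ≤ ψ₁ * D * ∑ l, c l ^ 2 := by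
  have hmem : ∑ l, c l • (e l : L2 A) ∈ S :=
    S.sum_mem fun l _ => S.smul_mem _ (e l).2
  have h1 := hS _ hmem
  rw [norm_sq_sum_smul, supNorm, eLpNorm_exponent_top] at h1
  filter_upwards [coeFn_sum_smul e c, enorm_ae_le_eLpNormEssSup
    (⇑(∑ l, c l • (e l : L2 A))) (volume.restrict A)] with x hx hx'
  have h2 := (pow_le_pow_left₀ (zero_le (a := ‖_‖ₑ)) hx' 2).trans h1
  rw [hx, Real.enorm_eq_ofReal_abs, ← ENNReal.ofReal_pow (abs_nonneg _), sq_abs] at h2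
  exact (ENNReal.ofReal_le_ofReal_iff (mul_nonneg (mul_nonneg hψ (Nat.cast_nonneg D))
    (Finset.sum_nonneg fun _ _ => sq_nonneg _))).1 h2

/-- The bound for each fixed linear combination holds off a null set depending on its coefficients.
Rational coefficients give a common null set, density extends the bound to real ones, and the choice
c_l = e_l(x) is extremal. -/
lemma ae_sum_sq_le (hS : ∀ s ∈ S, supNorm A s ^ 2 ≤ ENNReal.ofReal (ψ₁ * D * ‖s‖ ^ 2))
    (hψ : 0 ≤ ψ₁) : ∀ᵐ x ∂(volume.restrict A), ∑ l, (e l : L2 A) x ^ 2 ≤ ψ₁ * D := by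
  have h1 : ∀ᵐ x ∂(volume.restrict A), ∀ q : Fin D → ℚ,
      (∑ l, (q l : ℝ) * (e l : L2 A) x) ^ 2 ≤ ψ₁ * D * ∑ l, (q l : ℝ) ^ 2 :=
    ae_all_iff.2 fun q => supNorm_sq_le hS (fun l => (q l : ℝ)) hψ
  filter_upwards [h1] with x hx
  have hdense : DenseRange (Pi.map fun (_ : Fin D) (q : ℚ) => (q : ℝ)) :=
    DenseRange.piMap fun _ => Rat.denseRange_cast
  have h2 : ∀ c : Fin D → ℝ,
      (∑ l, c l * (e l : L2 A) x) ^ 2 ≤ ψ₁ * D * ∑ l, c l ^ 2 := fun c => by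
    refine hdense.induction_on (p := fun c : Fin D → ℝ =>
      (∑ l, c l * (e l : L2 A) x) ^ 2 ≤ ψ₁ * D * ∑ l, c l ^ 2) c ?_ fun q => hx q
    exact isClosed_le (by fun_prop) (by fun_prop)
  have h3 := h2 fun l => (e l : L2 A) x
  simp only [← sq] at h3
  by_contra hlt
  push Not at hlt
  have h0 : 0 ≤ ψ₁ * D := mul_nonneg hψ (Nat.cast_nonneg D)
  nlinarith

lemma supNorm_lt_top (hS : ∀ s ∈ S, supNorm A s ^ 2 ≤ ENNReal.ofReal (ψ₁ * D * ‖s‖ ^ 2))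
    (l : Fin D) : supNorm A (e l : L2 A) < ∞ := by
  have h1 := (hS _ (e l).2).trans_lt ENNReal.ofReal_lt_top
  by_contra h
  rw [not_lt_top_iff.1 h] at h1
  simp at h1

/-- The points of `A` where the bounds on the basis functions hold. -/
def goodSet (e : OrthonormalBasis (Fin D) ℝ S) (ψ₁ ψ₂ : ℝ) : Set ℝ :=
  A ∩ ({x | ∀ l, |(e l : L2 A) x| ≤ basisBound e l} ∩
    ({x | ∑ l, (e l : L2 A) x ^ 2 ≤ ψ₁ * D} ∩
      {x | ∑ l, basisBound e l * |(e l : L2 A) x| ≤ ψ₂ * D}))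

lemma measurableSet_goodSet (hA : MeasurableSet A) : MeasurableSet (goodSet e ψ₁ ψ₂) := by
  refine hA.inter (MeasurableSet.inter ?_ (MeasurableSet.inter ?_ ?_))
  · have : {x | ∀ l, |(e l : L2 A) x| ≤ basisBound e l} =
        ⋂ l, {x | |(e l : L2 A) x| ≤ basisBound e l} := by
      ext x; simp only [mem_iInter]; rfl
    rw [this]
    exact MeasurableSet.iInter fun l =>
      measurableSet_le (measurable_coe e l).abs measurable_const
  · exact measurableSet_le
      (Finset.measurable_sum _ fun l _ => (measurable_coe e l).pow_const 2) measurable_const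
  · exact measurableSet_le
      (Finset.measurable_sum _ fun l _ => (measurable_coe e l).abs.const_mul _) measurable_const

lemma volume_diff_goodSet (hA : MeasurableSet A)
    (hS : ∀ s ∈ S, supNorm A s ^ 2 ≤ ENNReal.ofReal (ψ₁ * D * ‖s‖ ^ 2)) (hψ₁ : 0 ≤ ψ₁)
    (hψ₂ : 0 ≤ ψ₂) (he : IsGoodBasis A ψ₂ e) : volume (A \ goodSet e ψ₁ ψ₂) = 0 := by
  have h1 : ∀ᵐ x ∂(volume.restrict A), ∀ l, |(e l : L2 A) x| ≤ basisBound e l := by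
    refine ae_all_iff.2 fun l => ?_
    filter_upwards [enorm_ae_le_eLpNormEssSup ⇑(e l : L2 A) (volume.restrict A)] with x hx
    have h2 := supNorm_lt_top hS (e := e) l
    rw [basisBound, ← Real.norm_eq_abs, ← toReal_enorm]
    refine ENNReal.toReal_mono h2.ne ?_
    rwa [supNorm, eLpNorm_exponent_top]
  have h3 : ∀ᵐ x ∂(volume.restrict A), ∑ l, basisBound e l * |(e l : L2 A) x| ≤ ψ₂ * D := by
    filter_upwards [he] with x hx
    have h4 := ENNReal.toReal_le_of_le_ofReal (mul_nonneg hψ₂ (Nat.cast_nonneg D)) hx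
    rw [ENNReal.toReal_sum fun l _ =>
      ENNReal.mul_ne_top (supNorm_lt_top hS l).ne ENNReal.ofReal_ne_top] at h4
    simpa [basisBound, ENNReal.toReal_mul] using h4
  have h4 : ∀ᵐ x ∂(volume.restrict A), x ∈ goodSet e ψ₁ ψ₂ := by
    filter_upwards [h1, ae_sum_sq_le hS hψ₁, h3, ae_restrict_mem hA] with x a1 a2 a3 a4
    exact ⟨a4, a1, a2, a3⟩
  rw [ae_iff, Measure.restrict_apply' hA] at h4
  refine measure_mono_null (fun x hx => ?_) h4
  exact ⟨hx.2, hx.1⟩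

/-- The basis functions, restricted to the good set and extended by `0`. -/
def goodBasis (e : OrthonormalBasis (Fin D) ℝ S) (ψ₁ ψ₂ : ℝ) (l : Fin D) : ℝ → ℝ :=
  (goodSet e ψ₁ ψ₂).indicator fun x => (e l : L2 A) x

/-- Cutting off to the good set turns almost-everywhere bounds into pointwise ones, as needed to
evaluate at the points of the chain. -/
lemma isBoundedFamily_goodBasis (hA : MeasurableSet A) (hψ₁ : 0 ≤ ψ₁) (hψ₂ : 0 ≤ ψ₂) :
    IsBoundedFamily (goodBasis e ψ₁ ψ₂) (basisBound e) (ψ₁ * D) (ψ₂ * D) where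
  measurable l := (measurable_coe e l).indicator (measurableSet_goodSet hA)
  abs_le l x := by
    by_cases hx : x ∈ goodSet e ψ₁ ψ₂
    · rw [goodBasis, indicator_of_mem hx]; exact hx.2.1 l
    · rw [goodBasis, indicator_of_notMem hx, abs_zero]; exact ENNReal.toReal_nonneg
  sum_sq_le x := by
    by_cases hx : x ∈ goodSet e ψ₁ ψ₂
    · simp only [goodBasis, indicator_of_mem hx]; exact hx.2.2.1
    · simp only [goodBasis, indicator_of_notMem hx]; simpa using by positivity
  sum_mul_le x := by
    by_cases hx : x ∈ goodSet e ψ₁ ψ₂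
    · simp only [goodBasis, indicator_of_mem hx]; exact hx.2.2.2
    · simp only [goodBasis, indicator_of_notMem hx]; simpa using by positivity

lemma indicator_eq_goodBasis {l : Fin D} {x : ℝ} (hx : x ∉ A \ goodSet e ψ₁ ψ₂) :
    A.indicator (fun y => (e l : L2 A) y) x = goodBasis e ψ₁ ψ₂ l x := by
  rw [goodBasis]
  by_cases hA : x ∈ A
  · have hg : x ∈ goodSet e ψ₁ ψ₂ := by by_contra h; exact hx ⟨hA, h⟩
    rw [indicator_of_mem hA, indicator_of_mem hg]
  · rw [indicator_of_notMem hA, indicator_of_notMem fun h => hA h.1]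

/-- Pythagoras: changing the coefficients of the projection. -/
lemma sqNorm_sum_sub_eq {ν : ℝ → ℝ} (hν : Measurable ν) (c : Fin D → ℝ)
    (hfin : sqNorm A (fun x => proj A e ν x - ν x) ≠ ∞) :
    sqNorm A (fun x => ∑ l, c l * (e l : L2 A) x - ν x) =
      sqNorm A (fun x => proj A e ν x - ν x) +
        ENNReal.ofReal (∑ l, (c l - ∫ y in A, (e l : L2 A) y * ν y) ^ 2) := by
  set a : Fin D → ℝ := fun l => ∫ y in A, (e l : L2 A) y * ν y with ha
  have hsum : ∀ c : Fin D → ℝ, MemLp (fun x => ∑ l, c l * (e l : L2 A) x) 2 (volume.restrict A) :=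
    fun c => (Lp.memLp (∑ l, c l • (e l : L2 A))).ae_eq (coeFn_sum_smul e c)
  -- Square integrability of ν on A is not known in advance; it follows from the finite bias, the
  -- projection being in L².
  have hνL : MemLp ν 2 (volume.restrict A) := by
    have h1 : MemLp (fun x => proj A e ν x - ν x) 2 (volume.restrict A) := by
      refine ⟨((hsum a).1.sub hν.aestronglyMeasurable), ?_⟩
      rw [sqNorm] at hfin
      refine lt_top_iff_ne_top.2 fun h => hfin ?_
      rw [h]; simp
    have h2 := (hsum a).sub h1
    refine h2.ae_eq (ae_of_all _ fun x => ?_)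
    simp [proj, ha]
  set v : L2 A := hνL.toLp ν with hv
  have hnorm : ∀ c : Fin D → ℝ, sqNorm A (fun x => ∑ l, c l * (e l : L2 A) x - ν x) =
      ENNReal.ofReal (‖∑ l, c l • (e l : L2 A) - v‖ ^ 2) := fun c => by
    have h1 : ⇑(∑ l, c l • (e l : L2 A) - v) =ᵐ[volume.restrict A]
        fun x => ∑ l, c l * (e l : L2 A) x - ν x := by
      filter_upwards [Lp.coeFn_sub (∑ l, c l • (e l : L2 A)) v, coeFn_sum_smul e c,
        hνL.coeFn_toLp] with x h1 h2 h3
      rw [h1, Pi.sub_apply, h2, hv, h3]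
    rw [sqNorm, ← eLpNorm_congr_ae h1, Lp.norm_def, ENNReal.ofReal_pow ENNReal.toReal_nonneg,
      ENNReal.ofReal_toReal (Lp.eLpNorm_ne_top _)]
  have hinner : ∀ l, inner ℝ (e l : L2 A) v = a l := fun l => by
    rw [L2.inner_def, ha]
    refine integral_congr_ae ?_
    filter_upwards [hνL.coeFn_toLp] with x hx
    rw [hv, hx]
    simp [mul_comm]
  have horth : ∀ d : Fin D → ℝ,
      inner ℝ (∑ l, d l • (e l : L2 A)) (∑ l, a l • (e l : L2 A) - v) = 0 := fun d => by
    rw [inner_sub_right, (orthonormal_coe e).inner_sum, sum_inner]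
    simp [inner_smul_left, hinner]
  have hdecomp : ∑ l, c l • (e l : L2 A) - v =
      ∑ l, (c l - a l) • (e l : L2 A) + (∑ l, a l • (e l : L2 A) - v) := by
    simp only [sub_smul, Finset.sum_sub_distrib]
    abel
  have hproj : (fun x => proj A e ν x - ν x) = fun x => ∑ l, a l * (e l : L2 A) x - ν x := rfl
  rw [hproj, hnorm c, hnorm a, ← ENNReal.ofReal_add (sq_nonneg _)
    (Finset.sum_nonneg fun _ _ => sq_nonneg _)]
  congr 1
  rw [hdecomp, norm_add_sq_real, horth, norm_sq_sum_smul]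
  ring

end L2

/-! ### The risk bound. -/

namespace Model

variable {E : Set ℝ} {φ : ℝ → ℝ → ℝ} {f mlo Mup lam ν : ℝ → ℝ} {κ r L a b R γ K x₀ ψ₁ ψ₂ : ℝ}
  (M : Model E φ f mlo Mup κ r a b) (hlam : lam ∈ rateClass f mlo Mup r L a b)
  (hν : IsErgodicDensity E φ f lam ν a b R γ K)
include M hlam hν

omit hlam in
lemma isErgodicKernel (hR : 0 ≤ R) (hγ : 0 ≤ γ) (hγ1 : γ < 1) :
    IsErgodicKernel (jumpKernel E φ f lam) (weight E f a b) (densityMeasure ν) R γ where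
  bind_eq := hν.bind_eq
  one_le := M.one_le_weight
  integrable := hν.integrable
  nonneg := hR
  rate_nonneg := hγ
  rate_lt_one := hγ1
  contraction := hν.contraction

/-- The bias-variance bound for the projection estimator. -/
theorem lintegral_sqNorm_le (hR : 0 ≤ R) (hγ : 0 ≤ γ) (hγ1 : γ < 1) (hx₀ : x₀ ∈ E)
    (hψ₁ : 0 ≤ ψ₁) (hψ₂ : 0 ≤ ψ₂) {A : Set ℝ} (hA : MeasurableSet A) (hA0 : A ⊆ Ici 0)
    {D : ℕ} {S : Submodule ℝ (L2 A)} (e : OrthonormalBasis (Fin D) ℝ S)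
    (hS : ∀ s ∈ S, supNorm A s ^ 2 ≤ ENNReal.ofReal (ψ₁ * D * ‖s‖ ^ 2))
    (he : IsGoodBasis A ψ₂ e) {Ω : Type*} [MeasurableSpace Ω] (P : Measure Ω)
    [IsProbabilityMeasure P] (Z : ℕ → Ω → ℝ) (hZ : IsJumpChain φ f lam x₀ P Z) {n : ℕ}
    (hn : 0 < n) (hD : D ^ 2 ≤ n) :
    ∫⁻ ω, sqNorm A (fun x => estimator A e n (fun k => Z k ω) x - ν x) ∂P ≤
      sqNorm A (fun x => proj A e ν x - ν x) + ENNReal.ofReal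
        ((ψ₁ + ψ₂ * ∫ z in Ici 0, G f ν a b R γ z * ν z) * D / n +
          (4 * ψ₁ * R * weight E f a b x₀ / (1 - γ) +
            4 * ψ₂ * R ^ 2 * weight E f a b x₀ / (1 - γ) ^ 2) / n) := by
  -- If the bias is infinite there is nothing to prove.
  by_cases hfin : sqNorm A (fun x => proj A e ν x - ν x) = ∞
  · rw [hfin, top_add]; exact le_top
  have := M.isMarkovKernel_jumpKernel hlam
  have := hν.prob
  have hchain := M.isMarkovChain hlam hx₀ hZ
  have hκ := M.isErgodicKernel hν hR hγ hγ1
  have hfam := isBoundedFamily_goodBasis (e := e) hA hψ₁ hψ₂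
  have hnull := volume_diff_goodSet hA hS hψ₁ hψ₂ he
  set h := goodBasis e ψ₁ ψ₂
  have hcoef : ∀ l, ∫ y in A, (e l : L2 A) y * ν y = ∫ y, h l y ∂(densityMeasure ν) := fun l => by
    rw [integral_densityMeasure hν.measurable hν.nonneg]
    have h1 : ∫ x in Ici 0, h l x * ν x =
        ∫ x in Ici 0, A.indicator (fun y => (e l : L2 A) y * ν y) x := by
      refine integral_congr_ae (ae_restrict_of_ae ?_)
      filter_upwards [measure_eq_zero_iff_ae_notMem.1 hnull] with x hx
      have h2 : h l x = A.indicator (fun y => (e l : L2 A) y) x := (indicator_eq_goodBasis hx).symm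
      rw [h2]
      by_cases hxA : x ∈ A
      · rw [indicator_of_mem hxA, indicator_of_mem hxA]
      · rw [indicator_of_notMem hxA, indicator_of_notMem hxA, zero_mul]
    rw [h1, integral_indicator hA, Measure.restrict_restrict hA, inter_eq_left.2 hA0]
  -- The empirical sums start at k = 1, so the deterministic initial state, which might be a bad
  -- point, is never evaluated.
  have hgood : ∀ᵐ ω ∂P, ∀ k, Z (k + 1) ω ∉ A \ goodSet e ψ₁ ψ₂ := ae_all_iff.2 fun k =>
    hchain.ae_notMem (fun x => (M.jumpKernel_absolutelyContinuous hlam x).trans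
      Measure.absolutelyContinuous_restrict) hnull k
  have hn0 : (0 : ℝ) < n := by exact_mod_cast hn
  set T : Fin D → Ω → ℝ := fun l ω =>
    ∑ k ∈ Finset.range n, centred (densityMeasure ν) (h l) (Z (k + 1) ω) with hT
  have hemp : ∀ᵐ ω ∂P, ∀ l, empCoeff A e n (fun k => Z k ω) l - ∫ y in A, (e l : L2 A) y * ν y =
      (1 / (n : ℝ)) * T l ω := by
    filter_upwards [hgood] with ω hω l
    have h1 : ∑ k ∈ Finset.Icc 1 n, A.indicator (fun y => (e l : L2 A) y) (Z k ω) =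
        ∑ k ∈ Finset.range n, h l (Z (k + 1) ω) := by
      rw [← Finset.Ico_add_one_right_eq_Icc, Finset.sum_Ico_eq_sum_range, Nat.add_sub_cancel]
      refine Finset.sum_congr rfl fun k _ => ?_
      rw [add_comm 1 k]
      exact indicator_eq_goodBasis (hω k)
    rw [empCoeff, h1, hcoef, hT]
    simp only [centred]
    rw [Finset.sum_sub_distrib, Finset.sum_const, Finset.card_range, nsmul_eq_mul]
    field_simp
  have hTm : ∀ l, Measurable (T l) := fun l => Finset.measurable_sum _ fun k _ =>
    (hfam.measurable_centred l).comp (hchain.measurable (k + 1))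
  have hTb : ∀ l ω, |T l ω| ≤ n * (2 * basisBound e l) := fun l ω => by
    refine (Finset.abs_sum_le_sum_abs _ _).trans ?_
    refine (Finset.sum_le_sum fun k _ => hfam.abs_centred_le l (Z (k + 1) ω)).trans ?_
    rw [Finset.sum_const, Finset.card_range, nsmul_eq_mul]
  have hTi : ∀ l, Integrable (fun ω => T l ω ^ 2) P := fun l =>
    integrable_of_abs_le (c := (n * (2 * basisBound e l)) ^ 2) ((hTm l).pow_const 2) fun ω => by
      rw [abs_pow]; exact pow_le_pow_left₀ (abs_nonneg _) (hTb l ω) 2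
  have hpyth : ∀ᵐ ω ∂P, sqNorm A (fun x => estimator A e n (fun k => Z k ω) x - ν x) =
      sqNorm A (fun x => proj A e ν x - ν x) +
        ENNReal.ofReal ((1 / (n : ℝ)) ^ 2 * ∑ l, T l ω ^ 2) := by
    filter_upwards [hemp] with ω hω
    have h1 := sqNorm_sum_sub_eq hν.measurable
      (fun l => empCoeff A e n (fun k => Z k ω) l) hfin
    refine h1.trans ?_
    congr 2
    rw [Finset.mul_sum]
    exact Finset.sum_congr rfl fun l _ => by rw [hω l, mul_pow]
  rw [lintegral_congr_ae hpyth, lintegral_add_left measurable_const, lintegral_const, measure_univ,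
    mul_one]
  refine add_le_add le_rfl ?_
  rw [← ofReal_integral_eq_lintegral_ofReal
    ((integrable_finsetSum _ fun l _ => hTi l).const_mul _)
    (ae_of_all _ fun ω => mul_nonneg (sq_nonneg _) (Finset.sum_nonneg fun _ _ => sq_nonneg _)),
    integral_const_mul, integral_finsetSum _ fun l _ => hTi l]
  refine ENNReal.ofReal_le_ofReal ?_
  have hvar := sum_integral_partialSum_sq_le hκ hfam hchain n
  have hw : 0 ≤ weight E f a b x₀ := zero_le_one.trans (M.one_le_weight x₀)
  have hγ' : 0 < 1 - γ := by linarith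
  set c := 4 * ψ₁ * R * weight E f a b x₀ / (1 - γ) +
    4 * ψ₂ * R ^ 2 * weight E f a b x₀ / (1 - γ) ^ 2 with hc
  have hc0 : 0 ≤ c := by positivity
  -- The starting-point error is c D/n² after normalization, and D ≤ D² ≤ n turns it into c/n.
  have hDn : (D : ℝ) ≤ n := by
    exact_mod_cast (Nat.le_self_pow two_ne_zero D).trans hD
  rw [M.integral_G_eq hlam hν]
  set m := ∫ x, weight E f a b x ∂(densityMeasure ν)
  have e1 : (n : ℝ) * (ψ₁ * D + 2 * (ψ₂ * D) * (R / (1 - γ)) * m) +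
      (4 * (ψ₁ * D) * R * weight E f a b x₀ / (1 - γ) +
        4 * (ψ₂ * D) * R ^ 2 * weight E f a b x₀ / (1 - γ) ^ 2) =
      n * ((ψ₁ + ψ₂ * (2 * (R / (1 - γ)) * m)) * D) + c * D := by
    rw [hc]; ring
  rw [e1] at hvar
  calc _ ≤ (1 / (n : ℝ)) ^ 2 * (n * ((ψ₁ + ψ₂ * (2 * (R / (1 - γ)) * m)) * D) + c * n) := by
        refine mul_le_mul_of_nonneg_left (hvar.trans ?_) (sq_nonneg _)
        exact add_le_add le_rfl (mul_le_mul_of_nonneg_left hDn hc0)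
    _ = _ := by field_simp

end Model
end PDMP

end

theorem mainTheorem4
    (E : Set ℝ) (hE : E = Ici 0 ∨ E = Ioi 0)
    (φ : ℝ → ℝ → ℝ) (hφ : PDMP.IsFlow E φ)
    (f : ℝ → ℝ) (hf : PDMP.IsJumpMap f)
    (mlo Mup : ℝ → ℝ) (κ : ℝ) (hb : PDMP.Bounds E φ f mlo Mup κ)
    (i₁ i₂ : ℝ) (hi₁ : 0 < i₁) (hi₂ : i₁ < i₂)
    (r L a b : ℝ) (hL : 0 < L) (ha : 0 < a) (hb_pos : 0 < b)
    (hr : i₂ < r) (hr' : PDMP.rMin f κ b ≤ r) :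
    ∃ (R γ K : ℝ) (ν : (ℝ → ℝ) → ℝ → ℝ), 0 < R ∧ 0 < γ ∧ γ < 1 ∧
      (∀ lam ∈ PDMP.rateClass f mlo Mup r L a b,
        PDMP.IsStationaryDensity E φ f lam (ν lam) ∧
        PDMP.Contraction E φ f lam (ν lam) a b R γ ∧
        IntegrableOn (fun z => PDMP.V f a b z * ν lam z) (Ici 0) ∧
        ∫ z in Ici 0, PDMP.V f a b z * ν lam z ≤ K) ∧
      ∀ x₀ ∈ E, ∀ ψ₁ ψ₂ : ℝ, 0 < ψ₁ → 0 < ψ₂ → ∃ c : ℝ,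
        ∀ lam ∈ PDMP.rateClass f mlo Mup r L a b,
        ∀ A : Set ℝ, IsCompact A → A ⊆ Ici 0 → f '' Icc i₁ i₂ ⊆ A →
        ∀ S : ℕ → Submodule ℝ (PDMP.L2 A), PDMP.IsModelSequence A ψ₁ S →
        ∀ (m : ℕ) (e : OrthonormalBasis (Fin (finrank ℝ (S m))) ℝ (S m)),
          PDMP.IsGoodBasis A ψ₂ e →
        ∀ (Ω : Type*) [MeasurableSpace Ω] (P : Measure Ω) [IsProbabilityMeasure P]
          (Z : ℕ → Ω → ℝ), PDMP.IsJumpChain φ f lam x₀ P Z →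
        ∀ n : ℕ, 0 < n → finrank ℝ (S m) ^ 2 ≤ n →
          ∫⁻ ω, PDMP.sqNorm A (fun x => PDMP.estimator A e n (fun k => Z k ω) x - ν lam x) ∂P
            ≤ PDMP.sqNorm A (fun x => PDMP.proj A e (ν lam) x - ν lam x)
              + ENNReal.ofReal
                ((ψ₁ + ψ₂ * ∫ z in Ici 0, PDMP.G f (ν lam) a b R γ z * ν lam z)
                    * finrank ℝ (S m) / n + c / n) := by
  have M : PDMP.Model E φ f mlo Mup κ r a b :=
    ⟨hE, hφ, hf, hb, hi₁.trans (hi₂.trans hr), ha, hb_pos⟩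
  obtain ⟨R, γ, K, hR, hγ, hγ1, herg⟩ := M.exists_isErgodicDensity L
  choose! ν hν using fun lam hlam => (herg lam hlam).2
  -- The witness for `c` is left to unification with `lintegral_sqNorm_le`: it involves R, γ, ψ₁, ψ₂
  -- and the weight at x₀, but not `lam`.
  refine ⟨R, γ, 2 * K, ν, hR, hγ, hγ1, fun lam hlam => ?_, fun x₀ hx₀ ψ₁ ψ₂ hψ₁ hψ₂ => ⟨_,
    fun lam hlam A hA hA0 _ S hS m e he Ω _ P _ Z hZ n hn hD =>
      M.lintegral_sqNorm_le hlam (hν lam hlam) hR.le hγ.le hγ1 hx₀ hψ₁.le hψ₂.le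
        hA.measurableSet hA0 e (hS.sup_le m) he P Z hZ hn hD⟩⟩
  have h := hν lam hlam
  exact ⟨M.isStationaryDensity hlam h, M.contraction_of_isErgodicDensity hlam h,
    M.integrableOn_V hlam h, (M.integral_V_eq hlam h).trans_le h.integral_le⟩
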